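/- A \emph{stochastic graph} (locational uncertainty model) consists of $n\ge 2$ nodes, $m$ points with a rational-valued metric $\mathrm{d}$ given by its distance matrix, and rational numbers $p_{vs}\ge 0$ with $\sum_s p_{vs}=1$ for each node $v$; the nodes are located independently, node $v$ at point $s$ with probability $p_{vs}$ (several nodes may be at the same point). For a realization $r=(r_1,\dots,r_n)$ let $\mathsf{CC}(r)$ be the minimum total length of a cycle cover of the nodes, that is, of a collection of vertex-disjoint cycles, each with at least two nodes, such that every node lies on exactly one of them; the edge between nodes $v$ and $w$ has length $\mathrm{d}(r_v,r_w)$, and a cycle on exactly two nodes has length twice their distance. Let $\mathbb{E}[\mathsf{CC}]=\sum_{r}\bigl(\prod_{v}p_{v r_v}\bigr)\mathsf{CC}(r)$. \textbf{Theorem.} There is an FPRAS for $\mathbb{E}[\mathsf{CC}]$: there is a randomized algorithm that, given a stochastic graph and a rational number $\epsilon>0$, returns a rational number $A$ with $$\Pr\bigl[(1-\epsilon)\,\mathbb{E}[\mathsf{CC}]\le A\le(1+\epsilon)\,\mathbb{E}[\mathsf{CC}]\bigr]\ge \tfrac34,$$ and whose running time (on a random access machine with fair coin flips, under the logarithmic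 cost criterion) is bounded, for every outcome of the coins, by a polynomial in the bit length of the input and $1/\epsilon$. -/

import Mathlib

/-! ## Randomized random access machines with logarithmic cost

Structured programs over integer registers and integer arrays, with fair coin flips.  Every
evaluation step is charged the bit length of the integer it produces, so running times are
polynomially related to those of probabilistic Turing machines. -/

namespace RAM

/-- The number of bits of an integer, including one for its sign. -/
def bits (z : ℤ) : ℕ := z.natAbs.size + 1

/-- Arithmetic instructions. -/
inductive Op where
  | add
  | sub
  | mul
  | div

/-- Meaning of the arithmetic instructions; `div` rounds as `Int.ediv`, and `x / 0 = 0`. -/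
def Op.eval : Op → ℤ → ℤ → ℤ
  | .add, x, y => x + y
  | .sub, x, y => x - y
  | .mul, x, y => x * y
  | .div, x, y => x / y

/-- Expressions: constants, registers, array cells with a computed address, arithmetic. -/
inductive Expr where
  | const (c : ℤ)
  | reg (i : ℕ)
  | arr (a : ℕ) (idx : Expr)
  | bin (o : Op) (e₁ e₂ : Expr)

/-- Memory: registers, arrays indexed by integers, and the number of coins used so far.  A program
mentions only finitely many registers and array names. -/
structure State where
  reg : ℕ → ℤ
  arr : ℕ → ℤ → ℤ
  used : ℕ

/-- The value of an expression. -/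
def Expr.eval (s : State) : Expr → ℤ
  | .const c => c
  | .reg i => s.reg i
  | .arr a idx => s.arr a (idx.eval s)
  | .bin o e₁ e₂ => o.eval (e₁.eval s) (e₂.eval s)

/-- The cost of evaluating an expression: every subexpression, addresses included, is charged the
bit length of its value. -/
def Expr.cost (s : State) : Expr → ℕ
  | .const c => bits c
  | .reg i => bits (s.reg i)
  | .arr a idx => idx.cost s + bits (s.arr a (idx.eval s))
  | .bin o e₁ e₂ => e₁.cost s + e₂.cost s + bits (o.eval (e₁.eval s) (e₂.eval s))

/-- Programs.  Tests (`ite`, `loop`) succeed when the expression is positive. -/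
inductive Prog where
  | skip
  | set (i : ℕ) (e : Expr)
  | store (a : ℕ) (idx e : Expr)
  | flip (i : ℕ)
  | seq (c₁ c₂ : Prog)
  | ite (e : Expr) (c₁ c₂ : Prog)
  | loop (e : Expr) (c : Prog)

/-- `Exec ω c s s' t`: with coin outcomes `ω 0, ω 1, …`, the program `c` started in memory `s`
halts in memory `s'` after time `t`. -/
inductive Exec (ω : ℕ → Bool) : Prog → State → State → ℕ → Prop
  | skip (s : State) : Exec ω .skip s s 1
  | set (s : State) (i : ℕ) (e : Expr) :
      Exec ω (.set i e) s { s with reg := Function.update s.reg i (e.eval s) } (e.cost s)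
  | store (s : State) (a : ℕ) (idx e : Expr) :
      Exec ω (.store a idx e) s
        { s with arr := Function.update s.arr a
                          (Function.update (s.arr a) (idx.eval s) (e.eval s)) }
        (idx.cost s + e.cost s)
  | flip (s : State) (i : ℕ) :
      Exec ω (.flip i) s
        { s with reg := Function.update s.reg i (if ω s.used then 1 else 0),
                 used := s.used + 1 } 1
  | seq {c₁ c₂ : Prog} {s s₁ s₂ : State} {t₁ t₂ : ℕ} :
      Exec ω c₁ s s₁ t₁ → Exec ω c₂ s₁ s₂ t₂ → Exec ω (.seq c₁ c₂) s s₂ (t₁ + t₂)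
  | ite_pos {e : Expr} {c₁ c₂ : Prog} {s s' : State} {t : ℕ} :
      0 < e.eval s → Exec ω c₁ s s' t → Exec ω (.ite e c₁ c₂) s s' (e.cost s + t)
  | ite_neg {e : Expr} {c₁ c₂ : Prog} {s s' : State} {t : ℕ} :
      ¬ 0 < e.eval s → Exec ω c₂ s s' t → Exec ω (.ite e c₁ c₂) s s' (e.cost s + t)
  | loop_done {e : Expr} {c : Prog} {s : State} :
      ¬ 0 < e.eval s → Exec ω (.loop e c) s s (e.cost s)
  | loop_step {e : Expr} {c : Prog} {s s₁ s₂ : State} {t₁ t₂ : ℕ} :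
      0 < e.eval s → Exec ω c s s₁ t₁ → Exec ω (.loop e c) s₁ s₂ t₂ →
      Exec ω (.loop e c) s s₂ (e.cost s + t₁ + t₂)

/-- For fixed coin outcomes the final memory and the running time are unique. -/
theorem Exec.unique {ω : ℕ → Bool} {c : Prog} {s s₁ s₂ : State} {t₁ t₂ : ℕ}
    (h₁ : Exec ω c s s₁ t₁) (h₂ : Exec ω c s s₂ t₂) : s₁ = s₂ ∧ t₁ = t₂ := by
  induction h₁ generalizing s₂ t₂ with
  | skip s => cases h₂; exact ⟨rfl, rfl⟩
  | set s i e => cases h₂; exact ⟨rfl, rfl⟩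
  | store s a idx e => cases h₂; exact ⟨rfl, rfl⟩
  | flip s i => cases h₂; exact ⟨rfl, rfl⟩
  | seq _ _ ih₁ ih₂ =>
    cases h₂ with
    | seq k₁ k₂ =>
      obtain ⟨rfl, rfl⟩ := ih₁ k₁
      obtain ⟨rfl, rfl⟩ := ih₂ k₂
      exact ⟨rfl, rfl⟩
  | ite_pos hp _ ih =>
    cases h₂ with
    | ite_pos _ k => obtain ⟨rfl, rfl⟩ := ih k; exact ⟨rfl, rfl⟩
    | ite_neg hn _ => exact absurd hp hn
  | ite_neg hn _ ih =>
    cases h₂ with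
    | ite_pos hp _ => exact absurd hp hn
    | ite_neg _ k => obtain ⟨rfl, rfl⟩ := ih k; exact ⟨rfl, rfl⟩
  | loop_done hn =>
    cases h₂ with
    | loop_done _ => exact ⟨rfl, rfl⟩
    | loop_step hp _ _ => exact absurd hp hn
  | loop_step hp _ _ ih₁ ih₂ =>
    cases h₂ with
    | loop_done hn => exact absurd hp hn
    | loop_step _ k₁ k₂ =>
      obtain ⟨rfl, rfl⟩ := ih₁ k₁
      obtain ⟨rfl, rfl⟩ := ih₂ k₂
      exact ⟨rfl, rfl⟩

/-- `Returns ω c s q`: the program halts, and the rational number that it writes into registers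
`0` (numerator) and `1` (denominator) is `q`. -/
def Returns (ω : ℕ → Bool) (c : Prog) (s : State) (q : ℚ) : Prop :=
  ∃ s' t, Exec ω c s s' t ∧ s'.reg 1 ≠ 0 ∧ q = (s'.reg 0 : ℚ) / (s'.reg 1 : ℚ)

/-- The coin outcomes given by a finite string; the positions after its end are irrelevant for a
run that takes at most `T` steps, since every flip takes one step. -/
def coins {T : ℕ} (w : Fin T → Bool) : ℕ → Bool :=
  fun i => if h : i < T then w ⟨i, h⟩ else false

/-- The probability of an event over `T` independent fair coins. -/
noncomputable def coinProb (T : ℕ) (E : (Fin T → Bool) → Prop) : ℝ :=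
  (Nat.card {w : Fin T → Bool // E w} : ℝ) / 2 ^ T

/-- The program `c` is a fully polynomial randomized approximation scheme for `f`, where `load x ε`
is the initial memory that holds the instance `x` and the accuracy `ε`, and `size x ε` is its
bit size: there is a polynomial `P` such that for every instance `x` and every rational `ε > 0` all
runs halt within time `T = P (size + ⌈1/ε⌉)`, and with probability at least `3/4` the returned
number is within the factors `1 - ε` and `1 + ε` of `f x`. -/
def IsFPRAS {X : Type} (load : X → ℚ → State) (size : X → ℚ → ℕ) (f : X → ℝ) (c : Prog) : Prop :=
  ∃ P : Polynomial ℕ, ∀ (x : X) (ε : ℚ), 0 < ε →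
    ∀ T : ℕ, T = P.eval (size x ε + ⌈1 / ε⌉₊) →
      (∀ w : Fin T → Bool, ∃ s' t, Exec (coins w) c (load x ε) s' t ∧ t ≤ T) ∧
      3 / 4 ≤ coinProb T (fun w => ∃ q : ℚ, Returns (coins w) c (load x ε) q ∧
        (1 - (ε : ℝ)) * f x ≤ (q : ℝ) ∧ (q : ℝ) ≤ (1 + (ε : ℝ)) * f x)

end RAM

/-! ## Cycle covers -/

/-- A cycle cover of the node set `V`: a collection of cycles (each has at least two nodes, and
two-node cycles are allowed) such that every node lies on exactly one of them.  A cycle is given as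
the cyclic permutation that moves each of its nodes to the next one. -/
def IsCycleCover {V : Type} [Fintype V] [DecidableEq V] (C : Finset (Equiv.Perm V)) : Prop :=
  (∀ c ∈ C, c.IsCycle) ∧ ∀ v : V, ∃! c, c ∈ C ∧ v ∈ c.support

/-- The total length of a collection of cycles under edge lengths `len`.  A two-node cycle
contributes twice the distance of its nodes. -/
def coverLength {V : Type} [Fintype V] [DecidableEq V] (len : V → V → ℚ)
    (C : Finset (Equiv.Perm V)) : ℚ :=
  ∑ c ∈ C, ∑ v ∈ c.support, len v (c v)

/-! ## Stochastic graphs in the locational uncertainty model -/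

/-- A stochastic graph: `n` nodes, `m` points with a metric `d`, and independent locations: node `v`
is at point `s` with probability `p v s`.  Nodes may share points. -/
structure StochasticGraph where
  n : ℕ
  m : ℕ
  two_le_n : 2 ≤ n
  d : Fin m → Fin m → ℚ
  d_eq_zero : ∀ s t, d s t = 0 ↔ s = t
  d_comm : ∀ s t, d s t = d t s
  d_triangle : ∀ s t u, d s u ≤ d s t + d t u
  p : Fin n → Fin m → ℚ
  p_nonneg : ∀ v s, 0 ≤ p v s
  p_sum : ∀ v, ∑ s, p v s = 1

namespace StochasticGraph

/-- The length of a minimum cycle cover when node `v` is located at point `r v`. -/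
noncomputable def minCycleCover (G : StochasticGraph) (r : Fin G.n → Fin G.m) : ℝ :=
  ⨅ C : {C : Finset (Equiv.Perm (Fin G.n)) // IsCycleCover C},
    (coverLength (fun v w => G.d (r v) (r w)) C.1 : ℝ)

/-- The expected length of the minimum cycle cover, over all realizations. -/
noncomputable def expectedCycleCover (G : StochasticGraph) : ℝ :=
  ∑ r : Fin G.n → Fin G.m, (∏ v, (G.p v (r v) : ℝ)) * G.minCycleCover r

/-- An `a × b` table of integers stored row by row in an array, zero outside. -/
def table {a b : ℕ} (f : Fin a → Fin b → ℤ) (k : ℤ) : ℤ :=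
  if h : 0 ≤ k ∧ k.toNat < a * b then
    f (finProdFinEquiv.symm ⟨k.toNat, h.2⟩).1 (finProdFinEquiv.symm ⟨k.toNat, h.2⟩).2
  else 0

/-- The initial memory: `n`, `m` and the numerator and denominator of `ε` in registers `0` to `3`,
numerators and denominators of the distances in arrays `0` and `1`, those of the probabilities in
arrays `2` and `3`, and zeros elsewhere. -/
def load (G : StochasticGraph) (ε : ℚ) : RAM.State where
  reg
    | 0 => (G.n : ℤ)
    | 1 => (G.m : ℤ)
    | 2 => ε.num
    | 3 => (ε.den : ℤ)
    | _ => 0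
  arr
    | 0 => table fun s t => (G.d s t).num
    | 1 => table fun s t => ((G.d s t).den : ℤ)
    | 2 => table fun v s => (G.p v s).num
    | 3 => table fun v s => ((G.p v s).den : ℤ)
    | _ => fun _ => 0
  used := 0

/-- The number of bits of a rational number. -/
def ratBits (q : ℚ) : ℕ := RAM.bits q.num + RAM.bits q.den

/-- The size of the input: the number of bits of all its entries. -/
def size (G : StochasticGraph) (ε : ℚ) : ℕ :=
  RAM.bits G.n + RAM.bits G.m + ratBits ε
    + ∑ s, ∑ t, ratBits (G.d s t) + ∑ v, ∑ s, ratBits (G.p v s)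

end StochasticGraph

/-!
Expected minimum cycle covers are estimated by importance sampling, with the nearest-neighbour
lengths as guide.

For a realization `r` let `NN r` be the sum of the distances of the nodes to their nearest
neighbours.  Every cycle cover has length at least `NN r`, and some cycle cover has length at most
`2 * NN r` (`CycleCover.exists_derangement_le`), since the map to nearest neighbours can be rerouted
into a permutation without fixed points.  The sum `Z r` of the distances `d (r v) (r w)` over all
pairs in which `w` is a nearest neighbour of `v` lies between `NN r` and `n * NN r`, so the ratio of
the minimum cycle cover to `Z r` lies in `[1 / n, 2]`.

Drawing `r` with probability proportional to `P r * Z r` is easy: given that `v` is at `s` and its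
nearest neighbour `w` at `t`, the other nodes are independent, each conditioned on having distance at
least `d s t` from `s`.  After clearing denominators this becomes a set of integer tickets, decoded
into realizations by `Ticket.loc`, in which every realization has `P r * Z r` tickets up to a constant
factor (`Ticket.sum_tickets`).  The expectation is therefore a known constant times the average of
the ratio over all tickets.  As the ratio is bounded above and below polynomially, Chebyshev's
inequality shows that polynomially many samples suffice (`Sampling.le_card_accurate`).  All samples
are the base-`M` digits of one random number formed by the coins, `M` being the number of tickets.

For one ticket the minimum cycle cover, an assignment problem, is solved approximately by the auction
algorithm with distances rounded to multiples of `Z r / S` (`Auction.approxCover_spec`); this loses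
at most `n / S` in the ratio, and the rounded problem has polynomially bounded prices.

The machine model enters through a class of functions `RAM.PolyComp`, computable by a program in
polynomial time for every placement of variables in registers.  It is closed under arithmetic, case
distinctions, bounded sums, products and searches, and bounded iteration with results of polynomial
bit length.  Since only polynomiality matters, intermediate results are recomputed rather than stored,
and the state of the auction is kept in a single integer.  `RAM.exists_randomized_prog` puts the loop
that flips the coins in front of such functions.
-/

/-! ### Polynomial-time computable functions -/

namespace RAM

open Finset

/-- A family of inputs: initial memories, sizes, and the number of registers that hold input. -/
structure Source where
  X : Type
  load : X → State
  size : X → ℕ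
  regs : ℕ

/-- A context: an input together with the values of `len` local variables.  The type `I` ranges over
inputs with local variables, `val z j` is the value of variable `j`. -/
structure Ctx (S : Source) where
  I : Type
  base : I → S.X
  size : I → ℕ
  len : ℕ
  val : I → ℕ → ℕ
  base_le : ∀ z, S.size (base z) ≤ size z

namespace Ctx

variable {S : Source} (Γ : Ctx S)

/-- The context with no local variables. -/
def nil (S : Source) : Ctx S where
  I := S.X
  base := id
  size := S.size
  len := 0
  val := fun _ _ => 0
  base_le := fun _ => le_rfl

/-- The context with one more local variable, which adds its bit length to the size. -/
def ext : Ctx S where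
  I := Γ.I × ℕ
  base := fun z => Γ.base z.1
  size := fun z => Γ.size z.1 + z.2.size
  len := Γ.len + 1
  val := fun z j => if j = Γ.len then z.2 else Γ.val z.1 j
  base_le := fun z => (Γ.base_le z.1).trans (Nat.le_add_right _ _)

/-- The memory `s` holds the input and the local variables `z`, variable `j` being in register
`ℓ j`. -/
def Holds (ℓ : ℕ → ℕ) (z : Γ.I) (s : State) : Prop :=
  (∀ j < S.regs, s.reg j = (S.load (Γ.base z)).reg j) ∧ s.arr = (S.load (Γ.base z)).arr ∧
    ∀ j < Γ.len, s.reg (ℓ j) = Γ.val z j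

end Ctx

/-- The numerical value of `g` is bounded by a polynomial in the size. -/
def PolyBdd {S : Source} (Γ : Ctx S) (g : Γ.I → ℕ) : Prop :=
  ∃ p : Polynomial ℕ, ∀ z, g z ≤ p.eval (Γ.size z)

/-- The memories `s` and `s'` agree up to registers from `k` on. -/
def Agree (k : ℕ) (s s' : State) : Prop :=
  (∀ j < k, s'.reg j = s.reg j) ∧ s'.arr = s.arr ∧ s'.used = s.used

/-- The program `c` writes `f z` into register `k`, changing no register below `k`, in time
`T z`. -/
def Computes {S : Source} (Γ : Ctx S) (ℓ : ℕ → ℕ) (k : ℕ) (c : Prog) (f T : Γ.I → ℕ) : Prop :=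
  ∀ ω z s, Γ.Holds ℓ z s → ∃ s' t, Exec ω c s s' t ∧ t ≤ T z ∧ s'.reg k = f z ∧ Agree k s s'

/-- The function `f` of the input and the local variables is computable in polynomial time without
coins, for every placement of the local variables and of the result. -/
def PolyComp {S : Source} (Γ : Ctx S) (f : Γ.I → ℕ) : Prop :=
  PolyBdd Γ (fun z => (f z).size) ∧
    ∀ ℓ k, S.regs ≤ k → (∀ j < Γ.len, ℓ j < k) →
      ∃ c T, PolyBdd Γ T ∧ Computes Γ ℓ k c f T

/-- The predicate `P` is decidable in polynomial time. -/
def PolyDec {S : Source} (Γ : Ctx S) (P : Γ.I → Prop) : Prop :=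
  open Classical in PolyComp Γ (fun z => if P z then 1 else 0)

theorem Agree.refl (k : ℕ) (s : State) : Agree k s s := ⟨fun _ _ => rfl, rfl, rfl⟩

theorem Agree.trans {k : ℕ} {s₁ s₂ s₃ : State} (h : Agree k s₁ s₂) (h' : Agree k s₂ s₃) :
    Agree k s₁ s₃ :=
  ⟨fun j hj => (h'.1 j hj).trans (h.1 j hj), h'.2.1.trans h.2.1, h'.2.2.trans h.2.2⟩

theorem Agree.mono {k k' : ℕ} {s s' : State} (h : Agree k' s s') (hk : k ≤ k') : Agree k s s' :=
  ⟨fun j hj => h.1 j (hj.trans_le hk), h.2⟩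

theorem Agree.set {k i : ℕ} (hk : k ≤ i) (s : State) (v : ℤ) :
    Agree k s { s with reg := Function.update s.reg i v } :=
  ⟨fun j hj => Function.update_of_ne (by omega) _ _, rfl, rfl⟩

theorem Ctx.Holds.agree {S : Source} {Γ : Ctx S} {ℓ : ℕ → ℕ} {k : ℕ} {z : Γ.I} {s s' : State}
    (h : Γ.Holds ℓ z s) (hs : Agree k s s') (hk : S.regs ≤ k) (hℓ : ∀ j < Γ.len, ℓ j < k) :
    Γ.Holds ℓ z s' :=
  ⟨fun j hj => (hs.1 j (hj.trans_le hk)).trans (h.1 j hj), hs.2.1.trans h.2.1,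
    fun j hj => (hs.1 _ (hℓ j hj)).trans (h.2.2 j hj)⟩

theorem bits_natCast (n : ℕ) : bits (n : ℤ) = n.size + 1 := by simp [bits]

section PolyBdd

variable {S : Source} {Γ : Ctx S} {f g : Γ.I → ℕ}

theorem eval_le_eval (p : Polynomial ℕ) {a b : ℕ} (h : a ≤ b) : p.eval a ≤ p.eval b := by
  rw [Polynomial.eval_eq_sum_range, Polynomial.eval_eq_sum_range]
  gcongr

theorem PolyBdd.mono (hg : PolyBdd Γ g) (h : ∀ z, f z ≤ g z) : PolyBdd Γ f :=
  hg.imp fun _ hp z => (h z).trans (hp z)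

theorem PolyBdd.const (n : ℕ) : PolyBdd Γ (fun _ => n) := ⟨Polynomial.C n, fun _ => by simp⟩

theorem PolyBdd.size : PolyBdd Γ Γ.size := ⟨Polynomial.X, fun _ => by simp⟩

theorem PolyBdd.add (hf : PolyBdd Γ f) (hg : PolyBdd Γ g) : PolyBdd Γ (fun z => f z + g z) := by
  obtain ⟨p, hp⟩ := hf
  obtain ⟨q, hq⟩ := hg
  exact ⟨p + q, fun z => by simpa using add_le_add (hp z) (hq z)⟩

theorem PolyBdd.mul (hf : PolyBdd Γ f) (hg : PolyBdd Γ g) : PolyBdd Γ (fun z => f z * g z) := by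
  obtain ⟨p, hp⟩ := hf
  obtain ⟨q, hq⟩ := hg
  exact ⟨p * q, fun z => by simpa using Nat.mul_le_mul (hp z) (hq z)⟩

theorem PolyBdd.pow (hf : PolyBdd Γ f) (n : ℕ) : PolyBdd Γ (fun z => f z ^ n) := by
  obtain ⟨p, hp⟩ := hf
  exact ⟨p ^ n, fun z => by simpa using Nat.pow_le_pow_left (hp z) n⟩

theorem PolyBdd.weaken (hf : PolyBdd Γ f) : PolyBdd Γ.ext (fun z => f z.1) := by
  obtain ⟨p, hp⟩ := hf
  exact ⟨p, fun z => (hp z.1).trans (eval_le_eval p (Nat.le_add_right _ _))⟩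

theorem PolyBdd.comp {p : Polynomial ℕ} (hf : PolyBdd Γ f) :
    PolyBdd Γ (fun z => p.eval (f z)) := by
  obtain ⟨q, hq⟩ := hf
  exact ⟨p.comp q, fun z => by simpa [Polynomial.eval_comp] using eval_le_eval p (hq z)⟩

/-- A bound in an extended context becomes a bound in the smaller context once the new variable has
polynomially many bits. -/
theorem PolyBdd.specialize {g : Γ.ext.I → ℕ} (hg : PolyBdd Γ.ext g) {b : Γ.I → ℕ}
    (hb : PolyBdd Γ b) :
    ∃ q, PolyBdd Γ q ∧ ∀ z i, Nat.size i ≤ b z → g (z, i) ≤ q z := by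
  obtain ⟨p, hp⟩ := hg
  exact ⟨fun z => p.eval (Γ.size z + b z), (PolyBdd.size.add hb).comp, fun z i hi =>
    (hp (z, i)).trans (eval_le_eval p (Nat.add_le_add_left hi _))⟩

theorem size_add_le (a b : ℕ) : (a + b).size ≤ a.size + b.size + 1 := by
  rw [Nat.size_le]
  have ha := Nat.lt_size_self a
  have hb := Nat.lt_size_self b
  have h1 : 2 ^ a.size ≤ 2 ^ (a.size + b.size) := Nat.pow_le_pow_right (by omega) (by omega)
  have h2 : 2 ^ b.size ≤ 2 ^ (a.size + b.size) := Nat.pow_le_pow_right (by omega) (by omega)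
  rw [pow_succ]
  omega

theorem size_mul_le (a b : ℕ) : (a * b).size ≤ a.size + b.size := by
  rw [Nat.size_le, pow_add]
  exact Nat.mul_lt_mul'' (Nat.lt_size_self a) (Nat.lt_size_self b)

theorem size_le_self (n : ℕ) : n.size ≤ n := Nat.size_le.2 n.lt_two_pow_self

theorem size_prod_le {ι : Type*} (s : Finset ι) (f : ι → ℕ) :
    (∏ i ∈ s, f i).size ≤ ∑ i ∈ s, (f i).size + 1 := by
  classical
  induction s using Finset.induction_on with
  | empty => simp
  | insert a s ha ih =>
    rw [prod_insert ha, sum_insert ha]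
    have := size_mul_le (f a) (∏ i ∈ s, f i)
    omega

theorem size_sum_range_le (n : ℕ) (f : ℕ → ℕ) (B : ℕ) (h : ∀ i < n, (f i).size ≤ B) :
    (∑ i ∈ range n, f i).size ≤ n + B + 1 := by
  have h1 : ∑ i ∈ range n, f i ≤ n * 2 ^ B := by
    have := sum_le_card_nsmul (range n) f (2 ^ B) fun i hi =>
      (Nat.size_le.1 (h i (mem_range.1 hi))).le
    simpa using this
  refine (Nat.size_le_size h1).trans ((size_mul_le _ _).trans ?_)
  have h2 : (2 ^ B).size ≤ B + 1 := Nat.size_le.2 (Nat.pow_lt_pow_right (by omega) (by omega))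
  have h3 : n.size ≤ n := size_le_self n
  omega

end PolyBdd

section PolyComp

variable {S : Source} {Γ : Ctx S} {f g h : Γ.I → ℕ}

theorem PolyComp.reg (j : ℕ) (hj : j < S.regs) (hb : PolyBdd Γ (fun z => (f z).size))
    (hf : ∀ z, (S.load (Γ.base z)).reg j = f z) : PolyComp Γ f := by
  refine ⟨hb, fun ℓ k hk hℓ => ⟨.set k (.reg j), fun z => (f z).size + 1, hb.add (.const 1),
    fun ω z s hs => ⟨_, _, .set s k _, ?_, ?_, .set le_rfl _ _⟩⟩⟩
  · simp [Expr.cost, hs.1 j hj, hf, bits_natCast]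
  · simp [Expr.eval, hs.1 j hj, hf]

theorem PolyComp.var : PolyComp Γ.ext (fun z => z.2) := by
  have hb : PolyBdd Γ.ext (fun z => z.2.size) :=
    PolyBdd.size.mono fun z => Nat.le_add_left _ _
  refine ⟨hb, fun ℓ k hk hℓ => ⟨.set k (.reg (ℓ Γ.len)), fun z => z.2.size + 1,
    hb.add (.const 1), fun ω z s hs => ?_⟩⟩
  have hr : s.reg (ℓ Γ.len) = z.2 := by
    have := hs.2.2 Γ.len (Nat.lt_succ_self _)
    simpa [Ctx.ext] using this
  refine ⟨_, _, .set s k _, ?_, ?_, .set le_rfl _ _⟩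
  · simp [Expr.cost, hr, bits_natCast]
  · simp [Expr.eval, hr]

theorem Ctx.Holds.of_ext {ℓ : ℕ → ℕ} {z : Γ.ext.I} {s : State} (hs : Γ.ext.Holds ℓ z s) :
    Γ.Holds ℓ z.1 s :=
  ⟨hs.1, hs.2.1, fun j hj => by
    have := hs.2.2 j (Nat.lt_succ_of_lt hj)
    simpa [Ctx.ext, hj.ne] using this⟩

theorem Ctx.Holds.ext {ℓ : ℕ → ℕ} {z : Γ.I} {s : State} {i r : ℕ} (hs : Γ.Holds ℓ z s)
    (hi : s.reg r = i) : Γ.ext.Holds (Function.update ℓ Γ.len r) (z, i) s := by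
  refine ⟨hs.1, hs.2.1, fun j hj => ?_⟩
  rcases Nat.lt_succ_iff_lt_or_eq.1 hj with hj | rfl
  · have := hs.2.2 j hj
    simpa [Ctx.ext, hj.ne] using this
  · simpa [Ctx.ext] using hi

theorem PolyComp.weaken (hf : PolyComp Γ f) : PolyComp Γ.ext (fun z => f z.1) := by
  refine ⟨hf.1.weaken, fun ℓ k hk hℓ => ?_⟩
  obtain ⟨c, T, hT, hc⟩ := hf.2 ℓ k hk fun j hj => hℓ j (Nat.lt_succ_of_lt hj)
  exact ⟨c, _, hT.weaken, fun ω z s hs => hc ω z.1 s hs.of_ext⟩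

theorem PolyComp.const (n : ℕ) : PolyComp Γ (fun _ => n) := by
  refine ⟨.const _, fun ℓ k hk hℓ => ⟨.set k (.const n), fun z => n.size + 1, .const _,
    fun ω z s hs => ⟨_, _, .set s k _, ?_, ?_, .set le_rfl _ _⟩⟩⟩
  · simp [Expr.cost, bits_natCast]
  · simp [Expr.eval]

theorem PolyComp.array (a : ℕ) (hg : PolyComp Γ g) (hb : PolyBdd Γ (fun z => (f z).size))
    (hf : ∀ z, (S.load (Γ.base z)).arr a (g z) = f z) : PolyComp Γ f := by
  refine ⟨hb, fun ℓ k hk hℓ => ?_⟩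
  obtain ⟨c, T, hT, hc⟩ := hg.2 ℓ k hk hℓ
  refine ⟨.seq c (.set k (.arr a (.reg k))),
    fun z => T z + ((g z).size + (f z).size + 2), hT.add ((hg.1.add hb).add (.const 2)),
    fun ω z s hs => ?_⟩
  obtain ⟨s₁, t₁, e₁, ht₁, hr₁, ha₁⟩ := hc ω z s hs
  have hs₁ := hs.agree ha₁ hk hℓ
  refine ⟨_, _, .seq e₁ (.set s₁ k _), ?_, ?_, ha₁.trans (.set le_rfl _ _)⟩
  · simp only [Expr.cost, Expr.eval, hr₁, hs₁.2.1, hf, bits_natCast]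
    omega
  · simp [Expr.eval, hr₁, hs₁.2.1, hf]

theorem PolyComp.bin (o : Op) (hf : PolyComp Γ f) (hg : PolyComp Γ g)
    (hb : PolyBdd Γ (fun z => (h z).size)) (ho : ∀ z, o.eval (f z) (g z) = h z) :
    PolyComp Γ h := by
  refine ⟨hb, fun ℓ k hk hℓ => ?_⟩
  obtain ⟨c, T, hT, hc⟩ := hf.2 ℓ k hk hℓ
  obtain ⟨c', T', hT', hc'⟩ := hg.2 ℓ (k + 1) (by omega) fun j hj => (hℓ j hj).trans (by omega)
  refine ⟨.seq c (.seq c' (.set k (.bin o (.reg k) (.reg (k + 1))))),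
    fun z => T z + T' z + ((f z).size + (g z).size + (h z).size + 3),
    (hT.add hT').add (((hf.1.add hg.1).add hb).add (.const 3)), fun ω z s hs => ?_⟩
  obtain ⟨s₁, t₁, e₁, ht₁, hr₁, ha₁⟩ := hc ω z s hs
  obtain ⟨s₂, t₂, e₂, ht₂, hr₂, ha₂⟩ := hc' ω z s₁ (hs.agree ha₁ hk hℓ)
  have hr : s₂.reg k = f z := (ha₂.1 k (by omega)).trans hr₁
  refine ⟨_, _, .seq e₁ (.seq e₂ (.set s₂ k _)), ?_, ?_,
    ha₁.trans ((ha₂.mono (by omega)).trans (.set le_rfl _ _))⟩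
  · simp only [Expr.cost, Expr.eval, hr, hr₂, ho, bits_natCast]
    omega
  · simp [Expr.eval, hr, hr₂, ho]

theorem PolyComp.add (hf : PolyComp Γ f) (hg : PolyComp Γ g) :
    PolyComp Γ (fun z => f z + g z) :=
  hf.bin .add hg (((hf.1.add hg.1).add (.const 1)).mono fun z => size_add_le _ _)
    fun z => by simp [Op.eval]

theorem PolyComp.mul (hf : PolyComp Γ f) (hg : PolyComp Γ g) :
    PolyComp Γ (fun z => f z * g z) :=
  hf.bin .mul hg ((hf.1.add hg.1).mono fun z => size_mul_le _ _) fun z => by simp [Op.eval]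

theorem PolyComp.div (hf : PolyComp Γ f) (hg : PolyComp Γ g) :
    PolyComp Γ (fun z => f z / g z) :=
  hf.bin .div hg (hf.1.mono fun z => Nat.size_le_size (Nat.div_le_self _ _))
    fun z => by simp [Op.eval]

theorem PolyComp.mod (hf : PolyComp Γ f) (hg : PolyComp Γ g) :
    PolyComp Γ (fun z => f z % g z) :=
  hf.bin .sub (hg.mul (hf.div hg)) (hf.1.mono fun z => Nat.size_le_size (Nat.mod_le _ _))
    fun z => by
      have := Nat.mod_add_div (f z) (g z)
      simp only [Op.eval]
      omega

theorem PolyComp.ite_lt {a b : Γ.I → ℕ} (hf : PolyComp Γ f) (hg : PolyComp Γ g)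
    (ha : PolyComp Γ a) (hb : PolyComp Γ b) :
    PolyComp Γ (fun z => if f z < g z then a z else b z) := by
  have hB : PolyBdd Γ (fun z => (a z).size + (b z).size) := ha.1.add hb.1
  refine ⟨hB.mono fun z => by dsimp only; split_ifs <;> omega, fun ℓ k hk hℓ => ?_⟩
  obtain ⟨c, T, hT, hc⟩ := hf.2 ℓ k hk hℓ
  obtain ⟨c', T', hT', hc'⟩ := hg.2 ℓ (k + 1) (by omega) fun j hj => (hℓ j hj).trans (by omega)
  obtain ⟨d, U, hU, hd⟩ := ha.2 ℓ k hk hℓ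
  obtain ⟨d', U', hU', hd'⟩ := hb.2 ℓ k hk hℓ
  refine ⟨.seq c (.seq c' (.ite (.bin .sub (.reg (k + 1)) (.reg k)) d d')),
    fun z => T z + T' z + (2 * (f z).size + 2 * (g z).size + 3) + (U z + U' z),
    ((hT.add hT').add (((((PolyBdd.const 2).mul hf.1).add ((PolyBdd.const 2).mul hg.1)).add
      (.const 3)))).add (hU.add hU'), fun ω z s hs => ?_⟩
  obtain ⟨s₁, t₁, e₁, ht₁, hr₁, ha₁⟩ := hc ω z s hs
  obtain ⟨s₂, t₂, e₂, ht₂, hr₂, ha₂⟩ := hc' ω z s₁ (hs.agree ha₁ hk hℓ)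
  have hr : s₂.reg k = f z := (ha₂.1 k (by omega)).trans hr₁
  have ha₂ := ha₁.trans (ha₂.mono k.le_succ)
  have hcost : (Expr.bin .sub (.reg (k + 1)) (.reg k)).cost s₂ ≤
      2 * (f z).size + 2 * (g z).size + 3 := by
    simp only [Expr.cost, Expr.eval, hr, hr₂, bits_natCast, Op.eval]
    have : bits ((g z : ℤ) - f z) ≤ (f z).size + (g z).size + 1 := by
      unfold bits
      have : ((g z : ℤ) - f z).natAbs ≤ max (f z) (g z) := by omega
      have := Nat.size_le_size this
      rcases max_cases (f z) (g z) with h | h <;> rw [h.1] at this <;> omega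
    omega
  have hs₂ := hs.agree ha₂ hk hℓ
  by_cases hlt : f z < g z
  · obtain ⟨s₃, t₃, e₃, ht₃, hr₃, ha₃⟩ := hd ω z s₂ hs₂
    refine ⟨s₃, _, .seq e₁ (.seq e₂ (.ite_pos ?_ e₃)), ?_, by simp [hlt, hr₃], ha₂.trans ha₃⟩
    · simp only [Expr.eval, hr, hr₂, Op.eval]
      omega
    · dsimp only
      omega
  · obtain ⟨s₃, t₃, e₃, ht₃, hr₃, ha₃⟩ := hd' ω z s₂ hs₂
    refine ⟨s₃, _, .seq e₁ (.seq e₂ (.ite_neg ?_ e₃)), ?_, by simp [hlt, hr₃], ha₂.trans ha₃⟩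
    · simp only [Expr.eval, hr, hr₂, Op.eval]
      omega
    · dsimp only
      omega

/-- Bounded iteration whose intermediate results have polynomially many bits.  The result is built up
in register `k`, with the number of passes so far in `k + 2` and the bound in `k + 1`. -/
theorem PolyComp.iter {b : Γ.I → ℕ} {step : Γ.I → ℕ → ℕ → ℕ} (hb : PolyComp Γ b)
    (hbb : PolyBdd Γ b) (hf : PolyComp Γ f)
    (hstep : PolyComp Γ.ext.ext (fun z => step z.1.1 z.1.2 z.2)) {B : Γ.I → ℕ} (hB : PolyBdd Γ B)
    (hbits : ∀ z, ∀ i ≤ b z,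
      (Nat.rec (f z) (fun i a => step z i a) i : ℕ).size ≤ B z) :
    PolyComp Γ (fun z => (Nat.rec (f z) (fun i a => step z i a) (b z) : ℕ)) := by
  refine ⟨hB.mono fun z => hbits z _ le_rfl, fun ℓ k hk hℓ => ?_⟩
  obtain ⟨c, T, hT, hc⟩ := hf.2 ℓ k hk hℓ
  obtain ⟨c', T', hT', hc'⟩ := hb.2 ℓ (k + 1) (by omega) fun j hj => (hℓ j hj).trans (by omega)
  obtain ⟨d, U, hU, hd⟩ := hstep.2
    (Function.update (Function.update ℓ Γ.len (k + 2)) (Γ.len + 1) k) (k + 3) (by omega) (by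
      intro j hj
      have hj : j < Γ.len + 2 := hj
      by_cases h1 : j = Γ.len + 1
      · subst h1; simp
      · by_cases h2 : j = Γ.len
        · subst h2; simp
        · have := hℓ j (by omega)
          simp only [Function.update_of_ne h1, Function.update_of_ne h2]
          omega)
  obtain ⟨V, hV, hV'⟩ := hU.specialize (b := fun z => B z.1) hB.weaken
  obtain ⟨W, hW, hW'⟩ := hV.specialize hbb
  -- the cost of one pass through the loop, and of its last test
  let C : Γ.I → ℕ := fun z => W z + (10 * b z + B z + 20)
  have hC : PolyBdd Γ C := hW.add ((((PolyBdd.const 10).mul hbb).add hB).add (.const 20))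
  refine ⟨.seq c (.seq c' (.seq (.set (k + 2) (.const 0))
    (.loop (.bin .sub (.reg (k + 1)) (.reg (k + 2)))
      (.seq d (.seq (.set k (.reg (k + 3)))
        (.set (k + 2) (.bin .add (.reg (k + 2)) (.const 1)))))))),
    fun z => T z + T' z + 2 + (b z + 1) * C z,
    ((hT.add hT').add (.const 2)).add ((hbb.add (.const 1)).mul hC), fun ω z s hs => ?_⟩
  obtain ⟨s₁, t₁, e₁, ht₁, hr₁, ha₁⟩ := hc ω z s hs
  obtain ⟨s₂, t₂, e₂, ht₂, hr₂, ha₂⟩ := hc' ω z s₁ (hs.agree ha₁ hk hℓ)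
  have hr : s₂.reg k = f z := (ha₂.1 k (by omega)).trans hr₁
  have ha₂ := ha₁.trans (ha₂.mono k.le_succ)
  set s₃ : State := { s₂ with reg := Function.update s₂.reg (k + 2) 0 } with hs₃
  have ha₃ : Agree k s₂ s₃ := .set (by omega) _ _
  have hcost : ∀ (s : State) (i : ℕ), i ≤ b z → s.reg (k + 1) = b z → s.reg (k + 2) = i →
      (Expr.bin .sub (.reg (k + 1)) (.reg (k + 2))).cost s ≤ 3 * b z + 3 := by
    intro s i hi h1 h2
    have e : (b z : ℤ) - i = ((b z - i : ℕ) : ℤ) := by omega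
    simp only [Expr.cost, Expr.eval, h1, h2, Op.eval, e, bits_natCast]
    have := size_le_self (b z)
    have := size_le_self (b z - i)
    have := size_le_self i
    omega
  have key : ∀ m i s, b z - i = m → i ≤ b z → Γ.Holds ℓ z s → s.reg (k + 1) = b z →
      s.reg (k + 2) = i → s.reg k = (Nat.rec (f z) (fun i a => step z i a) i : ℕ) →
      ∃ s' t, Exec ω (.loop (.bin .sub (.reg (k + 1)) (.reg (k + 2)))
        (.seq d (.seq (.set k (.reg (k + 3)))
          (.set (k + 2) (.bin .add (.reg (k + 2)) (.const 1)))))) s s' t ∧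
        t ≤ (m + 1) * C z ∧ s'.reg k = (Nat.rec (f z) (fun i a => step z i a) (b z) : ℕ) ∧
        Agree k s s' := by
    intro m
    induction m with
    | zero =>
      intro i s hm hi hs h1 h2 h0
      obtain rfl : i = b z := by omega
      refine ⟨s, _, .loop_done ?_, ?_, h0, .refl _ _⟩
      · simp [Expr.eval, Op.eval, h1, h2]
      · have := hcost s _ le_rfl h1 h2
        simp only [C]
        omega
    | succ m ih =>
      intro i s hm hi hs h1 h2 h0
      have hi' : i + 1 ≤ b z := by omega
      set a : ℕ := Nat.rec (f z) (fun i a => step z i a) i with hadef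
      have hh := (hs.ext h2).ext h0
      obtain ⟨u₁, w₁, x₁, hw₁, hu₁, hg₁⟩ := hd ω ((z, i), a) s hh
      have hw₁' : w₁ ≤ W z := hw₁.trans ((hV' (z, i) a (hbits z i hi)).trans
        (hW' z i ((size_le_self i).trans hi)))
      set u₂ : State := { u₁ with reg := Function.update u₁.reg k (u₁.reg (k + 3)) } with hu₂
      set u₃ : State := { u₂ with reg := Function.update u₂.reg (k + 2) (u₂.reg (k + 2) + 1) }
        with hu₃
      have hag : Agree k s u₃ := (hg₁.mono (by omega)).trans ((Agree.set le_rfl _ _).trans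
        (.set (by omega) _ _))
      have g1 : u₁.reg (k + 1) = b z := (hg₁.1 _ (by omega)).trans h1
      have g2 : u₁.reg (k + 2) = i := (hg₁.1 _ (by omega)).trans h2
      have g2' : u₂.reg (k + 2) = i := by simp [hu₂, g2]
      obtain ⟨s', t, e, ht, hr', ha'⟩ := ih (i + 1) u₃ (by omega) hi' (hs.agree hag hk hℓ)
        (by simp [hu₃, hu₂, g1]) (by simp [hu₃, g2']) (by
          simp only [hu₃, hu₂]
          rw [Function.update_of_ne (by omega), Function.update_self, hu₁])
      have hc1 := hcost s i hi h1 h2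
      refine ⟨s', _, .loop_step ?_ (.seq x₁ (.seq (.set u₁ k _) (.set u₂ (k + 2) _))) e, ?_, hr',
        hag.trans ha'⟩
      · simp only [Expr.eval, Op.eval, h1, h2]
        omega
      · have hv := hbits z (i + 1) hi'
        have e3 : (Expr.reg (k + 3)).cost u₁ ≤ B z + 1 := by
          simp only [Expr.cost, hu₁, bits_natCast]
          exact Nat.succ_le_succ hv
        have e4 : (Expr.bin .add (.reg (k + 2)) (.const 1)).cost u₂ ≤ 2 * b z + 4 := by
          have e : (i : ℤ) + 1 = ((i + 1 : ℕ) : ℤ) := by omega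
          have e1 : bits 1 = 2 := by simp [bits]
          simp only [Expr.cost, Expr.eval, Op.eval, g2', e, e1, bits_natCast]
          have := size_le_self (i + 1)
          have := size_le_self i
          omega
        have : (m + 1 + 1) * C z = (m + 1) * C z + C z := by ring
        rw [this]
        simp only [C] at ht ⊢
        omega
  obtain ⟨s₄, t₄, e₄, ht₄, hr₄, ha₄⟩ := key (b z) 0 s₃ rfl (Nat.zero_le _)
    (hs.agree (ha₂.trans ha₃) hk hℓ) (by simp [hs₃, hr₂]) (by simp [hs₃]) (by simp [hs₃, hr])
  refine ⟨s₄, _, .seq e₁ (.seq e₂ (.seq (.set s₂ (k + 2) _) e₄)), ?_, hr₄,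
    ha₂.trans (ha₃.trans ha₄)⟩
  have : (Expr.const 0).cost s₂ = 1 := by simp [Expr.cost, bits]
  dsimp only
  omega

end PolyComp
end RAM

/-! ### Closure properties of polynomial-time computable functions -/

namespace RAM

open Finset

section Closure

variable {S : Source} {Γ : Ctx S} {f g h b : Γ.I → ℕ}

theorem PolyComp.sum {F : Γ.I → ℕ → ℕ} (hb : PolyComp Γ b) (hbb : PolyBdd Γ b)
    (hF : PolyComp Γ.ext (fun z => F z.1 z.2)) :
    PolyComp Γ (fun z => ∑ i ∈ range (b z), F z i) := by
  obtain ⟨q, hq, hq'⟩ := hF.1.specialize hbb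
  have e : ∀ z i, (Nat.rec 0 (fun i a => a + F z i) i : ℕ) = ∑ i ∈ range i, F z i := by
    intro z i
    induction i with
    | zero => rfl
    | succ i ih => rw [sum_range_succ, ← ih]
  have := PolyComp.iter (f := fun _ => 0) (step := fun z i a => a + F z i) hb hbb (.const 0)
    (PolyComp.var.add hF.weaken) (B := fun z => b z + q z + 1) ((hbb.add hq).add (.const 1)) (by
      intro z i hi
      rw [e]
      refine (size_sum_range_le i _ (q z) fun j hj =>
        hq' z j ((size_le_self j).trans (by omega))).trans (by omega))
  simpa only [e] using this

theorem PolyComp.prod {F : Γ.I → ℕ → ℕ} (hb : PolyComp Γ b) (hbb : PolyBdd Γ b)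
    (hF : PolyComp Γ.ext (fun z => F z.1 z.2)) :
    PolyComp Γ (fun z => ∏ i ∈ range (b z), F z i) := by
  obtain ⟨q, hq, hq'⟩ := hF.1.specialize hbb
  have e : ∀ z i, (Nat.rec 1 (fun i a => a * F z i) i : ℕ) = ∏ i ∈ range i, F z i := by
    intro z i
    induction i with
    | zero => rfl
    | succ i ih => rw [prod_range_succ, ← ih]
  have := PolyComp.iter (f := fun _ => 1) (step := fun z i a => a * F z i) hb hbb (.const 1)
    (PolyComp.var.mul hF.weaken) (B := fun z => b z * q z + 1) ((hbb.mul hq).add (.const 1)) (by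
      intro z i hi
      rw [e]
      refine (size_prod_le _ _).trans (Nat.succ_le_succ ?_)
      refine (sum_le_card_nsmul _ _ (q z) fun j hj => ?_).trans ?_
      · have := mem_range.1 hj
        exact hq' z j ((size_le_self j).trans (by omega))
      · simpa using Nat.mul_le_mul_right _ hi)
  simpa only [e] using this

theorem PolyComp.ite {P : Γ.I → Prop} [∀ z, Decidable (P z)] (hP : PolyDec Γ P)
    (hf : PolyComp Γ f) (hg : PolyComp Γ g) : PolyComp Γ (fun z => if P z then f z else g z) := by
  classical
  have := PolyComp.ite_lt (.const 0) hP hf hg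
  refine (congrArg (PolyComp Γ) ?_).mp this
  funext z
  by_cases h : P z <;> simp [h]

theorem PolyDec.lt (hf : PolyComp Γ f) (hg : PolyComp Γ g) : PolyDec Γ (fun z => f z < g z) := by
  refine (congrArg (PolyComp Γ) ?_).mp (PolyComp.ite_lt hf hg (.const 1) (.const 0))
  funext z
  congr

theorem PolyDec.not {P : Γ.I → Prop} (hP : PolyDec Γ P) : PolyDec Γ (fun z => ¬ P z) := by
  classical
  refine (congrArg (PolyComp Γ) ?_).mp (PolyComp.ite hP (.const 0) (.const 1))
  funext z
  by_cases h : P z <;> simp [h]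

theorem PolyDec.and {P Q : Γ.I → Prop} (hP : PolyDec Γ P) (hQ : PolyDec Γ Q) :
    PolyDec Γ (fun z => P z ∧ Q z) := by
  classical
  refine (congrArg (PolyComp Γ) ?_).mp (PolyComp.ite hP hQ (.const 0))
  funext z
  by_cases h : P z <;> simp [h]

theorem PolyDec.imp {P Q : Γ.I → Prop} (hP : PolyDec Γ P) (hQ : PolyDec Γ Q) :
    PolyDec Γ (fun z => P z → Q z) := by
  refine (congrArg (PolyDec Γ) ?_).mp (hP.and hQ.not).not
  funext z
  simp

theorem PolyDec.le (hf : PolyComp Γ f) (hg : PolyComp Γ g) : PolyDec Γ (fun z => f z ≤ g z) := by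
  refine (congrArg (PolyDec Γ) ?_).mp (PolyDec.lt hg hf).not
  funext z
  simp

theorem PolyDec.eq (hf : PolyComp Γ f) (hg : PolyComp Γ g) : PolyDec Γ (fun z => f z = g z) := by
  refine (congrArg (PolyDec Γ) ?_).mp ((PolyDec.le hf hg).and (PolyDec.le hg hf))
  funext z
  exact propext le_antisymm_iff.symm

theorem PolyDec.ball {P : Γ.I → ℕ → Prop} (hb : PolyComp Γ b) (hbb : PolyBdd Γ b)
    (hP : PolyDec Γ.ext (fun z => P z.1 z.2)) : PolyDec Γ (fun z => ∀ i < b z, P z i) := by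
  classical
  refine (congrArg (PolyComp Γ) ?_).mp (PolyComp.prod (F := fun z i => if P z i then 1 else 0) hb hbb hP)
  funext z
  rw [prod_ite_zero]
  simp

theorem PolyDec.bex {P : Γ.I → ℕ → Prop} (hb : PolyComp Γ b) (hbb : PolyBdd Γ b)
    (hP : PolyDec Γ.ext (fun z => P z.1 z.2)) : PolyDec Γ (fun z => ∃ i < b z, P z i) := by
  refine (congrArg (PolyDec Γ) ?_).mp (PolyDec.ball (P := fun z i => ¬ P z i) hb hbb hP.not).not
  funext z
  simp

theorem PolyComp.sub (hf : PolyComp Γ f) (hg : PolyComp Γ g) :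
    PolyComp Γ (fun z => f z - g z) := by
  have hm : PolyComp Γ (fun z => if f z < g z then g z else f z) := .ite_lt hf hg hg hf
  refine hm.bin .sub hg (hf.1.mono fun z => Nat.size_le_size (Nat.sub_le _ _)) fun z => ?_
  simp only [Op.eval]
  split_ifs <;> omega

theorem PolyComp.min (hf : PolyComp Γ f) (hg : PolyComp Γ g) :
    PolyComp Γ (fun z => min (f z) (g z)) := by
  refine (congrArg (PolyComp Γ) ?_).mp (PolyComp.ite_lt hf hg hf hg)
  funext z
  split_ifs <;> omega

/-- Powers with exponents capped by a polynomially bounded number. -/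
theorem PolyComp.pow (hb : PolyComp Γ b) (hbb : PolyBdd Γ b) (hf : PolyComp Γ f)
    (hg : PolyComp Γ g) : PolyComp Γ (fun z => f z ^ Min.min (g z) (b z)) := by
  have := PolyComp.prod (b := fun z => Min.min (g z) (b z)) (F := fun z _ => f z) (hg.min hb)
    (hbb.mono fun z => min_le_right _ _) hf.weaken
  simpa using this

/-- Insertion of an unused variable before the last one. -/
theorem PolyComp.exchange {f : Γ.ext.I → ℕ} (hf : PolyComp Γ.ext f) :
    PolyComp Γ.ext.ext (fun z => f (z.1.1, z.2)) := by
  have hle : ∀ z : Γ.ext.ext.I, Γ.ext.size (z.1.1, z.2) ≤ Γ.ext.ext.size z := fun z => by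
    simp only [Ctx.ext]
    omega
  have hpb : ∀ {g : Γ.ext.I → ℕ}, PolyBdd Γ.ext g →
      PolyBdd Γ.ext.ext (fun z => g (z.1.1, z.2)) := fun ⟨p, hp⟩ =>
    ⟨p, fun z => (hp _).trans (eval_le_eval p (hle z))⟩
  refine ⟨hpb hf.1, fun ℓ k hk hℓ => ?_⟩
  have hℓ : ∀ j < Γ.len + 2, ℓ j < k := hℓ
  obtain ⟨c, T, hT, hc⟩ := hf.2 (Function.update ℓ Γ.len (ℓ (Γ.len + 1))) k hk (by
    intro j hj
    have hj : j < Γ.len + 1 := hj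
    by_cases h : j = Γ.len
    · subst h
      simpa using hℓ _ (by omega)
    · simpa [h] using hℓ j (by omega))
  refine ⟨c, _, hpb hT, fun ω z s hs => hc ω (z.1.1, z.2) s (hs.of_ext.of_ext.ext ?_)⟩
  have := hs.2.2 (Γ.len + 1) (Nat.lt_succ_self _)
  simpa [Ctx.ext] using this

/-- The least `i < b` with `P i`, and `b` if there is none. -/
def first (b : ℕ) (P : ℕ → Prop) [DecidablePred P] : ℕ :=
  Nat.rec 0 (fun i a => if a < i then a else if P i then i else i + 1) b

section first

variable {n : ℕ} {P : ℕ → Prop} [DecidablePred P]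

theorem first_succ : first (n + 1) P =
    if first n P < n then first n P else if P n then n else n + 1 := rfl

theorem first_le : first n P ≤ n := by
  induction n with
  | zero => exact le_rfl
  | succ n ih => rw [first_succ]; split_ifs <;> omega

theorem not_of_lt_first {i : ℕ} (hi : i < first n P) : ¬ P i := by
  induction n with
  | zero => exact absurd hi (Nat.not_lt_zero _)
  | succ n ih =>
    rw [first_succ] at hi
    have := first_le (n := n) (P := P)
    split_ifs at hi with h1 h2
    · exact ih hi
    · exact ih (by omega)
    · rcases Nat.lt_succ_iff_lt_or_eq.1 hi with h | rfl
      · exact ih (by omega)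
      · exact h2

theorem first_spec (h : first n P < n) : P (first n P) := by
  induction n with
  | zero => exact absurd h (Nat.not_lt_zero _)
  | succ n ih =>
    rw [first_succ] at h ⊢
    split_ifs at h ⊢ with h1 h2
    · exact ih h1
    · exact h2
    · omega

theorem first_lt {i : ℕ} (hi : i < n) (h : P i) : first n P < n := by
  by_contra hn
  exact not_of_lt_first (n := n) (by omega) h

theorem first_eq {i : ℕ} (hi : i < n) (h : P i) (hlt : ∀ j < i, ¬ P j) : first n P = i := by
  refine le_antisymm (not_lt.1 fun hn => not_of_lt_first hn h) (not_lt.1 fun hn => ?_)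
  exact hlt _ hn (first_spec (hn.trans hi))

end first

theorem PolyComp.first {P : Γ.I → ℕ → Prop} [∀ z, DecidablePred (P z)] (hb : PolyComp Γ b)
    (hbb : PolyBdd Γ b) (hP : PolyDec Γ.ext (fun z => P z.1 z.2)) :
    PolyComp Γ (fun z => first (b z) (P z)) := by
  have hP' : PolyDec Γ.ext.ext (fun z => P z.1.1 z.1.2) := PolyComp.weaken hP
  exact PolyComp.iter hb hbb (.const 0) (step := fun z i a =>
    if a < i then a else if P z i then i else i + 1)
    (.ite_lt .var PolyComp.var.weaken .var
      (.ite hP' PolyComp.var.weaken (PolyComp.var.weaken.add (.const 1)))) hbb (by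
      intro z i hi
      exact (size_le_self _).trans ((first_le (n := i) (P := P z)).trans hi))

/-- The bit length of a number, found by repeated halving. -/
theorem PolyComp.size (hf : PolyComp Γ f) : PolyComp Γ (fun z => (f z).size) := by
  refine ⟨hf.1.mono fun z => size_le_self _, fun ℓ k hk hℓ => ?_⟩
  obtain ⟨c, T, hT, hc⟩ := hf.2 ℓ (k + 1) (by omega) fun j hj => (hℓ j hj).trans (by omega)
  refine ⟨.seq c (.seq (.set k (.const 0)) (.loop (.reg (k + 1))
    (.seq (.set (k + 1) (.bin .div (.reg (k + 1)) (.const 2)))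
      (.set k (.bin .add (.reg k) (.const 1)))))),
    fun z => T z + 1 + ((f z).size + 1) * (10 * (f z).size + 20),
    (hT.add (.const 1)).add ((hf.1.add (.const 1)).mul
      (((PolyBdd.const 10).mul hf.1).add (.const 20))), fun ω z s hs => ?_⟩
  obtain ⟨s₁, t₁, e₁, ht₁, hr₁, ha₁⟩ := hc ω z s hs
  set s₂ : State := { s₁ with reg := Function.update s₁.reg k 0 } with hs₂
  have key : ∀ (m i v : ℕ) (s : State), v.size = m → m + i = (f z).size → s.reg (k + 1) = (v : ℤ) →
      s.reg k = (i : ℤ) →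
      ∃ s' t, Exec ω (.loop (.reg (k + 1))
        (.seq (.set (k + 1) (.bin .div (.reg (k + 1)) (.const 2)))
          (.set k (.bin .add (.reg k) (.const 1))))) s s' t ∧
        t ≤ (m + 1) * (10 * (f z).size + 20) ∧ s'.reg k = (f z).size ∧ Agree k s s' := by
    intro m
    induction m with
    | zero =>
      intro i v s hv hi h1 h0
      obtain rfl := Nat.size_eq_zero.1 hv
      refine ⟨s, _, .loop_done (by simp [Expr.eval, h1]), ?_, by simp [h0, ← hi], .refl _ _⟩
      simp [Expr.cost, h1, bits]
    | succ m ih =>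
      intro i v s hv hi h1 h0
      have hv0 : 0 < v := Nat.size_pos.1 (by omega)
      have hv2 : (v / 2).size = m := by
        have hlt := Nat.lt_size_self v
        have hle : 2 ^ m ≤ v := Nat.lt_size.1 (by omega)
        rw [hv, pow_succ] at hlt
        refine le_antisymm (Nat.size_le.2 (by omega)) ?_
        rcases Nat.eq_zero_or_pos m with rfl | hm
        · exact Nat.zero_le _
        · have : m - 1 < (v / 2).size := Nat.lt_size.2 (by
            rw [Nat.le_div_iff_mul_le two_pos, ← pow_succ, Nat.sub_add_cancel hm]
            exact hle)
          omega
      set u₁ : State := { s with reg := Function.update s.reg (k + 1) (v / 2 : ℕ) } with hu₁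
      set u₂ : State := { u₁ with reg := Function.update u₁.reg k (i + 1 : ℕ) } with hu₂
      have g1 : u₁.reg k = i := by simp [hu₁, h0]
      have x₁ : Exec ω (.set (k + 1) (.bin .div (.reg (k + 1)) (.const 2))) s u₁
          ((Expr.bin .div (.reg (k + 1)) (.const 2)).cost s) := by
        have := Exec.set (ω := ω) s (k + 1) (.bin .div (.reg (k + 1)) (.const 2))
        simpa [Expr.eval, Op.eval, h1, hu₁] using this
      have x₂ : Exec ω (.set k (.bin .add (.reg k) (.const 1))) u₁ u₂
          ((Expr.bin .add (.reg k) (.const 1)).cost u₁) := by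
        have := Exec.set (ω := ω) u₁ k (.bin .add (.reg k) (.const 1))
        simpa [Expr.eval, Op.eval, g1, hu₂] using this
      obtain ⟨s', t, e, ht, hr', ha'⟩ := ih (i + 1) (v / 2) u₂ hv2 (by omega)
        (by simp [hu₂, hu₁]) (by simp [hu₂])
      refine ⟨s', _, .loop_step (by simp [Expr.eval, h1, hv0]) (.seq x₁ x₂) e, ?_, hr',
        (Agree.trans (.set (by omega) _ _) (.set le_rfl _ _)).trans ha'⟩
      have b1 : bits 1 = 2 := by simp [bits]
      have b2 : bits 2 = 3 := by decide
      have c0 : (Expr.reg (k + 1)).cost s = v.size + 1 := by simp [Expr.cost, h1, bits_natCast]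
      have c1 : (Expr.bin .div (.reg (k + 1)) (.const 2)).cost s ≤ 2 * v.size + 5 := by
        have e : ((v : ℤ) / 2) = (v / 2 : ℕ) := by simp
        simp only [Expr.cost, Expr.eval, Op.eval, h1, e, bits_natCast, b2, hv2]
        omega
      have c2 : (Expr.bin .add (.reg k) (.const 1)).cost u₁ ≤ 2 * i + 5 := by
        have e : (i : ℤ) + 1 = (i + 1 : ℕ) := by simp
        simp only [Expr.cost, Expr.eval, Op.eval, g1, e, bits_natCast, b1]
        have := size_le_self i
        have := size_le_self (i + 1)
        omega
      have : (m + 1 + 1) * (10 * (f z).size + 20) =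
        (m + 1) * (10 * (f z).size + 20) + (10 * (f z).size + 20) := by ring
      omega
  obtain ⟨s₃, t₃, e₃, ht₃, hr₃, ha₃⟩ := key (f z).size 0 (f z) s₂ rfl rfl
    (by simp [hs₂, hr₁]) (by simp [hs₂])
  refine ⟨s₃, _, .seq e₁ (.seq (.set s₁ k (.const 0)) e₃), ?_, hr₃,
    (ha₁.mono (by omega)).trans ((Agree.set le_rfl _ _).trans ha₃)⟩
  have : (Expr.const 0).cost s₁ = 1 := by simp [Expr.cost, bits]
  dsimp only
  omega

end Closure
end RAM

/-! ### Randomized programs from polynomial-time computable functions -/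

namespace RAM

open Finset

/-- The number whose binary digits are the first `Q` coins. -/
def coinNumber (ω : ℕ → Bool) (Q : ℕ) : ℕ := ∑ i ∈ range Q, if ω i then 2 ^ i else 0

theorem coinNumber_lt (ω : ℕ → Bool) (Q : ℕ) : coinNumber ω Q < 2 ^ Q := by
  induction Q with
  | zero => simp [coinNumber]
  | succ Q ih =>
    rw [coinNumber, sum_range_succ, ← coinNumber, pow_succ]
    split_ifs <;> omega

/-- The coin loop: with `Q` in register `r + 2` it puts `coinNumber ω Q` into register `r`. -/
theorem exists_coinLoop (r : ℕ) : ∃ c : Prog, ∃ p : Polynomial ℕ, ∀ ω s (Q : ℕ), s.used = 0 →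
    s.reg (r + 2) = (Q : ℤ) → ∃ s' t, Exec ω c s s' t ∧ t ≤ p.eval Q ∧ s'.reg r = coinNumber ω Q ∧
      (∀ j < r, s'.reg j = s.reg j) ∧ s'.arr = s.arr := by
  let body : Prog := .seq (.flip (r + 3)) (.seq
    (.set r (.bin .add (.reg r) (.bin .mul (.reg (r + 3)) (.reg (r + 1))))) (.seq
    (.set (r + 1) (.bin .mul (.reg (r + 1)) (.const 2)))
    (.set (r + 2) (.bin .sub (.reg (r + 2)) (.const 1)))))
  refine ⟨.seq (.set r (.const 0)) (.seq (.set (r + 1) (.const 1)) (.loop (.reg (r + 2)) body)),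
    3 + (.X + 1) * (.C 30 * .X + 60), fun ω s Q hu hQ => ?_⟩
  have key : ∀ (m i : ℕ) (s : State), m + i = Q → s.used = i → s.reg (r + 2) = m →
      s.reg (r + 1) = (2 ^ i : ℕ) → s.reg r = coinNumber ω i →
      ∃ s' t, Exec ω (.loop (.reg (r + 2)) body) s s' t ∧ t ≤ (m + 1) * (30 * Q + 60) ∧
        s'.reg r = coinNumber ω Q ∧ (∀ j < r, s'.reg j = s.reg j) ∧ s'.arr = s.arr := by
    intro m
    induction m with
    | zero =>
      intro i s hi hu h2 h1 h0
      obtain rfl : i = Q := by omega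
      refine ⟨s, _, .loop_done (by simp [Expr.eval, h2]), ?_, h0, fun _ _ => rfl, rfl⟩
      simp [Expr.cost, h2, bits]
    | succ m ih =>
      intro i s hi hu h2 h1 h0
      let b : ℕ := if ω i then 1 else 0
      have hb : b ≤ 1 := by simp only [b]; split_ifs <;> omega
      have hsucc : coinNumber ω (i + 1) = coinNumber ω i + b * 2 ^ i := by
        rw [coinNumber, sum_range_succ, ← coinNumber]
        simp only [b]
        split_ifs <;> simp
      let s₁ : State := { s with reg := Function.update s.reg (r + 3) b, used := s.used + 1 }
      let s₂ : State := { s₁ with reg := Function.update s₁.reg r (coinNumber ω (i + 1)) }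
      let s₃ : State := { s₂ with reg := Function.update s₂.reg (r + 1) (2 ^ (i + 1) : ℕ) }
      let s₄ : State := { s₃ with reg := Function.update s₃.reg (r + 2) m }
      have g1 : s₁.reg r = coinNumber ω i := by simp [s₁, h0]
      have g1' : s₁.reg (r + 1) = (2 ^ i : ℕ) := by simp [s₁, h1]
      have g1'' : s₁.reg (r + 3) = b := by simp [s₁]
      have g2 : s₂.reg (r + 1) = (2 ^ i : ℕ) := by simp [s₂, s₁, h1]
      have g3 : s₃.reg (r + 2) = (m + 1 : ℕ) := by simp [s₃, s₂, s₁, h2]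
      have x₁ : Exec ω (.flip (r + 3)) s s₁ 1 := by
        have := Exec.flip (ω := ω) s (r + 3)
        have e : (if ω s.used then 1 else 0 : ℤ) = b := by simp [b, hu]
        rwa [e] at this
      have v₂ : (Expr.bin .add (.reg r) (.bin .mul (.reg (r + 3)) (.reg (r + 1)))).eval s₁ =
          coinNumber ω (i + 1) := by
        simp only [Expr.eval, Op.eval, g1, g1', g1'', hsucc]
        push_cast
        rfl
      have x₂ := Exec.set (ω := ω) s₁ r
        (.bin .add (.reg r) (.bin .mul (.reg (r + 3)) (.reg (r + 1))))
      rw [v₂] at x₂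
      have v₃ : (Expr.bin .mul (.reg (r + 1)) (.const 2)).eval s₂ = (2 ^ (i + 1) : ℕ) := by
        simp [Expr.eval, Op.eval, g2, pow_succ]
      have x₃ := Exec.set (ω := ω) s₂ (r + 1) (.bin .mul (.reg (r + 1)) (.const 2))
      rw [v₃] at x₃
      have v₄ : (Expr.bin .sub (.reg (r + 2)) (.const 1)).eval s₃ = m := by
        simp [Expr.eval, Op.eval, g3]
      have x₄ := Exec.set (ω := ω) s₃ (r + 2) (.bin .sub (.reg (r + 2)) (.const 1))
      rw [v₄] at x₄
      obtain ⟨s', t, e, ht, hr', ha', hA⟩ := ih (i + 1) s₄ (by omega) (by simp [s₄, s₃, s₂, s₁, hu])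
        (by simp [s₄]) (by simp [s₄, s₃]) (by simp [s₄, s₃, s₂])
      refine ⟨s', _, .loop_step (by simp [Expr.eval, h2])
        (.seq x₁ (.seq x₂ (.seq x₃ x₄))) e, ?_, hr', fun j hj => ?_, hA⟩
      · have z1 : (coinNumber ω i).size ≤ Q := Nat.size_le.2
          ((coinNumber_lt ω i).trans_le (Nat.pow_le_pow_right (by omega) (by omega)))
        have z2 : (coinNumber ω (i + 1)).size ≤ Q := Nat.size_le.2
          ((coinNumber_lt ω _).trans_le (Nat.pow_le_pow_right (by omega) (by omega)))
        have z3 : (2 ^ i : ℕ).size ≤ Q + 1 := Nat.size_le.2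
          (Nat.pow_lt_pow_right (by omega) (by omega))
        have z4 : (2 ^ (i + 1) : ℕ).size ≤ Q + 1 := Nat.size_le.2
          (Nat.pow_lt_pow_right (by omega) (by omega))
        have z5 := (size_le_self (m + 1)).trans (by omega : m + 1 ≤ Q)
        have z6 := (size_le_self m).trans (by omega : m ≤ Q)
        have z7 := (size_le_self b).trans hb
        have z8 := size_mul_le b (2 ^ i)
        have b1 : bits 1 = 2 := by simp [bits]
        have b2 : bits 2 = 3 := by decide
        have c0 : (Expr.reg (r + 2)).cost s ≤ Q + 1 := by
          simp only [Expr.cost, h2, bits_natCast]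
          omega
        have c1 : (Expr.bin .add (.reg r) (.bin .mul (.reg (r + 3)) (.reg (r + 1)))).cost s₁ ≤
            4 * Q + 10 := by
          have e : (Expr.bin .mul (.reg (r + 3)) (.reg (r + 1))).eval s₁ = (b * 2 ^ i : ℕ) := by
            simp [Expr.eval, Op.eval, g1', g1'']
          simp only [Expr.cost]
          rw [show Op.eval .add ((Expr.reg r).eval s₁)
            ((Expr.bin .mul (.reg (r + 3)) (.reg (r + 1))).eval s₁) = _ from v₂]
          rw [show Op.eval .mul ((Expr.reg (r + 3)).eval s₁) ((Expr.reg (r + 1)).eval s₁) = _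
            from e]
          simp only [g1, g1', g1'', bits_natCast]
          omega
        have c2 : (Expr.bin .mul (.reg (r + 1)) (.const 2)).cost s₂ ≤ 2 * Q + 10 := by
          simp only [Expr.cost]
          rw [show Op.eval .mul ((Expr.reg (r + 1)).eval s₂) ((Expr.const 2).eval s₂) = _ from v₃]
          simp only [g2, bits_natCast, b2]
          omega
        have c3 : (Expr.bin .sub (.reg (r + 2)) (.const 1)).cost s₃ ≤ 2 * Q + 10 := by
          simp only [Expr.cost]
          rw [show Op.eval .sub ((Expr.reg (r + 2)).eval s₃) ((Expr.const 1).eval s₃) = _ from v₄]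
          simp only [g3, bits_natCast, b1]
          omega
        have : (m + 1 + 1) * (30 * Q + 60) = (m + 1) * (30 * Q + 60) + (30 * Q + 60) := by ring
        omega
      · rw [ha' j hj]
        simp only [s₄, s₃, s₂, s₁]
        rw [Function.update_of_ne (by omega), Function.update_of_ne (by omega),
          Function.update_of_ne (by omega), Function.update_of_ne (by omega)]
  obtain ⟨s', t, e, ht, hr, ha, hA⟩ := key Q 0
    { s with reg := Function.update (Function.update s.reg r 0) (r + 1) 1 } rfl hu
    (by simp [hQ]) (by simp) (by simp [coinNumber])
  refine ⟨s', _, .seq (.set s r (.const 0)) (.seq (.set _ (r + 1) (.const 1)) e), ?_, hr,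
    fun j hj => ?_, hA⟩
  · have b1 : bits 1 = 2 := by simp [bits]
    have b0 : bits 0 = 1 := by simp [bits]
    simp only [Expr.cost, b1, b0, Polynomial.eval_add, Polynomial.eval_mul, Polynomial.eval_X,
      Polynomial.eval_C, Polynomial.eval_one, Polynomial.eval_ofNat]
    omega
  · rw [ha j hj]
    simp only
    rw [Function.update_of_ne (by omega), Function.update_of_ne (by omega)]

/-- Draw a random number with `Q x` bits, then compute a fraction from it. -/
theorem exists_randomized_prog (S : Source) {Q : S.X → ℕ} {num den : S.X → ℕ → ℕ}
    (hused : ∀ x, (S.load x).used = 0) (hQ : PolyComp (Ctx.nil S) Q) (hQb : PolyBdd (Ctx.nil S) Q)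
    (hnum : PolyComp (Ctx.nil S).ext (fun z => num z.1 z.2))
    (hden : PolyComp (Ctx.nil S).ext (fun z => den z.1 z.2)) :
    ∃ c : Prog, ∃ p : Polynomial ℕ, ∀ x, Q x ≤ p.eval (S.size x) ∧
      ∀ ω, ∃ s' t, Exec ω c (S.load x) s' t ∧ t ≤ p.eval (S.size x) ∧
        s'.reg 0 = num x (coinNumber ω (Q x)) ∧ s'.reg 1 = den x (coinNumber ω (Q x)) := by
  let r := S.regs
  obtain ⟨c, T, ⟨pT, hT⟩, hc⟩ := hQ.2 (fun _ => r) (r + 2) (by omega) (fun _ h => absurd h (by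
    simp [Ctx.nil]))
  obtain ⟨d, pd, hd⟩ := exists_coinLoop r
  obtain ⟨c₁, T₁, hT₁, hc₁⟩ := hnum.2 (Function.update (fun _ => r) 0 r) (r + 1) (by omega)
    (fun j _ => by simp)
  obtain ⟨c₂, T₂, hT₂, hc₂⟩ := hden.2 (Function.update (fun _ => r) 0 r) (r + 2) (by omega)
    (fun j _ => by simp)
  obtain ⟨q₁, ⟨p₁, hp₁⟩, hq₁⟩ := hT₁.specialize hQb
  obtain ⟨q₂, ⟨p₂, hp₂⟩, hq₂⟩ := hT₂.specialize hQb
  obtain ⟨v₁, ⟨w₁, hw₁⟩, hv₁⟩ := hnum.1.specialize hQb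
  obtain ⟨v₂, ⟨w₂, hw₂⟩, hv₂⟩ := hden.1.specialize hQb
  obtain ⟨pQ, hpQ⟩ := hQb
  refine ⟨.seq c (.seq d (.seq c₁ (.seq c₂ (.seq (.set 0 (.reg (r + 1))) (.set 1 (.reg (r + 2))))))),
    pT + pd.comp pQ + p₁ + p₂ + (w₁ + w₂ + 2) + pQ, fun x => ?_⟩
  have hQx : Q x ≤ pQ.eval (S.size x) := hpQ x
  simp only [Polynomial.eval_add, Polynomial.eval_comp, Polynomial.eval_ofNat]
  refine ⟨by omega, fun ω => ?_⟩
  have hs : (Ctx.nil S).Holds (fun _ => r) x (S.load x) :=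
    ⟨fun _ _ => rfl, rfl, fun j hj => absurd hj (Nat.not_lt_zero _)⟩
  obtain ⟨s₁, t₁, e₁, ht₁, hr₁, ha₁⟩ := hc ω x _ hs
  obtain ⟨s₂, t₂, e₂, ht₂, hr₂, ha₂, hA₂⟩ := hd ω s₁ (Q x) (ha₁.2.2.trans (hused x)) hr₁
  have hs₁ := hs.agree (ha₁.mono (by omega : r ≤ r + 2)) le_rfl
    fun j hj => absurd hj (Nat.not_lt_zero _)
  have hs₂ : (Ctx.nil S).Holds (fun _ => r) x s₂ :=
    ⟨fun j hj => (ha₂ j hj).trans (hs₁.1 j hj), hA₂.trans hs₁.2.1,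
      fun j hj => absurd hj (Nat.not_lt_zero _)⟩
  set R := coinNumber ω (Q x) with hR
  have hRs : R.size ≤ Q x := Nat.size_le.2 (coinNumber_lt _ _)
  have hx : (Ctx.nil S).ext.Holds (Function.update (fun _ => r) 0 r) (x, R) s₂ := hs₂.ext hr₂
  obtain ⟨s₃, t₃, e₃, ht₃, hr₃, ha₃⟩ := hc₁ ω (x, R) s₂ hx
  have hx₃ := hx.agree ha₃ (Nat.le_succ _) fun j _ => by simp
  obtain ⟨s₄, t₄, e₄, ht₄, hr₄, ha₄⟩ := hc₂ ω (x, R) s₃ hx₃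
  have hr₃' : s₄.reg (r + 1) = num x R := (ha₄.1 _ (by omega)).trans hr₃
  refine ⟨_, _, .seq e₁ (.seq e₂ (.seq e₃ (.seq e₄ (.seq (.set s₄ 0 _) (.set _ 1 _))))), ?_, ?_, ?_⟩
  · have k₁ : t₁ ≤ pT.eval (S.size x) := ht₁.trans (hT x)
    have k₂ : t₂ ≤ pd.eval (pQ.eval (S.size x)) := ht₂.trans (eval_le_eval _ hQx)
    have k₃ : t₃ ≤ p₁.eval (S.size x) := ht₃.trans ((hq₁ x R hRs).trans (hp₁ x))
    have k₄ : t₄ ≤ p₂.eval (S.size x) := ht₄.trans ((hq₂ x R hRs).trans (hp₂ x))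
    have k₅ : (num x R).size ≤ w₁.eval (S.size x) := (hv₁ x R hRs).trans (hw₁ x)
    have k₆ : (den x R).size ≤ w₂.eval (S.size x) := (hv₂ x R hRs).trans (hw₂ x)
    simp only [Expr.cost, hr₃', bits_natCast]
    rw [Function.update_of_ne (by omega), hr₄, bits_natCast]
    dsimp only
    omega
  · simp [Expr.eval, hr₃']
  · simp [Expr.eval, hr₄]

theorem coinNumber_coins {Q e : ℕ} (u : Fin Q → Fin 2) (v : Fin e → Bool) :
    coinNumber (coins (Fin.append (fun i => finTwoEquiv (u i)) v)) Q =
      (finFunctionFinEquiv u : ℕ) := by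
  rw [finFunctionFinEquiv_apply_val, coinNumber, sum_range]
  refine sum_congr rfl fun i _ => ?_
  have hi : (i : ℕ) < Q + e := by omega
  have : coins (Fin.append (fun i => finTwoEquiv (u i)) v) i = finTwoEquiv (u i) := by
    rw [coins, dif_pos hi]
    exact Fin.append_left _ _ i
  rw [this]
  generalize u i = b
  fin_cases b <;> simp [finTwoEquiv]

/-- The probability of an event that depends only on the number formed by the first `Q` coins. -/
theorem le_coinProb {T Q : ℕ} (hQT : Q ≤ T) {E : (Fin T → Bool) → Prop} {good : ℕ → Prop}
    [DecidablePred good] (hE : ∀ w, good (coinNumber (coins w) Q) → E w) :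
    (#{R ∈ range (2 ^ Q) | good R} : ℝ) / 2 ^ Q ≤ coinProb T E := by
  obtain ⟨e, rfl⟩ := Nat.exists_eq_add_of_le hQT
  -- a good number and arbitrary remaining coins determine an outcome in the event
  let F : {R : Fin (2 ^ Q) // good R} × (Fin e → Bool) → {w : Fin (Q + e) → Bool // E w} :=
    fun p => ⟨Fin.append (fun i => finTwoEquiv (finFunctionFinEquiv.symm p.1.1 i)) p.2,
      hE _ (by rw [coinNumber_coins, Equiv.apply_symm_apply]; exact p.1.2)⟩
  have hF : Function.Injective F := by
    rintro ⟨⟨R, hR⟩, v⟩ ⟨⟨R', hR'⟩, v'⟩ h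
    have h := congrArg Subtype.val h
    have h1 : (fun i => finTwoEquiv (finFunctionFinEquiv.symm R i)) =
        (fun i => finTwoEquiv (finFunctionFinEquiv.symm R' i)) := by
      funext i
      simpa [F] using congrFun h (Fin.castAdd e i)
    have h2 : v = v' := by
      funext i
      simpa [F] using congrFun h (Fin.natAdd Q i)
    have h3 : R = R' := finFunctionFinEquiv.symm.injective (funext fun i =>
      finTwoEquiv.injective (congrFun h1 i))
    subst h2 h3
    rfl
  have hcard := Nat.card_le_card_of_injective F hF
  rw [Nat.card_prod, Nat.card_fun, Nat.card_eq_fintype_card (α := {R : Fin (2 ^ Q) // good R}),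
    Fintype.card_subtype] at hcard
  have hc : #{R ∈ range (2 ^ Q) | good R} = #{R : Fin (2 ^ Q) | good R} := by
    rw [card_filter, card_filter, sum_range]
  simp only [Nat.card_eq_fintype_card, Fintype.card_bool, Fintype.card_fin] at hcard
  rw [coinProb, hc, div_le_div_iff₀ (by positivity) (by positivity), pow_add]
  have : ((#{R : Fin (2 ^ Q) | good R} * 2 ^ e : ℕ) : ℝ) ≤
      (Nat.card {w : Fin (Q + e) → Bool // E w} : ℝ) := by
    exact_mod_cast hcard
  push_cast at this
  nlinarith [pow_pos (two_pos (α := ℝ)) Q]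

end RAM

/-! ### Decoding tickets into realizations -/

namespace Ticket

open Finset RAM

/-- Cut `[0, ∑ i < b, f i)` into consecutive blocks of lengths `f 0, f 1, …`: the block that
contains `y`. -/
def pick (b : ℕ) (f : ℕ → ℕ) (y : ℕ) : ℕ :=
  first b (fun j => y < ∑ i ∈ range (min (j + 1) b), f i)

/-- The position of `y` inside its block. -/
def rest (b : ℕ) (f : ℕ → ℕ) (y : ℕ) : ℕ := y - ∑ i ∈ range (min (pick b f y) b), f i

theorem pick_eq {b : ℕ} {f : ℕ → ℕ} {j y : ℕ} (hj : j < b) (hy : y < f j) :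
    pick b f (∑ i ∈ range j, f i + y) = j := by
  refine first_eq hj ?_ fun i hi => ?_
  · rw [min_eq_left (by omega), sum_range_succ]
    omega
  · rw [min_eq_left (by omega), not_lt]
    exact (sum_le_sum_of_subset (range_subset_range.2 hi)).trans (Nat.le_add_right _ _)

theorem rest_eq {b : ℕ} {f : ℕ → ℕ} {j y : ℕ} (hj : j < b) (hy : y < f j) :
    rest b f (∑ i ∈ range j, f i + y) = y := by
  rw [rest, pick_eq hj hy, min_eq_left hj.le]
  omega

theorem sum_pick {R : Type*} [AddCommMonoid R] (b : ℕ) (f : ℕ → ℕ) (F : ℕ → ℕ → R) :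
    ∑ y ∈ range (∑ i ∈ range b, f i), F (pick b f y) (rest b f y) =
      ∑ j ∈ range b, ∑ y ∈ range (f j), F j y := by
  have key : ∀ c ≤ b, ∑ y ∈ range (∑ i ∈ range c, f i), F (pick b f y) (rest b f y) =
      ∑ j ∈ range c, ∑ y ∈ range (f j), F j y := by
    intro c
    induction c with
    | zero => simp
    | succ c ih =>
      intro hc
      rw [sum_range_succ f, sum_range_add, ih (by omega), sum_range_succ _ c]
      congr 1
      refine sum_congr rfl fun y hy => ?_
      rw [pick_eq (by omega) (mem_range.1 hy), rest_eq (by omega) (mem_range.1 hy)]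
  exact key b le_rfl

theorem sum_range_mul {R : Type*} [AddCommMonoid R] (a b : ℕ) (F : ℕ → R) :
    ∑ y ∈ range (a * b), F y = ∑ i ∈ range a, ∑ j ∈ range b, F (i * b + j) := by
  induction a with
  | zero => simp
  | succ a ih => rw [Nat.succ_mul, sum_range_add, ih, sum_range_succ]

theorem mul_add_div' (i : ℕ) {j b : ℕ} (h : j < b) : (i * b + j) / b = i := by
  rw [mul_comm, Nat.mul_add_div (by omega), Nat.div_eq_of_lt h, add_zero]

theorem mul_add_mod' (i : ℕ) {j b : ℕ} (h : j < b) : (i * b + j) % b = j := by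
  rw [mul_comm, Nat.mul_add_mod, Nat.mod_eq_of_lt h]

/-- The digit of `y` at position `u < n` in mixed radix with radices `q`.  Capping the product at `n`
factors has no effect for these `u`, and makes it a product of boundedly many factors for all `u`. -/
def digit (n : ℕ) (q : ℕ → ℕ) (y u : ℕ) : ℕ := y / (∏ i ∈ range (min u n), q i) % q u

theorem digit_succ {n : ℕ} {q : ℕ → ℕ} {i j u : ℕ} (hu : u < n) (hj : j < q 0) :
    digit (n + 1) q (i * q 0 + j) (u + 1) = digit n (fun u => q (u + 1)) i u := by
  rw [digit, digit, min_eq_left (by omega), min_eq_left hu.le, prod_range_succ',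
    mul_comm (∏ k ∈ range u, q (k + 1)), ← Nat.div_div_eq_div_mul, mul_add_div' i hj]

/-- Independent choices: the digits of a uniform number choose the entries of `r` independently,
entry `u` being `x` with probability proportional to `A u x`. -/
theorem sum_digits (n m c : ℕ) (A : ℕ → ℕ → ℕ) (G : (Fin n → ℕ) → ℝ) :
    ∑ y ∈ range (c * ∏ u ∈ range n, ∑ x ∈ range m, A u x),
      G (fun u => pick m (A u) (digit n (fun u => ∑ x ∈ range m, A u x) y u)) =
    c * ∑ r : Fin n → Fin m, (∏ u : Fin n, (A u (r u) : ℝ)) * G (fun u => r u) := by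
  induction n generalizing c A with
  | zero =>
    simp only [range_zero, prod_empty, mul_one, univ_eq_empty, one_mul]
    rw [Fintype.sum_unique]
    have : ∀ f : Fin 0 → ℕ, G f = G (fun u => ((default : Fin 0 → Fin m) u : ℕ)) := fun f =>
      congrArg G (Subsingleton.elim _ _)
    simp only [this]
    simp
  | succ n ih =>
    set q : ℕ → ℕ := fun u => ∑ x ∈ range m, A u x with hq
    have h1 : c * ∏ u ∈ range (n + 1), q u = (c * ∏ u ∈ range n, q (u + 1)) * q 0 := by
      rw [prod_range_succ', mul_assoc]
    rw [h1, sum_range_mul]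
    have h2 : ∀ i, ∑ j ∈ range (q 0), G (fun u : Fin (n + 1) => pick m (A u)
        (digit (n + 1) q (i * q 0 + j) u)) = ∑ x : Fin m, (A 0 x : ℝ) *
        G (Fin.cons (x : ℕ) (fun u : Fin n => pick m (A (u + 1))
          (digit n (fun u => q (u + 1)) i u))) := by
      intro i
      have h3 := sum_pick m (A 0) (fun x _ => G (Fin.cons x (fun u : Fin n => pick m (A (u + 1))
          (digit n (fun u => q (u + 1)) i u))))
      simp only [sum_const, card_range, nsmul_eq_mul] at h3
      rw [sum_range (fun x => (A 0 x : ℝ) * _)] at h3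
      rw [← h3]
      refine sum_congr rfl fun j hj => congrArg G (funext fun u => ?_)
      have hj := mem_range.1 hj
      refine Fin.cases ?_ (fun u => ?_) u
      · simp only [Fin.val_zero, Fin.cons_zero]
        rw [digit, min_eq_left (by omega), range_zero, prod_empty, Nat.div_one,
          mul_add_mod' i hj]
      · simp only [Fin.val_succ, Fin.cons_succ]
        rw [digit_succ u.2 hj]
    simp only [h2]
    rw [sum_comm]
    simp only [← mul_sum]
    have h4 := fun x : Fin m => ih c (fun u => A (u + 1)) (fun g => G (Fin.cons (x : ℕ) g))
    simp only [hq]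
    simp only [h4]
    rw [← (Fin.consEquiv (fun _ : Fin (n + 1) => Fin m)).sum_comp, Fintype.sum_prod_type, mul_sum]
    refine sum_congr rfl fun x _ => ?_
    rw [mul_left_comm, mul_sum (univ : Finset (Fin n → Fin m))]
    congr 1
    refine sum_congr rfl fun r _ => ?_
    rw [Fin.prod_univ_succ]
    simp only [Fin.consEquiv_apply, Fin.cons_zero, Fin.cons_succ, Fin.val_zero, Fin.val_succ]
    rw [mul_assoc]
    congr 3
    funext u
    refine Fin.cases ?_ (fun u => ?_) u <;> simp

/-- The weight with which node `u` is placed at point `x`, given that node `v` is at `s` and that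
node `w`, at `t`, is a nearest neighbour of `v`. -/
def mass (δ a : ℕ → ℕ → ℕ) (v s w t u x : ℕ) : ℕ :=
  if u = v then (if x = s then a u x else 0)
  else if u = w then (if x = t then a u x else 0)
  else if δ s t ≤ δ s x then a u x else 0

/-- The total weight of the realizations with node `v` at `s` and a nearest neighbour `w` of `v` at
`t`, times the distance of these two nodes; it is zero for `v = w`. -/
def weight (n m : ℕ) (δ a : ℕ → ℕ → ℕ) (v s w t : ℕ) : ℕ :=
  if v = w then 0 else δ s t * ∏ u ∈ range n, ∑ x ∈ range m, mass δ a v s w t u x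

/-- The weights listed in one sequence; `J` encodes `(v, s, w, t)`. -/
def codedWeight (n m : ℕ) (δ a : ℕ → ℕ → ℕ) (J : ℕ) : ℕ :=
  weight n m δ a (J / m / n / m) (J / m / n % m) (J / m % n) (J % m)

/-- The number of tickets. -/
def total (n m : ℕ) (δ a : ℕ → ℕ → ℕ) : ℕ :=
  ∑ J ∈ range (n * m * n * m), codedWeight n m δ a J

/-- The weights of the possible locations of node `u`, for a ticket in block `J`. -/
def codedMass (n m : ℕ) (δ a : ℕ → ℕ → ℕ) (J u x : ℕ) : ℕ :=
  mass δ a (J / m / n / m) (J / m / n % m) (J / m % n) (J % m) u x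

/-- The location of node `u` in the realization that belongs to ticket `y`. -/
def loc (n m : ℕ) (δ a : ℕ → ℕ → ℕ) (y u : ℕ) : ℕ :=
  let J := pick (n * m * n * m) (codedWeight n m δ a) y
  pick m (codedMass n m δ a J u) (digit n (fun u => ∑ x ∈ range m, codedMass n m δ a J u x)
    (rest (n * m * n * m) (codedWeight n m δ a) y) u)

/-- The sum, over the nodes `v` and all nearest neighbours `w` of `v`, of the distance of `v` and
`w`.  This is the factor by which the number of tickets of a realization exceeds its weight. -/
def nearSum {n : ℕ} (δ : ℕ → ℕ → ℕ) (r : Fin n → ℕ) : ℕ :=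
  ∑ v, ∑ w, if v ≠ w ∧ ∀ u, u ≠ v → δ (r v) (r w) ≤ δ (r v) (r u) then δ (r v) (r w) else 0

theorem prod_mass {n m : ℕ} (δ a : ℕ → ℕ → ℕ) (v w : Fin n) (hvw : v ≠ w) (s t : ℕ)
    (r : Fin n → Fin m) :
    ∏ u : Fin n, mass δ a v s w t u (r u) =
      if s = r v then if t = r w then
        if ∀ u, u ≠ v → δ (r v) (r w) ≤ δ (r v) (r u) then ∏ u : Fin n, a u (r u) else 0
      else 0 else 0 := by
  split_ifs with h1 h2 h3
  · subst h1 h2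
    refine prod_congr rfl fun u _ => ?_
    rw [mass]
    split_ifs with k1 k2 k3 k4 k5 <;> try rfl
    · exact absurd (by rw [Fin.ext k1]) k2
    · exact absurd (by rw [Fin.ext k3]) k4
    · exact absurd (h3 u fun e => k1 (congrArg _ e)) k5
  · subst h1 h2
    push Not at h3
    obtain ⟨u, hu, h⟩ := h3
    refine prod_eq_zero (mem_univ u) ?_
    have k1 : (u : ℕ) ≠ v := fun e => hu (Fin.ext e)
    have k2 : (u : ℕ) ≠ w := fun e => by
      rw [Fin.ext e] at h
      exact lt_irrefl _ h
    rw [mass, if_neg k1, if_neg k2, if_neg (not_le.2 h)]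
  · refine prod_eq_zero (mem_univ w) ?_
    rw [mass, if_neg fun e => hvw (Fin.ext e).symm, if_pos rfl, if_neg fun e => h2 e.symm]
  · refine prod_eq_zero (mem_univ v) ?_
    rw [mass, if_pos rfl, if_neg fun e => h1 e.symm]

theorem sum_coded {R : Type*} [AddCommMonoid R] (n m : ℕ) (F : ℕ → ℕ → ℕ → ℕ → R) :
    ∑ J ∈ range (n * m * n * m), F (J / m / n / m) (J / m / n % m) (J / m % n) (J % m) =
      ∑ v ∈ range n, ∑ s ∈ range m, ∑ w ∈ range n, ∑ t ∈ range m, F v s w t := by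
  rw [sum_range_mul, sum_range_mul, sum_range_mul]
  refine sum_congr rfl fun v _ => sum_congr rfl fun s hs => sum_congr rfl fun w hw =>
    sum_congr rfl fun t ht => ?_
  rw [mem_range] at hs hw ht
  rw [mul_add_div' _ ht, mul_add_mod' _ ht, mul_add_div' _ hw, mul_add_mod' _ hw,
    mul_add_div' _ hs, mul_add_mod' _ hs]

/-- The realization `r` belongs to `(∏ u, a u (r u)) * nearSum δ r` tickets. -/
theorem sum_tickets (n m : ℕ) (δ a : ℕ → ℕ → ℕ) (G : (Fin n → ℕ) → ℝ) :
    ∑ y ∈ range (total n m δ a), G (fun u => loc n m δ a y u) =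
      ∑ r : Fin n → Fin m, (∏ u : Fin n, (a u (r u) : ℝ)) * nearSum δ (fun u => (r u : ℕ)) *
        G (fun u => r u) := by
  have h1 := sum_pick (n * m * n * m) (codedWeight n m δ a) (fun J y => G (fun u =>
    pick m (codedMass n m δ a J u) (digit n (fun u => ∑ x ∈ range m, codedMass n m δ a J u x) y u)))
  have h2 : ∀ J, ∑ y ∈ range (codedWeight n m δ a J), G (fun u => pick m (codedMass n m δ a J u)
      (digit n (fun u => ∑ x ∈ range m, codedMass n m δ a J u x) y u)) =
      (fun v s w t => if v = w then 0 else (δ s t : ℝ) * ∑ r : Fin n → Fin m,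
        (∏ u : Fin n, (mass δ a v s w t u (r u) : ℝ)) * G (fun u => r u))
        (J / m / n / m) (J / m / n % m) (J / m % n) (J % m) := by
    intro J
    rw [codedWeight, weight]
    split_ifs with h
    · simp [h]
    · simp only [h, if_false]
      exact sum_digits n m _ (codedMass n m δ a J) G
  rw [sum_congr rfl fun J _ => h2 J, sum_coded n m (fun v s w t => if v = w then 0 else
    (δ s t : ℝ) * ∑ r : Fin n → Fin m, (∏ u : Fin n, (mass δ a v s w t u (r u) : ℝ)) *
      G (fun u => r u))] at h1
  unfold total loc
  rw [h1]
  simp only [sum_range]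
  have h3 : ∀ (v w : Fin n) (s t : Fin m), (if (v : ℕ) = w then 0 else (δ s t : ℝ) *
      ∑ r : Fin n → Fin m, (∏ u : Fin n, (mass δ a v s w t u (r u) : ℝ)) * G (fun u => r u)) =
      ∑ r : Fin n → Fin m, (if s = r v then if t = r w then
        (∏ u : Fin n, (a u (r u) : ℝ)) * G (fun u => r u) *
        (if v ≠ w ∧ ∀ u, u ≠ v → δ (r v) (r w) ≤ δ (r v) (r u) then (δ (r v) (r w) : ℝ) else 0)
        else 0 else 0) := by
    intro v w s t
    split_ifs with h
    · have h := Fin.ext h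
      simp [h]
    · have h : v ≠ w := fun e => h (congrArg _ e)
      rw [mul_sum]
      refine sum_congr rfl fun r _ => ?_
      have e := congrArg (Nat.cast (R := ℝ)) (prod_mass δ a v w h s t r)
      rw [Nat.cast_prod] at e
      rw [e]
      rcases eq_or_ne s (r v) with rfl | k1
      · rcases eq_or_ne t (r w) with rfl | k2
        · by_cases k3 : ∀ u, u ≠ v → δ (r v) (r w) ≤ δ (r v) (r u)
          · rw [if_pos rfl, if_pos rfl, if_pos rfl, if_pos rfl, if_pos k3, if_pos ⟨h, k3⟩,
              Nat.cast_prod]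
            ring
          · rw [if_pos rfl, if_pos rfl, if_pos rfl, if_pos rfl, if_neg k3,
              if_neg fun k => k3 k.2]
            simp
        · rw [if_pos rfl, if_pos rfl, if_neg k2, if_neg fun k => k2 (Fin.ext k)]
          simp
      · rw [if_neg k1, if_neg fun k => k1 (Fin.ext k)]
        simp
  simp only [h3]
  have h4 : ∀ v : Fin n, (∑ s : Fin m, ∑ w : Fin n, ∑ t : Fin m, ∑ r : Fin n → Fin m,
      (if s = r v then if t = r w then (∏ u : Fin n, (a u (r u) : ℝ)) * G (fun u => r u) *
        (if v ≠ w ∧ ∀ u, u ≠ v → δ (r v) (r w) ≤ δ (r v) (r u) then (δ (r v) (r w) : ℝ) else 0)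
        else 0 else 0)) =
      ∑ r : Fin n → Fin m, ∑ w : Fin n, (∏ u : Fin n, (a u (r u) : ℝ)) * G (fun u => r u) *
        (if v ≠ w ∧ ∀ u, u ≠ v → δ (r v) (r w) ≤ δ (r v) (r u) then (δ (r v) (r w) : ℝ)
          else 0) := by
    intro v
    rw [sum_comm]
    conv_rhs => rw [sum_comm]
    refine sum_congr rfl fun w _ => ?_
    rw [sum_congr rfl fun s _ => sum_comm, sum_comm]
    refine sum_congr rfl fun r _ => ?_
    have : ∀ s, (∑ t : Fin m, (if s = r v then if t = r w then
        (∏ u : Fin n, (a u (r u) : ℝ)) * G (fun u => r u) *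
        (if v ≠ w ∧ ∀ u, u ≠ v → δ (r v) (r w) ≤ δ (r v) (r u) then (δ (r v) (r w) : ℝ) else 0)
        else 0 else 0)) = if s = r v then (∏ u : Fin n, (a u (r u) : ℝ)) * G (fun u => r u) *
        (if v ≠ w ∧ ∀ u, u ≠ v → δ (r v) (r w) ≤ δ (r v) (r u) then (δ (r v) (r w) : ℝ) else 0)
        else 0 := by
      intro s
      split_ifs <;> simp
    simp only [this, sum_ite_eq', mem_univ, if_true]
  simp only [h4]
  rw [sum_comm]
  refine sum_congr rfl fun r _ => ?_
  simp only [← mul_sum]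
  rw [nearSum]
  push_cast
  ring

end Ticket

/-! ### Cycle covers, derangements and nearest neighbours -/

namespace CycleCover

open Finset Equiv

section Cover

variable {V : Type} [Fintype V]

/-- The least total length `∑ v, e v (σ v)` of a permutation `σ` without fixed points. -/
noncomputable def minDerangement (e : V → V → ℕ) : ℕ :=
  sInf {k | ∃ σ : Perm V, (∀ v, σ v ≠ v) ∧ ∑ v, e v (σ v) = k}

theorem minDerangement_le (e : V → V → ℕ) {σ : Perm V} (hσ : ∀ v, σ v ≠ v) :
    minDerangement e ≤ ∑ v, e v (σ v) := Nat.sInf_le ⟨σ, hσ, rfl⟩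

theorem exists_minDerangement (e : V → V → ℕ) (h : ∃ σ : Perm V, ∀ v, σ v ≠ v) :
    ∃ σ : Perm V, (∀ v, σ v ≠ v) ∧ ∑ v, e v (σ v) = minDerangement e :=
  Nat.sInf_mem (s := {k | ∃ σ : Perm V, (∀ v, σ v ≠ v) ∧ ∑ v, e v (σ v) = k})
    (h.elim fun σ hσ => ⟨_, σ, hσ, rfl⟩)

variable [DecidableEq V]

/-- A map `f` without fixed points can be turned into a derangement at most twice as long.  As long
as some node is not a value of `f`, such a node `v` is set aside and inserted behind `f v`
afterwards; when there is none, `f` itself is a permutation. -/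
theorem exists_derangement_le (e : V → V → ℕ) (hsymm : ∀ u v, e u v = e v u)
    (htri : ∀ u v w, e u w ≤ e u v + e v w) (f : V → V) (hf : ∀ v, f v ≠ v) :
    ∃ σ : Perm V, (∀ v, σ v ≠ v) ∧ ∑ v, e v (σ v) ≤ 2 * ∑ v, e v (f v) := by
  have key : ∀ (k : ℕ) (S : Finset V), #S = k → (∀ v ∈ S, f v ∈ S) →
      ∃ σ : Perm V, (∀ v ∈ S, σ v ≠ v) ∧ (∀ v ∉ S, σ v = v) ∧
        ∑ v ∈ S, e v (σ v) ≤ 2 * ∑ v ∈ S, e v (f v) := by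
    intro k
    induction k with
    | zero =>
      intro S hS _
      obtain rfl := card_eq_zero.1 hS
      exact ⟨1, by simp⟩
    | succ k ih =>
      intro S hS hfS
      by_cases hleaf : ∃ v ∈ S, ∀ u ∈ S, f u ≠ v
      · obtain ⟨v, hv, hleaf⟩ := hleaf
        obtain ⟨σ, h1, h2, h3⟩ := ih (S.erase v) (by rw [card_erase_of_mem hv, hS]; rfl)
          fun u hu => mem_erase.2 ⟨hleaf u (mem_of_mem_erase hu), hfS u (mem_of_mem_erase hu)⟩
        have hσv : σ v = v := h2 v (notMem_erase v S)
        have hfv : f v ∈ S.erase v := mem_erase.2 ⟨hf v, hfS v hv⟩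
        have e1 : (σ * swap v (f v)) v = σ (f v) := by simp
        have e2 : (σ * swap v (f v)) (f v) = v := by simp [hσv]
        have e3 : ∀ u, u ≠ v → u ≠ f v → (σ * swap v (f v)) u = σ u := fun u k1 k2 => by
          simp [swap_apply_of_ne_of_ne k1 k2]
        refine ⟨σ * swap v (f v), fun u hu => ?_, fun u hu => ?_, ?_⟩
        · rcases eq_or_ne u v with rfl | k1
          · rw [e1]
            exact fun h => hf u (σ.injective (h.trans hσv.symm))
          rcases eq_or_ne u (f v) with rfl | k2
          · rw [e2]
            exact k1.symm
          · rw [e3 u k1 k2]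
            exact h1 u (mem_erase.2 ⟨k1, hu⟩)
        · rw [e3 u (fun h => hu (h ▸ hv)) (fun h => hu (h ▸ hfS v hv))]
          exact h2 u fun h => hu (mem_of_mem_erase h)
        · rw [← add_sum_erase S _ hv, ← add_sum_erase S (fun v => e v (f v)) hv, e1,
            ← add_sum_erase _ _ hfv, e2]
          rw [← add_sum_erase _ _ hfv] at h3
          have : ∑ u ∈ (S.erase v).erase (f v), e u ((σ * swap v (f v)) u) =
              ∑ u ∈ (S.erase v).erase (f v), e u (σ u) := sum_congr rfl fun u hu => by
            rw [e3 u (ne_of_mem_erase (mem_of_mem_erase hu)) (ne_of_mem_erase hu)]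
          rw [this]
          have k1 := htri v (f v) (σ (f v))
          have k2 := hsymm (f v) v
          omega
      · push Not at hleaf
        have hinj : Set.InjOn f S := by
          refine card_image_iff.1 (congrArg card ?_)
          ext v
          refine ⟨fun h => ?_, fun h => ?_⟩
          · obtain ⟨u, hu, rfl⟩ := mem_image.1 h
            exact hfS u hu
          · obtain ⟨u, hu, h⟩ := hleaf v h
            exact mem_image.2 ⟨u, hu, h⟩
        have hg : Function.Injective (fun v => if v ∈ S then f v else v) := by
          intro u v huv
          by_cases hu : u ∈ S <;> by_cases hv : v ∈ S <;> simp only [hu, hv, if_true, if_false] at huv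
          · exact hinj hu hv huv
          · exact absurd (huv ▸ hfS u hu) hv
          · exact absurd (huv ▸ hfS v hv) hu
          · exact huv
        refine ⟨Equiv.ofBijective _ (Finite.injective_iff_bijective.1 hg), fun v hv => ?_,
          fun v hv => ?_, ?_⟩
        · simpa [hv] using hf v
        · simp [hv]
        · rw [sum_congr rfl fun v hv => by
            rw [show (Equiv.ofBijective _ (Finite.injective_iff_bijective.1 hg)) v = f v by
              simp [hv]]]
          omega
  obtain ⟨σ, h1, -, h3⟩ := key _ univ rfl fun _ _ => mem_univ _
  exact ⟨σ, fun v => h1 v (mem_univ v), h3⟩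

theorem coverLength_eq (len : V → V → ℚ) {C : Finset (Perm V)} (hC : IsCycleCover C)
    {σ : V → V} (hσ : ∀ c ∈ C, ∀ v ∈ c.support, c v = σ v) :
    coverLength len C = ∑ v, len v (σ v) := by
  have h1 : coverLength len C = ∑ c ∈ C, ∑ v, if v ∈ c.support then len v (σ v) else 0 := by
    refine sum_congr rfl fun c hc => ?_
    rw [← sum_filter]
    have : univ.filter (· ∈ c.support) = c.support := by ext; simp
    rw [this]
    exact sum_congr rfl fun v hv => by rw [hσ c hc v hv]
  rw [h1, sum_comm]
  refine sum_congr rfl fun v _ => ?_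
  obtain ⟨c, ⟨hc, hv⟩, huniq⟩ := hC.2 v
  rw [sum_eq_single c, if_pos hv]
  · exact fun b hb hbc => if_neg fun h => hbc (huniq b ⟨hb, h⟩)
  · exact fun h => absurd hc h

theorem exists_cover_of_derangement (len : V → V → ℚ) (σ : Perm V) (hσ : ∀ v, σ v ≠ v) :
    ∃ C, IsCycleCover C ∧ coverLength len C = ∑ v, len v (σ v) := by
  have hC : IsCycleCover σ.cycleFactorsFinset := by
    refine ⟨fun c hc => (Perm.mem_cycleFactorsFinset_iff.1 hc).1, fun v =>
      ⟨σ.cycleOf v, ⟨?_, ?_⟩, fun c hc => ?_⟩⟩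
    · exact Perm.cycleOf_mem_cycleFactorsFinset_iff.2 (Perm.mem_support.2 (hσ v))
    · rw [Perm.mem_support, Perm.cycleOf_apply_self]
      exact hσ v
    · exact Perm.cycle_is_cycleOf hc.2 hc.1
  exact ⟨_, hC, coverLength_eq len hC fun c hc => (Perm.mem_cycleFactorsFinset_iff.1 hc).2⟩

theorem exists_derangement_of_cover (len : V → V → ℚ) {C : Finset (Perm V)}
    (hC : IsCycleCover C) :
    ∃ σ : Perm V, (∀ v, σ v ≠ v) ∧ coverLength len C = ∑ v, len v (σ v) := by
  choose c hc huniq using hC.2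
  have hinj : Function.Injective (fun v => c v v) := by
    intro u v huv
    have hu : c u = c (c u u) := huniq _ _ ⟨(hc u).1, Perm.apply_mem_support.2 (hc u).2⟩
    have hv : c v = c (c v v) := huniq _ _ ⟨(hc v).1, Perm.apply_mem_support.2 (hc v).2⟩
    have huv : c u u = c v v := huv
    have : c u = c v := by rw [hu, hv, huv]
    rw [this] at huv
    exact (c v).injective huv
  refine ⟨Equiv.ofBijective _ (Finite.injective_iff_bijective.1 hinj), fun v => ?_, ?_⟩
  · have h : c v v ≠ v := Perm.mem_support.1 (hc v).2
    exact h
  · exact coverLength_eq len hC fun b hb v hv => by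
      rw [huniq v b ⟨hb, hv⟩]
      rfl

/-- With integral lengths `e = D * len` the minimum length of a cycle cover, times `D`, is the
minimum length of a derangement. -/
theorem mul_iInf_coverLength (len : V → V → ℚ) (e : V → V → ℕ) (D : ℕ) (hD : 0 < D)
    (he : ∀ u v, (e u v : ℚ) = D * len u v) (hex : ∃ σ : Perm V, ∀ v, σ v ≠ v) :
    (D : ℝ) * ⨅ C : {C : Finset (Perm V) // IsCycleCover C}, (coverLength len C.1 : ℝ) =
      minDerangement e := by
  have hD' : (0 : ℝ) < D := by exact_mod_cast hD
  have hlen : ∀ σ : Perm V, ((∑ v, e v (σ v) : ℕ) : ℝ) = D * ((∑ v, len v (σ v) : ℚ) : ℝ) := by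
    intro σ
    have : ((∑ v, e v (σ v) : ℕ) : ℚ) = D * ∑ v, len v (σ v) := by
      push_cast
      rw [mul_sum]
      exact sum_congr rfl fun v _ => he v _
    exact_mod_cast congrArg (Rat.cast (K := ℝ)) this
  obtain ⟨σ, hσ, hmin⟩ := exists_minDerangement e hex
  obtain ⟨C₀, hC₀, hlen₀⟩ := exists_cover_of_derangement len σ hσ
  rw [← hmin, hlen σ, ← hlen₀]
  congr 1
  have : Nonempty {C : Finset (Perm V) // IsCycleCover C} := ⟨⟨C₀, hC₀⟩⟩
  have hle : ∀ C : {C : Finset (Perm V) // IsCycleCover C},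
      (coverLength len C₀ : ℝ) ≤ coverLength len C.1 := by
    rintro ⟨C, hC⟩
    obtain ⟨τ, hτ, hτl⟩ := exists_derangement_of_cover len hC
    have h := minDerangement_le e hτ
    rw [← hmin] at h
    have h : ((∑ v, e v (σ v) : ℕ) : ℝ) ≤ (∑ v, e v (τ v) : ℕ) := by exact_mod_cast h
    rw [hlen, hlen, ← hlen₀, ← hτl] at h
    exact le_of_mul_le_mul_left h hD'
  exact le_antisymm (ciInf_le ⟨_, Set.forall_mem_range.2 hle⟩ ⟨C₀, hC₀⟩) (le_ciInf hle)

end Cover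

section Near

variable {n : ℕ} {δ : ℕ → ℕ → ℕ} {r : Fin n → ℕ}

theorem exists_nearest (hn : 2 ≤ n) (δ : ℕ → ℕ → ℕ) (r : Fin n → ℕ) : ∃ f : Fin n → Fin n,
    (∀ v, f v ≠ v) ∧ ∀ v u, u ≠ v → δ (r v) (r (f v)) ≤ δ (r v) (r u) := by
  have : Nontrivial (Fin n) := Fin.nontrivial_iff_two_le.2 hn
  have : ∀ v : Fin n, ∃ w, w ≠ v ∧ ∀ u, u ≠ v → δ (r v) (r w) ≤ δ (r v) (r u) := by
    intro v
    obtain ⟨w₀, hw₀⟩ := exists_ne v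
    obtain ⟨w, hw, hmin⟩ := exists_min_image (univ.erase v) (fun w => δ (r v) (r w))
      ⟨w₀, mem_erase.2 ⟨hw₀, mem_univ _⟩⟩
    exact ⟨w, ne_of_mem_erase hw, fun u hu => hmin u (mem_erase.2 ⟨hu, mem_univ _⟩)⟩
  choose f hf hf' using this
  exact ⟨f, hf, hf'⟩

theorem exists_derangement (hn : 2 ≤ n) : ∃ σ : Perm (Fin n), ∀ v, σ v ≠ v := by
  obtain ⟨f, hf, -⟩ := exists_nearest hn (fun _ _ => 0) (fun _ => 0)
  obtain ⟨σ, hσ, -⟩ := exists_derangement_le (fun _ _ => 0) (by simp) (by simp) f hf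
  exact ⟨σ, hσ⟩

theorem minDerangement_le_nearSum (hn : 2 ≤ n) (hsymm : ∀ u v, δ (r u) (r v) = δ (r v) (r u))
    (htri : ∀ u v w, δ (r u) (r w) ≤ δ (r u) (r v) + δ (r v) (r w)) :
    minDerangement (fun v w => δ (r v) (r w)) ≤ 2 * Ticket.nearSum δ r := by
  obtain ⟨f, hf, hmin⟩ := exists_nearest hn δ r
  obtain ⟨σ, hσ, hle⟩ := exists_derangement_le (fun v w => δ (r v) (r w)) hsymm htri f hf
  refine (minDerangement_le _ hσ).trans (hle.trans (Nat.mul_le_mul_left _ ?_))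
  refine sum_le_sum fun v _ => ?_
  refine le_trans ?_ (single_le_sum (fun _ _ => Nat.zero_le _) (mem_univ (f v)))
  rw [if_pos ⟨(hf v).symm, hmin v⟩]

theorem nearSum_le (hn : 2 ≤ n) :
    Ticket.nearSum δ r ≤ n * minDerangement (fun v w => δ (r v) (r w)) := by
  obtain ⟨σ, hσ, h⟩ := exists_minDerangement (fun v w => δ (r v) (r w)) (exists_derangement hn)
  rw [← h, mul_sum]
  refine sum_le_sum fun v _ => ?_
  refine (sum_le_card_nsmul _ _ (δ (r v) (r (σ v))) fun w _ => ?_).trans (by simp)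
  split_ifs with hw
  · exact hw.2 _ (hσ v)
  · exact Nat.zero_le _

end Near

end CycleCover

/-! ### The auction algorithm for the assignment problem -/

namespace Auction

open Finset RAM

/-- The first person that owns nothing, `n` if there is none.  In a state `σ` of the auction,
`σ j` is the price of object `j < n`, and `σ (n + j)` is `i + 1` if person `i` owns object `j`, and
`0` if nobody does. -/
def bidder (n : ℕ) (σ : ℕ → ℕ) : ℕ := first n (fun i => ¬ ∃ j < n, σ (n + j) = i + 1)

/-- An object that is cheapest for person `i`, taking the prices into account. -/
def target (n : ℕ) (c : ℕ → ℕ → ℕ) (σ : ℕ → ℕ) (i : ℕ) : ℕ :=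
  first n (fun j => ∀ k < n, c i j + σ j ≤ c i k + σ k)

/-- The next state: the bidder takes over the object that is cheapest for it and raises its price by
one. -/
def bid (n : ℕ) (c : ℕ → ℕ → ℕ) (σ : ℕ → ℕ) (l : ℕ) : ℕ :=
  if bidder n σ < n then
    if l = target n c σ (bidder n σ) then σ l + 1
    else if l = n + target n c σ (bidder n σ) then bidder n σ + 1 else σ l
  else σ l

/-- The state encoded by the number `a` in base `β`.  Only positions `l < 2 * n` matter; capping the
exponent bounds the size of the powers for all `l`. -/
def decode (n β a l : ℕ) : ℕ := a / β ^ min l (2 * n) % β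

/-- The next state, encoded.  Digits are reduced modulo `β` to bound the code in all cases; in states
that arise in an auction they are below `β` anyway. -/
def bidCode (n : ℕ) (c : ℕ → ℕ → ℕ) (β a : ℕ) : ℕ :=
  ∑ l ∈ range (2 * n), bid n c (decode n β a) l % β * β ^ min l (2 * n)

/-- The state after `T` rounds, encoded. -/
def run (n : ℕ) (c : ℕ → ℕ → ℕ) (β T : ℕ) : ℕ := Nat.rec 0 (fun _ a => bidCode n c β a) T

/-- The total cost of the objects to their owners. -/
def value (n : ℕ) (c : ℕ → ℕ → ℕ) (σ : ℕ → ℕ) : ℕ := ∑ j ∈ range n, c (σ (n + j) - 1) j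

theorem decode_sum {n β : ℕ} (x : ℕ → ℕ) (hβ : 0 < β) {l : ℕ} (hl : l < 2 * n) :
    decode n β (∑ l ∈ range (2 * n), x l % β * β ^ min l (2 * n)) l = x l % β := by
  have h : ∑ l ∈ range (2 * n), x l % β * β ^ min l (2 * n) =
      (finFunctionFinEquiv (fun i : Fin (2 * n) => (⟨x i % β, Nat.mod_lt _ hβ⟩ : Fin β)) : ℕ) := by
    rw [finFunctionFinEquiv_apply, sum_range]
    exact sum_congr rfl fun i _ => by rw [min_eq_left i.2.le]
  set f : Fin (2 * n) → Fin β := fun i => ⟨x i % β, Nat.mod_lt _ hβ⟩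
  have h2 : ((finFunctionFinEquiv.symm (finFunctionFinEquiv f)) ⟨l, hl⟩ : ℕ) = x l % β := by
    rw [Equiv.symm_apply_apply]
  rw [decode, min_eq_left hl.le, h, ← h2]
  rfl

/-- The invariant of the auction: each person owns at most one object, objects without owner are
free, and the object of a person is within one unit of being cheapest for it. -/
structure Inv (n : ℕ) (c : ℕ → ℕ → ℕ) (B : ℕ) (σ : ℕ → ℕ) : Prop where
  price_le : ∀ j < n, σ j ≤ B + 1
  owner_le : ∀ j < n, σ (n + j) ≤ n
  inj : ∀ j < n, ∀ k < n, σ (n + j) = σ (n + k) → σ (n + j) ≠ 0 → j = k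
  free : ∀ j < n, σ (n + j) = 0 → σ j = 0
  slack : ∀ j < n, ∀ i, σ (n + j) = i + 1 → ∀ k < n, c i j + σ j ≤ c i k + σ k + 1

variable {n : ℕ} {c : ℕ → ℕ → ℕ} {B : ℕ} {σ σ' : ℕ → ℕ}

theorem Inv.congr (h : Inv n c B σ) (hσ : ∀ l < 2 * n, σ' l = σ l) : Inv n c B σ' := by
  have e1 : ∀ j < n, σ' j = σ j := fun j hj => hσ j (by omega)
  have e2 : ∀ j < n, σ' (n + j) = σ (n + j) := fun j hj => hσ _ (by omega)
  refine ⟨fun j hj => ?_, fun j hj => ?_, fun j hj k hk => ?_, fun j hj => ?_,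
    fun j hj i hi k hk => ?_⟩
  · rw [e1 j hj]; exact h.price_le j hj
  · rw [e2 j hj]; exact h.owner_le j hj
  · rw [e2 j hj, e2 k hk]; exact h.inj j hj k hk
  · rw [e2 j hj, e1 j hj]; exact h.free j hj
  · rw [e1 j hj, e1 k hk]; exact h.slack j hj i ((e2 j hj).symm.trans hi) k hk

/-- When every object has an owner, the owners form a permutation. -/
theorem Inv.exists_perm (h : Inv n c B σ) (hown : ∀ j < n, σ (n + j) ≠ 0) :
    ∃ π : Equiv.Perm (Fin n), ∀ j : Fin n, σ (n + j) = π j + 1 := by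
  let f : Fin n → Fin n := fun j => ⟨σ (n + j) - 1, by
    have := h.owner_le j j.2
    have := hown j j.2
    omega⟩
  have hf : Function.Injective f := by
    intro j k hjk
    have hjk : σ (n + j) - 1 = σ (n + k) - 1 := congrArg Fin.val hjk
    have h1 := hown j j.2
    have h2 := hown k k.2
    exact Fin.ext (h.inj j j.2 k k.2 (by omega) h1)
  refine ⟨Equiv.ofBijective f (Finite.injective_iff_bijective.1 hf), fun j => ?_⟩
  have := hown j j.2
  simp only [Equiv.ofBijective_apply, f]
  omega

theorem Inv.exists_free (h : Inv n c B σ) {i : ℕ} (hi : i < n)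
    (hfree : ∀ j < n, σ (n + j) ≠ i + 1) : ∃ j < n, σ (n + j) = 0 := by
  by_contra! hall
  obtain ⟨π, hπ⟩ := h.exists_perm hall
  have := hπ (π.symm ⟨i, hi⟩)
  rw [Equiv.apply_symm_apply] at this
  exact hfree _ (Fin.is_lt _) this

theorem target_spec (hn : 0 < n) (c : ℕ → ℕ → ℕ) (σ : ℕ → ℕ) (i : ℕ) : target n c σ i < n ∧
    ∀ k < n, c i (target n c σ i) + σ (target n c σ i) ≤ c i k + σ k := by
  obtain ⟨j, hj, hmin⟩ := exists_min_image (range n) (fun j => c i j + σ j)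
    ⟨0, mem_range.2 hn⟩
  have h : target n c σ i < n := first_lt (mem_range.1 hj) fun k hk => hmin k (mem_range.2 hk)
  exact ⟨h, first_spec h⟩

theorem bidder_spec (h : bidder n σ < n) : ∀ j < n, σ (n + j) ≠ bidder n σ + 1 :=
  fun j hj hj' => first_spec h ⟨j, hj, hj'⟩

theorem Inv.bid (h : Inv n c B σ) (hc : ∀ i j, c i j ≤ B) : Inv n c B (bid n c σ) := by
  by_cases hi : bidder n σ < n
  swap
  · exact h.congr fun l _ => by rw [Auction.bid, if_neg hi]
  have hfree := bidder_spec hi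
  obtain ⟨ht, htmin⟩ := target_spec ((Nat.zero_le _).trans_lt hi) c σ (bidder n σ)
  obtain ⟨k₀, hk₀, hk₀'⟩ := h.exists_free hi hfree
  set i := bidder n σ with hidef
  set t := target n c σ i with htdef
  have e1 : ∀ j < n, Auction.bid n c σ j = if j = t then σ j + 1 else σ j := by
    intro j hj
    rw [Auction.bid, if_pos hi, ← hidef, ← htdef]
    by_cases hjt : j = t
    · rw [if_pos hjt, if_pos hjt]
    · rw [if_neg hjt, if_neg hjt, if_neg (by omega)]
  have e2 : ∀ j < n, Auction.bid n c σ (n + j) = if j = t then i + 1 else σ (n + j) := by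
    intro j hj
    rw [Auction.bid, if_pos hi, ← hidef, ← htdef, if_neg (by omega)]
    by_cases hjt : j = t
    · rw [if_pos (by omega), if_pos hjt]
    · rw [if_neg (by omega), if_neg hjt]
  have hge : ∀ j < n, σ j ≤ Auction.bid n c σ j := fun j hj => by
    rw [e1 j hj]; split_ifs <;> omega
  have htB : σ t ≤ B := by
    have h1 := htmin k₀ hk₀
    rw [h.free k₀ hk₀ hk₀'] at h1
    have := hc i k₀
    omega
  refine ⟨fun j hj => ?_, fun j hj => ?_, fun j hj k hk => ?_, fun j hj => ?_,
    fun j hj i' hi' k hk => ?_⟩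
  · have := h.price_le j hj
    rw [e1 j hj]
    split_ifs with hjt
    · subst hjt
      omega
    · exact this
  · have := h.owner_le j hj
    rw [e2 j hj]
    split_ifs <;> omega
  · rw [e2 j hj, e2 k hk]
    split_ifs with h1 h2 h2
    · exact fun _ _ => h1.trans h2.symm
    · exact fun e => absurd e.symm (hfree k hk)
    · exact fun e => absurd e (hfree j hj)
    · exact h.inj j hj k hk
  · rw [e2 j hj, e1 j hj]
    split_ifs
    · intro e
      omega
    · exact h.free j hj
  · have hk' := hge k hk
    rw [e2 j hj] at hi'
    rw [e1 j hj]
    split_ifs at hi' ⊢ with hjt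
    · obtain rfl : i = i' := by omega
      subst hjt
      have := htmin k hk
      omega
    · have := h.slack j hj i' hi' k hk
      omega

theorem sum_bid (hi : bidder n σ < n) :
    ∑ j ∈ range n, bid n c σ j = ∑ j ∈ range n, σ j + 1 := by
  have ht := (target_spec ((Nat.zero_le _).trans_lt hi) c σ (bidder n σ)).1
  have e1 : ∀ j ∈ range n, bid n c σ j =
      σ j + if j = target n c σ (bidder n σ) then 1 else 0 := by
    intro j hj
    have := mem_range.1 hj
    rw [bid, if_pos hi]
    by_cases hjt : j = target n c σ (bidder n σ)
    · rw [if_pos hjt, if_pos hjt]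
    · rw [if_neg hjt, if_neg hjt, if_neg (by omega), add_zero]
  rw [sum_congr rfl e1, sum_add_distrib, sum_ite_eq', if_pos (mem_range.2 ht)]

theorem decode_bidCode {β a : ℕ} (hβ : B + n + 2 ≤ β) (hc : ∀ i j, c i j ≤ B)
    (h : Inv n c B (decode n β a)) : ∀ l < 2 * n,
    decode n β (bidCode n c β a) l = bid n c (decode n β a) l := by
  intro l hl
  rw [bidCode, decode_sum _ (by omega) hl]
  refine Nat.mod_eq_of_lt ?_
  have hb := h.bid hc
  rcases lt_or_ge l n with hln | hln
  · have := hb.price_le l hln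
    omega
  · have := hb.owner_le (l - n) (by omega)
    rw [Nat.add_sub_cancel' hln] at this
    omega

/-- Prices never exceed `B + 1`, and each bid raises their sum by one, so all objects are assigned
after `n * (B + 1) + 1` rounds. -/
theorem inv_run {β : ℕ} (hβ : B + n + 2 ≤ β) (hc : ∀ i j, c i j ≤ B) :
    Inv n c B (decode n β (run n c β (n * (B + 1) + 1))) ∧
      ¬ bidder n (decode n β (run n c β (n * (B + 1) + 1))) < n := by
  have key : ∀ T, Inv n c B (decode n β (run n c β T)) ∧
      (bidder n (decode n β (run n c β T)) < n →
        T ≤ ∑ j ∈ range n, decode n β (run n c β T) j) := by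
    intro T
    induction T with
    | zero =>
      refine ⟨?_, fun _ => Nat.zero_le _⟩
      have h0 : ∀ l, decode n β (run n c β 0) l = 0 := fun l => by simp [run, decode]
      exact ⟨fun j _ => by simp [h0], fun j _ => by simp [h0],
        fun j _ k _ _ h => absurd (h0 _) h, fun j _ _ => h0 j,
        fun j _ i hi => absurd (hi.symm.trans (h0 _)) (Nat.succ_ne_zero _)⟩
    | succ T ih =>
      obtain ⟨hinv, hT⟩ := ih
      have hd := decode_bidCode hβ hc hinv
      have hs : run n c β (T + 1) = bidCode n c β (run n c β T) := rfl
      refine ⟨hs ▸ (hinv.bid hc).congr hd, fun hb => ?_⟩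
      rw [hs] at hb ⊢
      by_cases hi : bidder n (decode n β (run n c β T)) < n
      · rw [sum_congr rfl fun j hj => hd j (by have := mem_range.1 hj; omega), sum_bid hi]
        exact Nat.succ_le_succ (hT hi)
      -- once everybody owns an object the state does not change any more
      · exfalso
        refine hi ?_
        have hn := first_spec hb
        refine first_lt hb ?_
        rintro ⟨j, hj, hj'⟩
        refine hn ⟨j, hj, ?_⟩
        rw [hd _ (by omega), bid, if_neg hi]
        exact hj'
  obtain ⟨hinv, hT⟩ := key (n * (B + 1) + 1)
  refine ⟨hinv, fun hb => ?_⟩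
  have := sum_le_card_nsmul (range n) (fun j => decode n β (run n c β (n * (B + 1) + 1)) j) (B + 1) fun j hj => hinv.price_le j (mem_range.1 hj)
  rw [card_range, smul_eq_mul] at this
  have := hT hb
  omega

theorem Inv.value_spec (h : Inv n c B σ) (hb : ¬ bidder n σ < n) :
    ∃ τ : Equiv.Perm (Fin n), value n c σ = ∑ i : Fin n, c i (τ i) ∧
      ∀ τ' : Equiv.Perm (Fin n), value n c σ ≤ ∑ i : Fin n, c i (τ' i) + n := by
  have hall : ∀ i : Fin n, ∃ j : Fin n, σ (n + j) = i + 1 := by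
    intro i
    by_contra hi
    refine hb (first_lt i.2 fun hj => hi ?_)
    obtain ⟨j, hj, hj'⟩ := hj
    exact ⟨⟨j, hj⟩, hj'⟩
  choose τ hτ using hall
  have hinj : Function.Injective τ := fun i i' hii => by
    have h1 := hτ i
    have h2 := hτ i'
    rw [hii] at h1
    exact Fin.ext (by omega)
  let τ₀ := Equiv.ofBijective τ (Finite.injective_iff_bijective.1 hinj)
  have hv : value n c σ = ∑ i : Fin n, c i (τ₀ i) := by
    rw [value, sum_range, ← τ₀.sum_comp]
    refine sum_congr rfl fun i _ => ?_
    have : σ (n + (τ₀ i : ℕ)) = i + 1 := hτ i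
    rw [this, Nat.add_sub_cancel]
  refine ⟨τ₀, hv, fun τ' => ?_⟩
  -- summing the slackness conditions, the prices cancel
  have h1 : ∑ i : Fin n, (c i (τ₀ i) + σ (τ₀ i)) ≤ ∑ i : Fin n, (c i (τ' i) + σ (τ' i) + 1) :=
    sum_le_sum fun i _ => h.slack (τ₀ i) (Fin.is_lt _) i (hτ i) (τ' i) (Fin.is_lt _)
  rw [sum_add_distrib, sum_add_distrib, sum_add_distrib, Equiv.sum_comp τ₀ (fun j : Fin n => σ j),
    Equiv.sum_comp τ' (fun j : Fin n => σ j)] at h1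
  simp only [sum_const, card_univ, Fintype.card_fin, smul_eq_mul, mul_one] at h1
  omega

/-- Distances in units of `Z / S`, rounded down and capped at `2 * S`, the value also used to forbid
fixed points. -/
def cost (S Z : ℕ) (e : ℕ → ℕ → ℕ) (i j : ℕ) : ℕ :=
  if i = j then 2 * S else min (S * e i j / Z) (2 * S)

/-- The cost of the assignment found by the auction, in units of `Z / S`.  Costs are at most
`2 * S`, so prices are at most `2 * S + 1`, which determines the base of the encoding and the number
of rounds. -/
def approxCover (n S Z : ℕ) (e : ℕ → ℕ → ℕ) : ℕ :=
  value n (cost S Z e) (decode n (2 * S + n + 2)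
    (run n (cost S Z e) (2 * S + n + 2) (n * (2 * S + 1) + 1)))

theorem approxCover_spec {S Z : ℕ} (e : ℕ → ℕ → ℕ) (hZ : 0 < Z)
    (hex : ∃ σ : Equiv.Perm (Fin n), ∀ v, σ v ≠ v)
    (hK : CycleCover.minDerangement (fun v w : Fin n => e v w) ≤ 2 * Z) :
    approxCover n S Z e * Z ≤ S * CycleCover.minDerangement (fun v w : Fin n => e v w) + n * Z ∧
    S * CycleCover.minDerangement (fun v w : Fin n => e v w) ≤ approxCover n S Z e * Z + n * Z ∧
    approxCover n S Z e ≤ 2 * S + n := by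
  have hc : ∀ i j, cost S Z e i j ≤ 2 * S := fun i j => by
    rw [cost]; split_ifs
    · exact le_rfl
    · exact min_le_right _ _
  obtain ⟨hinv, hb⟩ := inv_run (β := 2 * S + n + 2) le_rfl hc
  obtain ⟨τ, hτ, hopt⟩ := hinv.value_spec hb
  rw [← approxCover] at hτ hopt
  set Y := approxCover n S Z e
  set K := CycleCover.minDerangement (fun v w : Fin n => e v w) with hKdef
  obtain ⟨σ, hσ, hσK⟩ := CycleCover.exists_minDerangement (fun v w : Fin n => e v w) hex
  rw [← hKdef] at hσK
  have hup : (∑ i : Fin n, cost S Z e i (σ i)) * Z ≤ S * K := by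
    rw [← hσK, mul_sum, sum_mul]
    refine sum_le_sum fun i _ => ?_
    rw [cost, if_neg fun h => hσ i (Fin.ext h).symm]
    exact (Nat.mul_le_mul_right _ (min_le_left _ _)).trans (Nat.div_mul_le_self _ _)
  have hYup : Y * Z ≤ S * K + n * Z := by
    have := Nat.mul_le_mul_right Z (hopt σ)
    rw [add_mul] at this
    omega
  refine ⟨hYup, ?_, ?_⟩
  · by_cases hcap : ∃ i : Fin n, cost S Z e i (τ i) = 2 * S
    · obtain ⟨i, hi⟩ := hcap
      have h1 : 2 * S ≤ Y := by
        rw [hτ, ← hi]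
        exact single_le_sum (f := fun i : Fin n => cost S Z e i (τ i))
          (fun _ _ => Nat.zero_le _) (mem_univ i)
      have h2 := Nat.mul_le_mul_left S hK
      have h3 := Nat.mul_le_mul_right Z h1
      have : S * (2 * Z) = 2 * S * Z := by ring
      omega
    · push Not at hcap
      have hτf : ∀ i, τ i ≠ i := fun i h => hcap i (by rw [cost, if_pos (by rw [h])])
      have h1 := CycleCover.minDerangement_le (fun v w : Fin n => e v w) hτf
      rw [← hKdef] at h1
      refine (Nat.mul_le_mul_left S h1).trans ?_
      have : n * Z = ∑ i : Fin n, Z := by simp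
      rw [mul_sum, hτ, sum_mul, this, ← sum_add_distrib]
      refine sum_le_sum fun i _ => ?_
      have h2 := hcap i
      rw [cost, if_neg fun h => hτf i (Fin.ext h).symm] at h2 ⊢
      have h3 : S * e i (τ i) / Z ≤ 2 * S := by
        by_contra h
        exact h2 (min_eq_right (by omega))
      rw [min_eq_left h3]
      have := Nat.div_add_mod (S * e i (τ i)) Z
      have := Nat.mod_lt (S * e i (τ i)) hZ
      rw [mul_comm Z] at *
      omega
  · have h1 := hopt σ
    have h2 : ∑ i : Fin n, cost S Z e i (σ i) ≤ 2 * S := by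
      refine Nat.le_of_mul_le_mul_right (hup.trans ?_) hZ
      calc S * K ≤ S * (2 * Z) := Nat.mul_le_mul_left _ hK
        _ = 2 * S * Z := by ring
    omega

end Auction

/-! ### Sampling and concentration -/

namespace Sampling

open Finset

theorem sum_sq_le {M : ℕ} (N : ℕ) (g : Fin M → ℝ) (hg : ∑ y, g y = 0) {V : ℝ}
    (hV : ∀ y, g y ^ 2 ≤ V) :
    ∑ f : Fin N → Fin M, (∑ i, g (f i)) ^ 2 ≤ N * V * M ^ N := by
  induction N with
  | zero => simp
  | succ N ih =>
    rw [← (Fin.consEquiv (fun _ : Fin (N + 1) => Fin M)).sum_comp, Fintype.sum_prod_type]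
    simp only [Fin.consEquiv_apply, Fin.sum_univ_succ, Fin.cons_zero, Fin.cons_succ]
    have h1 : ∀ x, ∑ f : Fin N → Fin M, (g x + ∑ i, g (f i)) ^ 2 =
        M ^ N * g x ^ 2 + g x * (2 * ∑ f : Fin N → Fin M, ∑ i, g (f i)) +
          ∑ f : Fin N → Fin M, (∑ i, g (f i)) ^ 2 := by
      intro x
      simp only [add_sq, sum_add_distrib, ← mul_sum]
      simp
      ring
    simp only [h1, sum_add_distrib]
    rw [← sum_mul, hg, zero_mul, add_zero, ← mul_sum, sum_const, card_univ, Fintype.card_fin,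
      nsmul_eq_mul]
    have h2 : ∑ y, g y ^ 2 ≤ M * V := by
      simpa using sum_le_sum fun y (_ : y ∈ univ) => hV y
    have h3 := mul_le_mul_of_nonneg_left h2 (pow_nonneg (Nat.cast_nonneg (α := ℝ) M) N)
    have h4 := mul_le_mul_of_nonneg_left ih (Nat.cast_nonneg (α := ℝ) M)
    push_cast
    calc _ ≤ (M : ℝ) ^ N * (M * V) + M * (N * V * M ^ N) := add_le_add h3 h4
      _ = _ := by ring

/-- Chebyshev's inequality for the sum of `N` independent uniform samples. -/
theorem chebyshev {M : ℕ} (N : ℕ) (X : Fin M → ℝ) {μ V t : ℝ} (ht : 0 ≤ t)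
    (hμ : ∑ y, X y = M * μ)
    (hV : ∀ y, (X y - μ) ^ 2 ≤ V) :
    (#{f : Fin N → Fin M | t < |∑ i, X (f i) - N * μ|} : ℝ) * t ^ 2 ≤ N * V * M ^ N := by
  refine le_trans ?_ (sum_sq_le N (fun y => X y - μ) (by simp [hμ]) hV)
  rw [card_filter]
  push_cast
  rw [sum_mul]
  refine sum_le_sum fun f _ => ?_
  split_ifs with h
  · rw [sum_sub_distrib]
    simp only [sum_const, card_univ, Fintype.card_fin, nsmul_eq_mul, one_mul]
    rw [← sq_abs (∑ i, X (f i) - N * μ)]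
    exact pow_le_pow_left₀ ht h.le 2
  · rw [zero_mul]
    positivity

/-- A random number below `2 ^ Q` yields `N` digits in base `M`, which are nearly uniform when `M ^ N`
is small compared with `2 ^ Q`. -/
theorem card_digits_le {M N Q : ℕ} (hM : 0 < M) (hQ : 8 * M ^ N ≤ 2 ^ Q)
    (bad : (Fin N → ℕ) → Prop) [DecidablePred bad]
    (hbad : 8 * #{f : Fin N → Fin M | bad (fun i => f i)} ≤ M ^ N) :
    4 * #{R ∈ range (2 ^ Q) | bad (fun i => R / M ^ (i : ℕ) % M)} ≤ 2 ^ Q := by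
  have hP : 0 < M ^ N := pow_pos hM N
  have hdig : ∀ x j, ∀ i : Fin N, (x * M ^ N + j) / M ^ (i : ℕ) % M = j / M ^ (i : ℕ) % M := by
    intro x j i
    have e : x * M ^ N = M ^ (i : ℕ) * (M * (x * M ^ (N - i - 1))) := by
      have : N = i + 1 + (N - i - 1) := by omega
      conv_lhs => rw [this]
      ring
    rw [e, Nat.mul_add_div (pow_pos hM _), Nat.mul_add_mod]
  have hcount : #{R ∈ range ((2 ^ Q / M ^ N + 1) * M ^ N) | bad (fun i => R / M ^ (i : ℕ) % M)} =
      (2 ^ Q / M ^ N + 1) * #{f : Fin N → Fin M | bad (fun i => f i)} := by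
    rw [card_filter, Ticket.sum_range_mul]
    simp only [hdig]
    rw [sum_const, card_range, smul_eq_mul, card_filter, sum_range,
      ← finFunctionFinEquiv.symm.sum_comp]
    rfl
  have hsub : #{R ∈ range (2 ^ Q) | bad (fun i => R / M ^ (i : ℕ) % M)} ≤
      #{R ∈ range ((2 ^ Q / M ^ N + 1) * M ^ N) | bad (fun i => R / M ^ (i : ℕ) % M)} := by
    refine card_le_card (filter_subset_filter _ (range_subset_range.2 ?_))
    have := Nat.div_add_mod (2 ^ Q) (M ^ N)
    have := Nat.mod_lt (2 ^ Q) hP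
    rw [add_mul, mul_comm (2 ^ Q / M ^ N)]
    omega
  rw [hcount] at hsub
  have h1 := Nat.mul_le_mul_left (2 ^ Q / M ^ N + 1) hbad
  have h2 := Nat.div_mul_le_self (2 ^ Q) (M ^ N)
  have h3 : (2 ^ Q / M ^ N + 1) * M ^ N = 2 ^ Q / M ^ N * M ^ N + M ^ N := by ring
  have h4 : (2 ^ Q / M ^ N + 1) * (8 * #{f : Fin N → Fin M | bad (fun i => f i)}) =
    8 * ((2 ^ Q / M ^ N + 1) * #{f : Fin N → Fin M | bad (fun i => f i)}) := by ring
  omega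

/-- Averaging `288 * n ^ 2 * h ^ 2` samples of a rounded quantity `Y y ≈ S * ρ y` with
`ρ y ∈ [1 / n, 2]` gives its mean up to a factor `1 ± 1 / h` with probability at least `3 / 4`.
Rounding shifts the mean by at most `n = S / (4 * n * h)`, a relative error of `1 / (4 * h)`, and by
Chebyshev's inequality the relative deviation from the shifted mean exceeds `1 / (2 * h)` with
probability at most `1 / 8`. -/
theorem le_card_accurate {n h M Q S N : ℕ} (hn : 0 < n) (hh : 0 < h) (hM : 0 < M)
    (hS : S = 4 * n ^ 2 * h) (hN : N = 288 * n ^ 2 * h ^ 2) (hQ : 8 * M ^ N ≤ 2 ^ Q)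
    (Y : ℕ → ℕ) (ρ : ℕ → ℝ) (hρ : ∀ y < M, 1 / (n : ℝ) ≤ ρ y) (hY : ∀ y < M, Y y ≤ 2 * S + n)
    (hYρ : ∀ y < M, |(Y y : ℝ) - S * ρ y| ≤ n) {μ : ℝ} (hμ : ∑ y ∈ range M, ρ y = M * μ) :
    (3 / 4 : ℝ) * 2 ^ Q ≤ #{R ∈ range (2 ^ Q) |
      |((∑ i ∈ range N, Y (R / M ^ i % M) : ℕ) : ℝ) - N * S * μ| ≤ N * S * μ / h} := by
  classical
  have hn' : (0 : ℝ) < n := by exact_mod_cast hn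
  have hn1 : (1 : ℝ) ≤ n := by exact_mod_cast hn
  have hh1 : (1 : ℝ) ≤ h := by exact_mod_cast hh
  have hh' : (0 : ℝ) < h := by linarith
  have hM' : (0 : ℝ) < M := by exact_mod_cast hM
  have hSr : (S : ℝ) = 4 * n ^ 2 * h := by rw [hS]; push_cast; ring
  have hNr : (N : ℝ) = 288 * n ^ 2 * h ^ 2 := by rw [hN]; push_cast; ring
  have hS' : (0 : ℝ) < S := by rw [hSr]; positivity
  have hN' : (0 : ℝ) < N := by rw [hNr]; positivity
  have hμ1 : 1 / (n : ℝ) ≤ μ := by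
    have : M * (1 / (n : ℝ)) ≤ M * μ := by
      rw [← hμ]
      simpa using card_nsmul_le_sum (range M) ρ (1 / (n : ℝ)) fun y hy => hρ y (mem_range.1 hy)
    exact le_of_mul_le_mul_left this hM'
  have hnμ : 1 ≤ n * μ := by
    rw [div_le_iff₀ hn'] at hμ1
    linarith
  have hμ0 : 0 < μ := lt_of_lt_of_le (by positivity) hμ1
  set ν : ℝ := (∑ y ∈ range M, (Y y : ℝ)) / M with hν
  have hYν : ∑ y : Fin M, (Y y : ℝ) = M * ν := by
    rw [hν, mul_div_cancel₀ _ hM'.ne', sum_range]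
  have hnonneg : ∀ y, 0 ≤ (Y y : ℝ) := fun y => Nat.cast_nonneg _
  have hYle : ∀ y < M, (Y y : ℝ) ≤ 3 * S := by
    intro y hy
    have h1 : (Y y : ℝ) ≤ 2 * S + n := by exact_mod_cast hY y hy
    have h2 : (n : ℝ) ≤ S := by rw [hSr]; nlinarith [mul_pos hn' hh', mul_pos hn' hn']
    linarith
  have hν0 : 0 ≤ ν := div_nonneg (sum_nonneg fun y _ => hnonneg y) hM'.le
  have hν3 : ν ≤ 3 * S := by
    rw [hν, div_le_iff₀ hM']
    have := sum_le_card_nsmul (range M) (fun y => (Y y : ℝ)) (3 * S) fun y hy =>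
      hYle y (mem_range.1 hy)
    rw [card_range, nsmul_eq_mul] at this
    linarith
  have hbias : |ν - S * μ| ≤ n := by
    have h1 : ν - S * μ = (∑ y ∈ range M, ((Y y : ℝ) - S * ρ y)) / M := by
      rw [sum_sub_distrib, ← mul_sum, hμ, hν, sub_div]
      congr 1
      field_simp
    rw [h1, abs_div, abs_of_pos hM', div_le_iff₀ hM']
    refine (abs_sum_le_sum_abs _ _).trans ?_
    have := sum_le_card_nsmul (range M) (fun y => |(Y y : ℝ) - S * ρ y|) n fun y hy =>
      hYρ y (mem_range.1 hy)
    rw [card_range, nsmul_eq_mul] at this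
    linarith
  have hbias' : (n : ℝ) ≤ S * μ / (4 * h) := by
    rw [le_div_iff₀ (by positivity), hSr]
    nlinarith [mul_pos (mul_pos hn' hh') hn']
  set t : ℝ := N * S * μ / (2 * h) with ht
  have ht0 : 0 < t := by positivity
  have hcheb := chebyshev N (fun y : Fin M => (Y y : ℝ)) (V := (3 * S) ^ 2) ht0.le hYν
    fun y => by
      rw [← sq_abs]
      refine pow_le_pow_left₀ (abs_nonneg _) (abs_le.2 ⟨?_, ?_⟩) 2
      · linarith [hnonneg y]
      · linarith [hYle y y.2]
  have hbad : 8 * #{f : Fin N → Fin M | t < |∑ i, (Y (f i) : ℝ) - N * ν|} ≤ M ^ N := by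
    have h1 : N * (3 * S : ℝ) ^ 2 * M ^ N * 8 ≤ M ^ N * t ^ 2 := by
      have h2 : N * (3 * S : ℝ) ^ 2 * 8 ≤ t ^ 2 := by
        rw [ht, div_pow, le_div_iff₀ (by positivity)]
        have h3 : (N : ℝ) * 1 ≤ N * (n * μ) ^ 2 :=
          mul_le_mul_of_nonneg_left (one_le_pow₀ hnμ) hN'.le
        have h4 : (N : ℝ) * (N * S ^ 2) * 1 ≤ N * (N * S ^ 2) * (n * μ) ^ 2 := by
          refine mul_le_mul_of_nonneg_left (one_le_pow₀ hnμ) (by positivity)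
        have h5 : N * (3 * S : ℝ) ^ 2 * 8 * (2 * h) ^ 2 * n ^ 2 = N * (N * S ^ 2) * 1 := by
          rw [hNr]
          ring
        have h6 : (N * S * μ : ℝ) ^ 2 * n ^ 2 = N * (N * S ^ 2) * (n * μ) ^ 2 := by ring
        rw [← h5, ← h6] at h4
        exact le_of_mul_le_mul_right h4 (by positivity)
      nlinarith [pow_pos hM' N]
    have h2 : ((#{f : Fin N → Fin M | t < |∑ i, (Y (f i) : ℝ) - N * ν|} : ℝ) * 8) * t ^ 2 ≤
        M ^ N * t ^ 2 := by linarith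
    have h3 := le_of_mul_le_mul_right h2 (by positivity)
    have h4 : ((8 * #{f : Fin N → Fin M | t < |∑ i, (Y (f i) : ℝ) - N * ν|} : ℕ) : ℝ) ≤
        (M ^ N : ℕ) := by
      push_cast
      linarith
    exact_mod_cast h4
  have hcard := card_digits_le hM hQ (fun f => t < |∑ i, (Y (f i) : ℝ) - N * ν|) hbad
  beta_reduce at hcard
  have hsplit := card_filter_add_card_filter_not (s := range (2 ^ Q))
    (fun R => t < |∑ i : Fin N, (Y (R / M ^ (i : ℕ) % M) : ℝ) - N * ν|)
  rw [card_range] at hsplit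
  have hgood : 3 * 2 ^ Q ≤ 4 * #{R ∈ range (2 ^ Q) |
      ¬ t < |∑ i : Fin N, (Y (R / M ^ (i : ℕ) % M) : ℝ) - N * ν|} := by omega
  have hmono : #{R ∈ range (2 ^ Q) | ¬ t < |∑ i : Fin N, (Y (R / M ^ (i : ℕ) % M) : ℝ) - N * ν|} ≤
      #{R ∈ range (2 ^ Q) |
        |((∑ i ∈ range N, Y (R / M ^ i % M) : ℕ) : ℝ) - N * S * μ| ≤ N * S * μ / h} := by
    refine card_le_card fun R hR => ?_
    rw [mem_filter] at hR ⊢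
    refine ⟨hR.1, ?_⟩
    have h1 := not_lt.1 hR.2
    rw [sum_range, Nat.cast_sum]
    have h2 : |N * ν - N * S * μ| ≤ N * S * μ / (4 * h) := by
      rw [show N * ν - N * S * μ = N * (ν - S * μ) by ring, abs_mul, abs_of_pos hN',
        show N * S * μ / (4 * h) = N * (S * μ / (4 * h)) by ring]
      exact mul_le_mul_of_nonneg_left (hbias.trans hbias') hN'.le
    refine (abs_sub_le _ (N * ν) _).trans ((add_le_add h1 h2).trans ?_)
    rw [ht]
    have h3 : N * S * μ / (2 * h) + N * S * μ / (4 * h) = N * S * μ / h * (3 / 4) := by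
      field_simp
      ring
    rw [h3]
    have : 0 ≤ N * S * μ / h := by positivity
    linarith
  have : (3 * 2 ^ Q : ℝ) ≤ 4 * (#{R ∈ range (2 ^ Q) |
        |((∑ i ∈ range N, Y (R / M ^ i % M) : ℕ) : ℝ) - N * S * μ| ≤ N * S * μ / h} : ℝ) := by
    exact_mod_cast hgood.trans (Nat.mul_le_mul_left 4 hmono)
  linarith

end Sampling

/-! ### The algorithm -/

namespace CycleCoverScheme

open Finset RAM StochasticGraph

/-- Stochastic graphs together with an accuracy. -/
def source : Source where
  X := {x : StochasticGraph × ℚ // 0 < x.2}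
  load := fun x => x.1.1.load x.1.2
  size := fun x => x.1.1.size x.1.2 + ⌈1 / x.1.2⌉₊
  regs := 4

section Defs

variable (x : source.X)

/-- The number of nodes. -/
def nodes : ℕ := x.1.1.n

/-- The number of points. -/
def points : ℕ := x.1.1.m

/-- The entry `k` of input array `b`; all entries are nonnegative. -/
def cell (b k : ℕ) : ℕ := ((source.load x).arr b k).toNat

/-- A common denominator of the probabilities. -/
def probDen : ℕ := ∏ k ∈ range (nodes x * points x), cell x 3 k

/-- A common denominator of the distances. -/
def distDen : ℕ := ∏ k ∈ range (points x * points x), cell x 1 k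

/-- The probability that node `v` is at point `s`, times `probDen x`. -/
def prob (v s : ℕ) : ℕ := cell x 2 (v * points x + s) * (probDen x / cell x 3 (v * points x + s))

/-- The distance of the points `s` and `t`, times `distDen x`. -/
def dist (s t : ℕ) : ℕ := cell x 0 (s * points x + t) * (distDen x / cell x 1 (s * points x + t))

/-- An integer that is at least `1 / ε`. -/
def precision : ℕ := x.1.2.den / x.1.2.num.toNat + 1

/-- The scale to which distances are rounded in the auction. -/
def scale : ℕ := 4 * nodes x ^ 2 * precision x

/-- The number of samples. -/
def samples : ℕ := 288 * nodes x ^ 2 * precision x ^ 2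

/-- The number of tickets. -/
def tickets : ℕ := Ticket.total (nodes x) (points x) (dist x) (prob x)

/-- The number of coins that are flipped: `2 ^ coinCount x` is at least `8` times the number of
sequences of samples. -/
def coinCount : ℕ := samples x * (tickets x).size + 3

/-- The location of node `u` for ticket `y`. -/
def place (y u : ℕ) : ℕ := Ticket.loc (nodes x) (points x) (dist x) (prob x) y u

/-- The value of `Ticket.nearSum` for ticket `y`, written with natural numbers as indices. -/
def nearTotal (y : ℕ) : ℕ :=
  ∑ v ∈ range (nodes x), ∑ w ∈ range (nodes x),
    if v ≠ w ∧ ∀ u < nodes x, u ≠ v →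
      dist x (place x y v) (place x y w) ≤ dist x (place x y v) (place x y u)
    then dist x (place x y v) (place x y w) else 0

/-- The length of a nearly minimum cycle cover for ticket `y`, divided by `nearTotal x y` and
multiplied by `scale x`. -/
def sampleValue (y : ℕ) : ℕ :=
  Auction.approxCover (nodes x) (scale x) (nearTotal x y)
    (fun i j => dist x (place x y i) (place x y j))

/-- The numerator of the output, where `R` is the random number formed by the coins. -/
def outNum (R : ℕ) : ℕ :=
  (∑ i ∈ range (samples x), sampleValue x (R / tickets x ^ min i (samples x) % tickets x)) *
    tickets x

/-- The denominator of the output. -/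
def outDen : ℕ := samples x * scale x * (probDen x ^ nodes x * distDen x)

end Defs

/-! ### Bounds on the entries of the input -/

section Bounds

variable (x : source.X)

theorem size_eq : source.size x = x.1.1.size x.1.2 + ⌈1 / x.1.2⌉₊ := rfl

theorem ratBits_pos (q : ℚ) : 1 ≤ ratBits q := by
  unfold ratBits RAM.bits
  omega

theorem points_pos (G : StochasticGraph) : 0 < G.m := by
  rcases Nat.eq_zero_or_pos G.m with h | h
  · have h1 := G.p_sum ⟨0, by have := G.two_le_n; omega⟩
    have : IsEmpty (Fin G.m) := h ▸ Fin.isEmpty'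
    simp at h1
  · exact h

theorem mul_le_size : nodes x * points x ≤ source.size x := by
  have h : ∑ v : Fin x.1.1.n, ∑ s : Fin x.1.1.m, 1 ≤ ∑ v, ∑ s, ratBits (x.1.1.p v s) :=
    sum_le_sum fun v _ => sum_le_sum fun s _ => ratBits_pos _
  simp only [sum_const, card_univ, Fintype.card_fin, smul_eq_mul, mul_one] at h
  rw [size_eq, StochasticGraph.size]
  unfold nodes points
  omega

theorem nodes_le_size : nodes x ≤ source.size x :=
  (Nat.le_mul_of_pos_right _ (points_pos x.1.1)).trans (mul_le_size x)

theorem points_le_size : points x ≤ source.size x :=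
  (Nat.le_mul_of_pos_left _ (by have := x.1.1.two_le_n; unfold nodes; omega)).trans (mul_le_size x)

theorem precision_le_size : precision x ≤ source.size x + 1 := by
  have hε := x.2
  have h1 : (x.1.2.den / x.1.2.num.toNat : ℕ) ≤ ⌈1 / x.1.2⌉₊ := by
    refine Nat.cast_le (α := ℚ).1 (Nat.cast_div_le.trans ?_)
    refine le_trans (le_of_eq ?_) (Nat.le_ceil _)
    have h2 : ((x.1.2.num.toNat : ℕ) : ℚ) = x.1.2.num := by
      have : (x.1.2.num.toNat : ℤ) = x.1.2.num := Int.toNat_of_nonneg (Rat.num_pos.2 hε).le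
      exact_mod_cast this
    rw [h2]
    conv_rhs => rw [← Rat.num_div_den x.1.2]
    rw [one_div_div]
  rw [size_eq]
  unfold precision
  omega

theorem index_lt {a b : ℕ} (v : Fin a) (s : Fin b) : (v : ℕ) * b + s < a * b := by
  have := Nat.mul_le_mul_right b v.2
  have := s.2
  rw [Nat.succ_mul] at *
  omega

theorem table_mul_add {a b : ℕ} (f : Fin a → Fin b → ℤ) (v : Fin a) (s : Fin b) :
    table f ((v * b + s : ℕ) : ℤ) = f v s := by
  have hlt := index_lt v s
  have h : (0 : ℤ) ≤ ((v * b + s : ℕ) : ℤ) ∧ ((v * b + s : ℕ) : ℤ).toNat < a * b :=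
    ⟨Int.natCast_nonneg _, by rwa [Int.toNat_natCast]⟩
  rw [table, dif_pos h]
  have : (⟨((v * b + s : ℕ) : ℤ).toNat, h.2⟩ : Fin (a * b)) = finProdFinEquiv (v, s) := by
    apply Fin.ext
    simp only [Int.toNat_natCast, finProdFinEquiv_apply_val]
    ring
  rw [this, Equiv.symm_apply_apply]

theorem table_cases {a b : ℕ} (f : Fin a → Fin b → ℤ) (k : ℤ) :
    table f k = 0 ∨ ∃ v s, table f k = f v s := by
  unfold table
  split_ifs with h
  · exact Or.inr ⟨_, _, rfl⟩
  · exact Or.inl rfl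

theorem dist_nonneg (G : StochasticGraph) (s t : Fin G.m) : 0 ≤ G.d s t := by
  have h1 := G.d_triangle s t s
  rw [(G.d_eq_zero s s).2 rfl, G.d_comm t s] at h1
  linarith

theorem natCast_cell {b : ℕ} (hb : b < 4) (k : ℕ) : (source.load x).arr b k = cell x b k := by
  refine (Int.toNat_of_nonneg ?_).symm
  interval_cases b
  · rcases table_cases (fun s t => (x.1.1.d s t).num) k with h | ⟨v, s, h⟩
    · exact h.ge
    · exact h.ge.trans' (Rat.num_nonneg.2 (dist_nonneg _ _ _))
  · rcases table_cases (fun s t => ((x.1.1.d s t).den : ℤ)) k with h | ⟨v, s, h⟩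
    · exact h.ge
    · exact h.ge.trans' (Int.natCast_nonneg _)
  · rcases table_cases (fun v s => (x.1.1.p v s).num) k with h | ⟨v, s, h⟩
    · exact h.ge
    · exact h.ge.trans' (Rat.num_nonneg.2 (x.1.1.p_nonneg _ _))
  · rcases table_cases (fun v s => ((x.1.1.p v s).den : ℤ)) k with h | ⟨v, s, h⟩
    · exact h.ge
    · exact h.ge.trans' (Int.natCast_nonneg _)

theorem size_cell_le {b : ℕ} (hb : b < 4) (k : ℕ) : (cell x b k).size ≤ source.size x := by
  have h1 : ∀ q : ℚ, q.num.natAbs.size ≤ ratBits q := fun q => by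
    unfold ratBits RAM.bits; omega
  have h2 : ∀ q : ℚ, q.den.size ≤ ratBits q := fun q => by
    unfold ratBits RAM.bits; simp; omega
  have h3 : ∀ s t, ratBits (x.1.1.d s t) ≤ source.size x := fun s t => by
    have k1 := single_le_sum (f := fun s => ∑ t, ratBits (x.1.1.d s t))
      (fun _ _ => Nat.zero_le _) (mem_univ s)
    have k2 := single_le_sum (f := fun t => ratBits (x.1.1.d s t))
      (fun _ _ => Nat.zero_le _) (mem_univ t)
    rw [size_eq, StochasticGraph.size]
    omega
  have h4 : ∀ v s, ratBits (x.1.1.p v s) ≤ source.size x := fun v s => by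
    have k1 := single_le_sum (f := fun v => ∑ s, ratBits (x.1.1.p v s))
      (fun _ _ => Nat.zero_le _) (mem_univ v)
    have k2 := single_le_sum (f := fun s => ratBits (x.1.1.p v s))
      (fun _ _ => Nat.zero_le _) (mem_univ s)
    rw [size_eq, StochasticGraph.size]
    omega
  have h5 : (cell x b k).size = ((source.load x).arr b k).natAbs.size := by
    rw [natCast_cell x hb, Int.natAbs_natCast]
  rw [h5]
  interval_cases b
  · rcases table_cases (fun s t => (x.1.1.d s t).num) k with h | ⟨v, s, h⟩
    · simp [source, load, h]
    · exact (congrArg (fun z : ℤ => z.natAbs.size) h).le.trans ((h1 _).trans (h3 v s))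
  · rcases table_cases (fun s t => ((x.1.1.d s t).den : ℤ)) k with h | ⟨v, s, h⟩
    · simp [source, load, h]
    · exact (congrArg (fun z : ℤ => z.natAbs.size) h).le.trans ((h2 _).trans (h3 v s))
  · rcases table_cases (fun v s => (x.1.1.p v s).num) k with h | ⟨v, s, h⟩
    · simp [source, load, h]
    · exact (congrArg (fun z : ℤ => z.natAbs.size) h).le.trans ((h1 _).trans (h4 v s))
  · rcases table_cases (fun v s => ((x.1.1.p v s).den : ℤ)) k with h | ⟨v, s, h⟩
    · simp [source, load, h]
    · exact (congrArg (fun z : ℤ => z.natAbs.size) h).le.trans ((h2 _).trans (h4 v s))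

end Bounds

/-! ### The algorithm takes polynomial time -/

section PolyComp

variable {Γ : Ctx source}

theorem polyBdd_base {g : source.X → ℕ} (h : ∀ x, g x ≤ source.size x) :
    PolyBdd Γ (fun z => g (Γ.base z)) :=
  PolyBdd.size.mono fun z => (h _).trans (Γ.base_le z)

theorem polyBdd_nodes : PolyBdd Γ (fun z => nodes (Γ.base z)) := polyBdd_base nodes_le_size

theorem polyBdd_points : PolyBdd Γ (fun z => points (Γ.base z)) := polyBdd_base points_le_size

theorem polyBdd_precision : PolyBdd Γ (fun z => precision (Γ.base z)) :=
  (PolyBdd.size.add (.const 1)).mono fun z =>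
    (precision_le_size _).trans (Nat.succ_le_succ (Γ.base_le z))

theorem polyBdd_scale : PolyBdd Γ (fun z => scale (Γ.base z)) :=
  ((PolyBdd.const 4).mul (polyBdd_nodes.pow 2)).mul polyBdd_precision

theorem polyBdd_samples : PolyBdd Γ (fun z => samples (Γ.base z)) :=
  ((PolyBdd.const 288).mul (polyBdd_nodes.pow 2)).mul (polyBdd_precision.pow 2)

theorem _root_.RAM.PolyBdd.natSize {S : Source} {Γ : Ctx S} {g : Γ.I → ℕ} (hg : PolyBdd Γ g) :
    PolyBdd Γ (fun z => (g z).size) := hg.mono fun _ => size_le_self _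

theorem polyComp_nodes : PolyComp Γ (fun z => nodes (Γ.base z)) :=
  .reg 0 (by decide) polyBdd_nodes.natSize fun _ => rfl

theorem polyComp_points : PolyComp Γ (fun z => points (Γ.base z)) :=
  .reg 1 (by decide) polyBdd_points.natSize fun _ => rfl

theorem polyComp_precision : PolyComp Γ (fun z => precision (Γ.base z)) := by
  have hbits : ∀ x : source.X, x.1.2.num.natAbs.size + x.1.2.den.size ≤ source.size x := by
    intro x
    rw [size_eq, StochasticGraph.size, ratBits, RAM.bits, RAM.bits, Int.natAbs_natCast]
    unfold RAM.bits
    simp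
    omega
  refine (PolyComp.div (.reg 3 (by decide) ?_ fun _ => rfl) (.reg 2 (by decide) ?_ fun z => ?_)).add
    (.const 1)
  · exact polyBdd_base (g := fun x => x.1.2.den.size) fun x => by have := hbits x; omega
  · refine polyBdd_base (g := fun x => x.1.2.num.toNat.size) fun x => ?_
    have h1 : x.1.2.num.toNat ≤ x.1.2.num.natAbs := by omega
    have h2 := Nat.size_le_size h1
    have := hbits x
    omega
  · exact (Int.toNat_of_nonneg (Rat.num_pos.2 (Γ.base z).2).le).symm

theorem polyComp_sq {f : Γ.I → ℕ} (hf : PolyComp Γ f) : PolyComp Γ (fun z => f z ^ 2) := by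
  simpa only [sq] using hf.mul hf

theorem polyComp_scale : PolyComp Γ (fun z => scale (Γ.base z)) :=
  ((PolyComp.const 4).mul (polyComp_sq polyComp_nodes)).mul polyComp_precision

theorem polyComp_samples : PolyComp Γ (fun z => samples (Γ.base z)) :=
  ((PolyComp.const 288).mul (polyComp_sq polyComp_nodes)).mul (polyComp_sq polyComp_precision)

variable {i j k l v s w t u y p β a : Γ.I → ℕ}

theorem polyComp_cell {b : ℕ} (hb : b < 4) (hk : PolyComp Γ k) :
    PolyComp Γ (fun z => cell (Γ.base z) b (k z)) :=
  .array b hk (PolyBdd.size.mono fun z => (size_cell_le _ hb _).trans (Γ.base_le z))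
    fun _ => natCast_cell _ hb _

theorem polyComp_probDen : PolyComp Γ (fun z => probDen (Γ.base z)) :=
  .prod (F := fun z k => cell (Γ.base z) 3 k) (polyComp_nodes.mul polyComp_points)
    (polyBdd_nodes.mul polyBdd_points) (polyComp_cell (Γ := Γ.ext) (by decide) .var)

theorem polyComp_distDen : PolyComp Γ (fun z => distDen (Γ.base z)) :=
  .prod (F := fun z k => cell (Γ.base z) 1 k) (polyComp_points.mul polyComp_points)
    (polyBdd_points.mul polyBdd_points) (polyComp_cell (Γ := Γ.ext) (by decide) .var)

theorem polyComp_prob (hv : PolyComp Γ v) (hs : PolyComp Γ s) :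
    PolyComp Γ (fun z => prob (Γ.base z) (v z) (s z)) :=
  have h := (hv.mul polyComp_points).add hs
  (polyComp_cell (by decide) h).mul (polyComp_probDen.div (polyComp_cell (by decide) h))

theorem polyComp_dist (hs : PolyComp Γ s) (ht : PolyComp Γ t) :
    PolyComp Γ (fun z => dist (Γ.base z) (s z) (t z)) :=
  have h := (hs.mul polyComp_points).add ht
  (polyComp_cell (by decide) h).mul (polyComp_distDen.div (polyComp_cell (by decide) h))

theorem polyComp_mass (hv : PolyComp Γ v) (hs : PolyComp Γ s) (hw : PolyComp Γ w)
    (ht : PolyComp Γ t) (hu : PolyComp Γ u) (hp : PolyComp Γ p) : PolyComp Γ (fun z =>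
      Ticket.mass (dist (Γ.base z)) (prob (Γ.base z)) (v z) (s z) (w z) (t z) (u z) (p z)) :=
  .ite (.eq hu hv) (.ite (.eq hp hs) (polyComp_prob hu hp) (.const 0))
    (.ite (.eq hu hw) (.ite (.eq hp ht) (polyComp_prob hu hp) (.const 0))
      (.ite (.le (polyComp_dist hs ht) (polyComp_dist hs hp)) (polyComp_prob hu hp) (.const 0)))

theorem polyComp_weight (hv : PolyComp Γ v) (hs : PolyComp Γ s) (hw : PolyComp Γ w)
    (ht : PolyComp Γ t) : PolyComp Γ (fun z => Ticket.weight (nodes (Γ.base z)) (points (Γ.base z))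
      (dist (Γ.base z)) (prob (Γ.base z)) (v z) (s z) (w z) (t z)) := by
  refine .ite (.eq hv hw) (.const 0) ((polyComp_dist hs ht).mul ?_)
  refine .prod polyComp_nodes polyBdd_nodes ?_
  refine .sum (Γ := Γ.ext) polyComp_points polyBdd_points ?_
  exact polyComp_mass (Γ := Γ.ext.ext) hv.weaken.weaken hs.weaken.weaken hw.weaken.weaken
    ht.weaken.weaken PolyComp.var.weaken .var

theorem polyComp_codedWeight (hj : PolyComp Γ j) : PolyComp Γ (fun z => Ticket.codedWeight
    (nodes (Γ.base z)) (points (Γ.base z)) (dist (Γ.base z)) (prob (Γ.base z)) (j z)) :=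
  have hm := polyComp_points (Γ := Γ)
  have hn := polyComp_nodes (Γ := Γ)
  polyComp_weight (((hj.div hm).div hn).div hm) (((hj.div hm).div hn).mod hm)
    ((hj.div hm).mod hn) (hj.mod hm)

theorem polyComp_codedMass (hj : PolyComp Γ j) (hu : PolyComp Γ u) (hp : PolyComp Γ p) :
    PolyComp Γ (fun z => Ticket.codedMass (nodes (Γ.base z)) (points (Γ.base z)) (dist (Γ.base z))
      (prob (Γ.base z)) (j z) (u z) (p z)) :=
  have hm := polyComp_points (Γ := Γ)
  have hn := polyComp_nodes (Γ := Γ)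
  polyComp_mass (((hj.div hm).div hn).div hm) (((hj.div hm).div hn).mod hm)
    ((hj.div hm).mod hn) (hj.mod hm) hu hp

theorem polyComp_blocks : PolyComp Γ (fun z => nodes (Γ.base z) * points (Γ.base z) *
    nodes (Γ.base z) * points (Γ.base z)) :=
  ((polyComp_nodes.mul polyComp_points).mul polyComp_nodes).mul polyComp_points

theorem polyBdd_blocks : PolyBdd Γ (fun z => nodes (Γ.base z) * points (Γ.base z) *
    nodes (Γ.base z) * points (Γ.base z)) :=
  ((polyBdd_nodes.mul polyBdd_points).mul polyBdd_nodes).mul polyBdd_points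

theorem polyComp_tickets : PolyComp Γ (fun z => tickets (Γ.base z)) :=
  .sum polyComp_blocks polyBdd_blocks (polyComp_codedWeight (Γ := Γ.ext) .var)

section Generic

variable {b : Γ.I → ℕ} {F : Γ.I → ℕ → ℕ}

theorem polyComp_pick (hb : PolyComp Γ b) (hbb : PolyBdd Γ b)
    (hF : PolyComp Γ.ext (fun z => F z.1 z.2)) (hy : PolyComp Γ y) :
    PolyComp Γ (fun z => Ticket.pick (b z) (F z) (y z)) :=
  .first hb hbb (.lt hy.weaken
    (.sum (Γ := Γ.ext) (F := fun z i => F z.1 i) ((PolyComp.var.add (.const 1)).min hb.weaken)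
      (hbb.weaken.mono fun _ => min_le_right _ _) hF.exchange))

theorem polyComp_rest (hb : PolyComp Γ b) (hbb : PolyBdd Γ b)
    (hF : PolyComp Γ.ext (fun z => F z.1 z.2)) (hy : PolyComp Γ y) :
    PolyComp Γ (fun z => Ticket.rest (b z) (F z) (y z)) :=
  hy.sub (.sum ((polyComp_pick hb hbb hF hy).min hb) (hbb.mono fun _ => min_le_right _ _) hF)

theorem polyComp_digit (hb : PolyComp Γ b) (hbb : PolyBdd Γ b)
    (hF : PolyComp Γ.ext (fun z => F z.1 z.2)) (hy : PolyComp Γ y) (hu : PolyComp Γ u)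
    (hFu : PolyComp Γ (fun z => F z (u z))) :
    PolyComp Γ (fun z => Ticket.digit (b z) (F z) (y z) (u z)) :=
  (hy.div (.prod (hu.min hb) (hbb.mono fun _ => min_le_right _ _) hF)).mod hFu

end Generic

theorem polyComp_place (hy : PolyComp Γ y) (hu : PolyComp Γ u) :
    PolyComp Γ (fun z => place (Γ.base z) (y z) (u z)) := by
  have hJ := polyComp_pick (F := fun z => Ticket.codedWeight (nodes (Γ.base z)) (points (Γ.base z))
    (dist (Γ.base z)) (prob (Γ.base z))) polyComp_blocks polyBdd_blocks
    (polyComp_codedWeight (Γ := Γ.ext) .var) hy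
  have hR := polyComp_rest (F := fun z => Ticket.codedWeight (nodes (Γ.base z)) (points (Γ.base z))
    (dist (Γ.base z)) (prob (Γ.base z))) polyComp_blocks polyBdd_blocks
    (polyComp_codedWeight (Γ := Γ.ext) .var) hy
  refine polyComp_pick polyComp_points polyBdd_points
    (polyComp_codedMass (Γ := Γ.ext) hJ.weaken hu.weaken .var) ?_
  refine polyComp_digit polyComp_nodes polyBdd_nodes ?_ hR hu ?_
  · exact .sum (Γ := Γ.ext) polyComp_points polyBdd_points
      (polyComp_codedMass (Γ := Γ.ext.ext) hJ.weaken.weaken PolyComp.var.weaken .var)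
  · exact .sum polyComp_points polyBdd_points
      (polyComp_codedMass (Γ := Γ.ext) hJ.weaken hu.weaken .var)

theorem polyComp_length (hy : PolyComp Γ y) (hi : PolyComp Γ i) (hj : PolyComp Γ j) :
    PolyComp Γ (fun z => dist (Γ.base z) (place (Γ.base z) (y z) (i z))
      (place (Γ.base z) (y z) (j z))) :=
  polyComp_dist (polyComp_place hy hi) (polyComp_place hy hj)

theorem polyComp_nearTotal (hy : PolyComp Γ y) :
    PolyComp Γ (fun z => nearTotal (Γ.base z) (y z)) := by
  refine .sum polyComp_nodes polyBdd_nodes ?_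
  refine .sum (Γ := Γ.ext) polyComp_nodes polyBdd_nodes ?_
  have hv : PolyComp Γ.ext.ext (fun z => z.1.2) := PolyComp.var.weaken
  have hw : PolyComp Γ.ext.ext (fun z => z.2) := .var
  have hy' : PolyComp Γ.ext.ext (fun z => y z.1.1) := hy.weaken.weaken
  refine .ite (.and (.not (.eq hv hw)) (.ball polyComp_nodes polyBdd_nodes (.imp
    (.not (.eq .var hv.weaken)) (.le ?_ ?_)))) (polyComp_length hy' hv hw) (.const 0)
  · exact polyComp_length hy'.weaken hv.weaken hw.weaken
  · exact polyComp_length hy'.weaken hv.weaken .var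

/-- The costs in the auction for ticket `y`. -/
def auctionCost (x : source.X) (y : ℕ) : ℕ → ℕ → ℕ :=
  Auction.cost (scale x) (nearTotal x y) (fun i j => dist x (place x y i) (place x y j))

/-- The base of the encoding of the states of the auction. -/
def auctionBase (x : source.X) : ℕ := 2 * scale x + nodes x + 2

theorem polyComp_auctionCost (hy : PolyComp Γ y) (hi : PolyComp Γ i) (hj : PolyComp Γ j) :
    PolyComp Γ (fun z => auctionCost (Γ.base z) (y z) (i z) (j z)) :=
  have h2 := (PolyComp.const 2).mul (polyComp_scale (Γ := Γ))
  .ite (.eq hi hj) h2 (.min ((polyComp_scale.mul (polyComp_length hy hi hj)).div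
    (polyComp_nearTotal hy)) h2)

theorem polyComp_auctionBase : PolyComp Γ (fun z => auctionBase (Γ.base z)) :=
  (((PolyComp.const 2).mul polyComp_scale).add polyComp_nodes).add (.const 2)

theorem polyComp_two_mul_nodes : PolyComp Γ (fun z => 2 * nodes (Γ.base z)) :=
  (PolyComp.const 2).mul polyComp_nodes

theorem polyBdd_two_mul_nodes : PolyBdd Γ (fun z => 2 * nodes (Γ.base z)) :=
  (PolyBdd.const 2).mul polyBdd_nodes

theorem polyComp_decode (ha : PolyComp Γ a) (hl : PolyComp Γ l) : PolyComp Γ (fun z =>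
    Auction.decode (nodes (Γ.base z)) (auctionBase (Γ.base z)) (a z) (l z)) :=
  (ha.div (.pow polyComp_two_mul_nodes polyBdd_two_mul_nodes polyComp_auctionBase hl)).mod
    polyComp_auctionBase

theorem polyComp_bidder (ha : PolyComp Γ a) : PolyComp Γ (fun z => Auction.bidder (nodes (Γ.base z))
    (Auction.decode (nodes (Γ.base z)) (auctionBase (Γ.base z)) (a z))) := by
  refine .first polyComp_nodes polyBdd_nodes (.not ?_)
  refine .bex (Γ := Γ.ext) polyComp_nodes polyBdd_nodes (.eq ?_ (PolyComp.var.weaken.add (.const 1)))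
  exact polyComp_decode (Γ := Γ.ext.ext) ha.weaken.weaken (polyComp_nodes.add .var)

theorem polyComp_target (hy : PolyComp Γ y) (ha : PolyComp Γ a) (hi : PolyComp Γ i) :
    PolyComp Γ (fun z => Auction.target (nodes (Γ.base z)) (auctionCost (Γ.base z) (y z))
      (Auction.decode (nodes (Γ.base z)) (auctionBase (Γ.base z)) (a z)) (i z)) := by
  refine .first polyComp_nodes polyBdd_nodes ?_
  refine .ball (Γ := Γ.ext) polyComp_nodes polyBdd_nodes ?_
  have hj : PolyComp Γ.ext.ext (fun z => z.1.2) := PolyComp.var.weaken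
  have hy' : PolyComp Γ.ext.ext (fun z => y z.1.1) := hy.weaken.weaken
  have ha' : PolyComp Γ.ext.ext (fun z => a z.1.1) := ha.weaken.weaken
  have hi' : PolyComp Γ.ext.ext (fun z => i z.1.1) := hi.weaken.weaken
  exact .le ((polyComp_auctionCost hy' hi' hj).add (polyComp_decode ha' hj))
    ((polyComp_auctionCost hy' hi' .var).add (polyComp_decode ha' .var))

theorem polyComp_bid (hy : PolyComp Γ y) (ha : PolyComp Γ a) (hl : PolyComp Γ l) :
    PolyComp Γ (fun z => Auction.bid (nodes (Γ.base z)) (auctionCost (Γ.base z) (y z))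
      (Auction.decode (nodes (Γ.base z)) (auctionBase (Γ.base z)) (a z)) (l z)) :=
  have hb := polyComp_bidder ha
  have ht := polyComp_target hy ha hb
  have hd := polyComp_decode ha hl
  .ite (.lt hb polyComp_nodes) (.ite (.eq hl ht) (hd.add (.const 1))
    (.ite (.eq hl (polyComp_nodes.add ht)) (hb.add (.const 1)) hd)) hd

theorem polyComp_bidCode (hy : PolyComp Γ y) (ha : PolyComp Γ a) :
    PolyComp Γ (fun z => Auction.bidCode (nodes (Γ.base z)) (auctionCost (Γ.base z) (y z))
      (auctionBase (Γ.base z)) (a z)) := by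
  refine .sum polyComp_two_mul_nodes polyBdd_two_mul_nodes ?_
  exact ((polyComp_bid (Γ := Γ.ext) hy.weaken ha.weaken .var).mod polyComp_auctionBase).mul
    (.pow polyComp_two_mul_nodes polyBdd_two_mul_nodes polyComp_auctionBase .var)

theorem size_bidCode_le (n : ℕ) (c : ℕ → ℕ → ℕ) {β : ℕ} (hβ : 0 < β) (a : ℕ) :
    (Auction.bidCode n c β a).size ≤ 2 * n + (β.size + (2 * n * β.size + 1)) + 1 := by
  refine size_sum_range_le _ _ _ fun l _ => (size_mul_le _ _).trans (Nat.add_le_add ?_ ?_)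
  · exact Nat.size_le_size (Nat.mod_lt _ hβ).le
  · have h1 : β ^ min l (2 * n) = ∏ _i ∈ range (min l (2 * n)), β := by simp
    rw [h1]
    refine (size_prod_le _ _).trans ?_
    simp only [sum_const, card_range, smul_eq_mul]
    exact Nat.succ_le_succ (Nat.mul_le_mul_right _ (min_le_right _ _))

theorem polyComp_run (hy : PolyComp Γ y) : PolyComp Γ (fun z => Auction.run (nodes (Γ.base z))
    (auctionCost (Γ.base z) (y z)) (auctionBase (Γ.base z))
    (nodes (Γ.base z) * (2 * scale (Γ.base z) + 1) + 1)) := by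
  have hb : PolyBdd Γ (fun z => auctionBase (Γ.base z)) :=
    (((PolyBdd.const 2).mul polyBdd_scale).add polyBdd_nodes).add (.const 2)
  refine .iter (f := fun _ => 0) (step := fun z _ a => Auction.bidCode (nodes (Γ.base z))
      (auctionCost (Γ.base z) (y z)) (auctionBase (Γ.base z)) a)
    ((polyComp_nodes.mul (((PolyComp.const 2).mul polyComp_scale).add (.const 1))).add (.const 1))
    ((polyBdd_nodes.mul (((PolyBdd.const 2).mul polyBdd_scale).add (.const 1))).add (.const 1))
    (.const 0) (polyComp_bidCode (Γ := Γ.ext.ext) hy.weaken.weaken .var)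
    (((polyBdd_two_mul_nodes (Γ := Γ)).add (hb.natSize.add
      ((polyBdd_two_mul_nodes.mul hb.natSize).add (.const 1)))).add (.const 1)) fun z i _ => ?_
  cases i with
  | zero => simp
  | succ i => exact size_bidCode_le _ _ (Nat.succ_pos _) _

theorem polyComp_sampleValue (hy : PolyComp Γ y) :
    PolyComp Γ (fun z => sampleValue (Γ.base z) (y z)) := by
  refine .sum polyComp_nodes polyBdd_nodes ?_
  have hy' : PolyComp Γ.ext (fun z => y z.1) := hy.weaken
  exact polyComp_auctionCost hy' ((polyComp_decode (Γ := Γ.ext) (polyComp_run hy')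
    (polyComp_nodes.add .var)).sub (.const 1)) .var

theorem polyComp_outNum (hy : PolyComp Γ y) : PolyComp Γ (fun z => outNum (Γ.base z) (y z)) := by
  refine PolyComp.mul (.sum polyComp_samples polyBdd_samples ?_) polyComp_tickets
  exact polyComp_sampleValue (Γ := Γ.ext) (((hy.weaken).div (.pow polyComp_samples polyBdd_samples
    polyComp_tickets .var)).mod polyComp_tickets)

theorem polyComp_outDen : PolyComp Γ (fun z => outDen (Γ.base z)) :=
  have h := PolyComp.pow (Γ := Γ) polyComp_nodes polyBdd_nodes polyComp_probDen polyComp_nodes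
  (polyComp_samples.mul polyComp_scale).mul (PolyComp.mul (by simpa only [min_self] using h)
    polyComp_distDen)

theorem polyComp_coinCount : PolyComp Γ (fun z => coinCount (Γ.base z)) :=
  (polyComp_samples.mul polyComp_tickets.size).add (.const 3)

theorem polyBdd_coinCount : PolyBdd Γ (fun z => coinCount (Γ.base z)) :=
  (polyBdd_samples.mul polyComp_tickets.1).add (.const 3)

end PolyComp

end CycleCoverScheme

/-! ### Correctness of the output -/

namespace CycleCoverScheme

open Finset RAM StochasticGraph CycleCover

section Correct

variable (x : source.X)

theorem two_le_nodes : 2 ≤ nodes x := x.1.1.two_le_n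

theorem cast_mul_div (q : ℚ) (hq : 0 ≤ q) {D : ℕ} (hD : q.den ∣ D) :
    ((q.num.toNat * (D / q.den) : ℕ) : ℚ) = D * q := by
  have h2 : ((q.num.toNat : ℕ) : ℚ) = q.num := by
    have : (q.num.toNat : ℤ) = q.num := Int.toNat_of_nonneg (Rat.num_nonneg.2 hq)
    exact_mod_cast this
  have h3 : (q.den : ℚ) ≠ 0 := by exact_mod_cast q.den_nz
  rw [Nat.cast_mul, h2, Nat.cast_div hD h3]
  conv_rhs => rw [← Rat.num_div_den q]
  field_simp

theorem cell_num_d (s t : Fin x.1.1.m) :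
    cell x 0 ((s : ℕ) * points x + t) = (x.1.1.d s t).num.toNat :=
  congrArg Int.toNat (table_mul_add (fun s t => (x.1.1.d s t).num) s t)

theorem cell_den_d (s t : Fin x.1.1.m) :
    cell x 1 ((s : ℕ) * points x + t) = (x.1.1.d s t).den :=
  congrArg Int.toNat (table_mul_add (fun s t => ((x.1.1.d s t).den : ℤ)) s t)

theorem cell_num_p (v : Fin x.1.1.n) (s : Fin x.1.1.m) :
    cell x 2 ((v : ℕ) * points x + s) = (x.1.1.p v s).num.toNat :=
  congrArg Int.toNat (table_mul_add (fun v s => (x.1.1.p v s).num) v s)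

theorem cell_den_p (v : Fin x.1.1.n) (s : Fin x.1.1.m) :
    cell x 3 ((v : ℕ) * points x + s) = (x.1.1.p v s).den :=
  congrArg Int.toNat (table_mul_add (fun v s => ((x.1.1.p v s).den : ℤ)) v s)

theorem cast_dist (s t : Fin x.1.1.m) : (dist x s t : ℚ) = distDen x * x.1.1.d s t := by
  rw [dist, cell_num_d, cell_den_d]
  refine cast_mul_div _ (dist_nonneg _ _ _) ?_
  rw [← cell_den_d]
  exact dvd_prod_of_mem _ (mem_range.2 (index_lt s t))

theorem cast_prob (v : Fin x.1.1.n) (s : Fin x.1.1.m) :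
    (prob x v s : ℚ) = probDen x * x.1.1.p v s := by
  rw [prob, cell_num_p, cell_den_p]
  refine cast_mul_div _ (x.1.1.p_nonneg _ _) ?_
  rw [← cell_den_p]
  exact dvd_prod_of_mem _ (mem_range.2 (index_lt v s))

theorem exists_index {a b k : ℕ} (hk : k < a * b) :
    ∃ (v : Fin a) (s : Fin b), k = (v : ℕ) * b + s := by
  refine ⟨(finProdFinEquiv.symm ⟨k, hk⟩).1, (finProdFinEquiv.symm ⟨k, hk⟩).2, ?_⟩
  have h := congrArg Fin.val (finProdFinEquiv.apply_symm_apply (⟨k, hk⟩ : Fin (a * b)))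
  rw [finProdFinEquiv_apply_val] at h
  refine h.symm.trans ?_
  ring

theorem probDen_pos : 0 < probDen x := by
  refine prod_pos fun k hk => ?_
  obtain ⟨v, s, rfl⟩ := exists_index (a := x.1.1.n) (b := x.1.1.m) (mem_range.1 hk)
  exact (Rat.den_pos _).trans_eq (cell_den_p x v s).symm

theorem distDen_pos : 0 < distDen x := by
  refine prod_pos fun k hk => ?_
  obtain ⟨v, s, rfl⟩ := exists_index (a := x.1.1.m) (b := x.1.1.m) (mem_range.1 hk)
  exact (Rat.den_pos _).trans_eq (cell_den_d x v s).symm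

theorem dist_comm (s t : Fin x.1.1.m) : dist x s t = dist x t s := by
  have h : (dist x s t : ℚ) = dist x t s := by
    rw [cast_dist, cast_dist, x.1.1.d_comm]
  exact_mod_cast h

theorem dist_triangle (s t u : Fin x.1.1.m) : dist x s u ≤ dist x s t + dist x t u := by
  have h : (dist x s u : ℚ) ≤ dist x s t + dist x t u := by
    rw [cast_dist, cast_dist, cast_dist, ← mul_add]
    exact mul_le_mul_of_nonneg_left (x.1.1.d_triangle s t u) (Nat.cast_nonneg _)
  exact_mod_cast h

/-- The minimum length of a cycle cover of the realization `r`, times `distDen x`. -/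
noncomputable def minCover (r : Fin (nodes x) → ℕ) : ℕ :=
  minDerangement (fun v w => dist x (r v) (r w))

theorem cast_minCover (r : Fin x.1.1.n → Fin x.1.1.m) :
    (minCover x (fun v => r v) : ℝ) = distDen x * x.1.1.minCycleCover r :=
  (mul_iInf_coverLength _ _ _ (distDen_pos x) (fun u v => cast_dist x (r u) (r v))
    (exists_derangement (two_le_nodes x))).symm

theorem minCover_le {r : Fin (nodes x) → ℕ} (hr : ∀ u, r u < points x) :
    minCover x r ≤ 2 * Ticket.nearSum (dist x) r :=
  minDerangement_le_nearSum (two_le_nodes x)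
    (fun u v => dist_comm x ⟨_, hr u⟩ ⟨_, hr v⟩)
    (fun u v w => dist_triangle x ⟨_, hr u⟩ ⟨_, hr v⟩ ⟨_, hr w⟩)

/-- The factor between probabilities and lengths and their integral versions. -/
noncomputable def factor : ℝ := probDen x ^ nodes x * distDen x

theorem factor_pos : 0 < factor x := by
  have h1 : (0 : ℝ) < probDen x := by exact_mod_cast probDen_pos x
  have h2 : (0 : ℝ) < distDen x := by exact_mod_cast distDen_pos x
  unfold factor
  positivity

/-- The realization of ticket `y`. -/
def realization (y : ℕ) : Fin (nodes x) → ℕ := fun u => place x y u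

/-- The expectation is an average over the tickets. -/
theorem sum_ratio : ∑ y ∈ range (tickets x),
    (minCover x (realization x y) : ℝ) / Ticket.nearSum (dist x) (realization x y) =
      factor x * x.1.1.expectedCycleCover := by
  have h := Ticket.sum_tickets (nodes x) (points x) (dist x) (prob x)
    (fun r => (minCover x r : ℝ) / Ticket.nearSum (dist x) r)
  refine h.trans ?_
  rw [expectedCycleCover, mul_sum]
  refine sum_congr rfl fun r _ => ?_
  have h1 : (∏ u : Fin (nodes x), (prob x u (r u) : ℝ)) =
      probDen x ^ nodes x * ∏ v, (x.1.1.p v (r v) : ℝ) := by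
    have : ∀ u : Fin (nodes x), (prob x u (r u) : ℝ) = probDen x * (x.1.1.p u (r u) : ℝ) :=
      fun u => by exact_mod_cast congrArg (Rat.cast (K := ℝ)) (cast_prob x u (r u))
    simp only [this, prod_mul_distrib, prod_const, card_univ, Fintype.card_fin]
    rfl
  have h2 := cast_minCover x r
  have h3 : (Ticket.nearSum (dist x) (fun u => (r u : ℕ)) : ℝ) *
      ((minCover x (fun u => r u) : ℝ) / Ticket.nearSum (dist x) (fun u => (r u : ℕ))) =
      minCover x (fun u => r u) := by
    rcases Nat.eq_zero_or_pos (Ticket.nearSum (dist x) (fun u => (r u : ℕ))) with h0 | h0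
    · have := minCover_le x (r := fun u => r u) fun u => (r u).2
      rw [h0] at this ⊢
      have : minCover x (fun u => r u) = 0 := by omega
      rw [this]
      simp
    · exact mul_div_cancel₀ _ (by exact_mod_cast h0.ne')
  rw [mul_assoc, h3, h1, h2, factor]
  ring

/-- Every ticket belongs to a realization whose cycle covers have positive length. -/
theorem realization_spec {y : ℕ} (hy : y < tickets x) : (∀ u, realization x y u < points x) ∧
    0 < Ticket.nearSum (dist x) (realization x y) := by
  classical
  have h := Ticket.sum_tickets (nodes x) (points x) (dist x) (prob x)
    (fun r => if (∀ u, r u < points x) ∧ 0 < Ticket.nearSum (dist x) r then 0 else 1)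
  rw [sum_eq_zero (s := univ) fun r _ => ?_] at h
  · have h2 := (sum_eq_zero_iff_of_nonneg fun _ _ => by split_ifs <;> norm_num).1 h y
      (mem_range.2 hy)
    by_contra hcon
    exact one_ne_zero ((if_neg hcon).symm.trans h2)
  · by_cases h0 : 0 < Ticket.nearSum (dist x) (fun u => (r u : ℕ))
    · rw [if_pos ⟨fun u => (r u).2, h0⟩, mul_zero]
    · rw [Nat.eq_zero_of_not_pos h0]
      simp

theorem nearTotal_eq (y : ℕ) :
    nearTotal x y = Ticket.nearSum (dist x) (realization x y) := by
  rw [nearTotal, Ticket.nearSum, sum_range]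
  refine sum_congr rfl fun v _ => ?_
  rw [sum_range]
  refine sum_congr rfl fun w _ => ?_
  refine if_congr ?_ rfl rfl
  refine and_congr (not_congr Fin.val_inj) ⟨fun h u hu => h u u.2 fun e => hu (Fin.ext e),
    fun h u hu hne => h ⟨u, hu⟩ fun e => hne (congrArg Fin.val e)⟩

theorem sampleValue_spec {y : ℕ} (hy : y < tickets x) :
    1 / (nodes x : ℝ) ≤
      (minCover x (realization x y) : ℝ) / Ticket.nearSum (dist x) (realization x y) ∧
    sampleValue x y ≤ 2 * scale x + nodes x ∧
    |(sampleValue x y : ℝ) - scale x *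
      ((minCover x (realization x y) : ℝ) / Ticket.nearSum (dist x) (realization x y))| ≤
      nodes x := by
  obtain ⟨hr, hZ⟩ := realization_spec x hy
  obtain ⟨h1, h2, h3⟩ := Auction.approxCover_spec (n := nodes x) (S := scale x)
    (fun i j => dist x (place x y i) (place x y j)) hZ (exists_derangement (two_le_nodes x))
    (minCover_le x hr)
  rw [← nearTotal_eq] at hZ h1 h2 h3 ⊢
  have hn : (0 : ℝ) < nodes x := by exact_mod_cast (two_le_nodes x).trans' (by norm_num)
  have hZ' : (0 : ℝ) < nearTotal x y := by exact_mod_cast hZ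
  refine ⟨?_, h3, ?_⟩
  · rw [div_le_div_iff₀ hn hZ', one_mul, nearTotal_eq, mul_comm]
    exact_mod_cast nearSum_le (r := realization x y) (δ := dist x) (two_le_nodes x)
  · have h1 : (sampleValue x y * nearTotal x y : ℝ) ≤
        scale x * minCover x (realization x y) + nodes x * nearTotal x y := by exact_mod_cast h1
    have h2 : (scale x * minCover x (realization x y) : ℝ) ≤
        sampleValue x y * nearTotal x y + nodes x * nearTotal x y := by exact_mod_cast h2
    rw [← mul_div_assoc, abs_le]
    constructor
    · rw [neg_le_sub_iff_le_add, div_le_iff₀ hZ', add_mul]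
      exact h2
    · rw [sub_le_iff_le_add, ← sub_le_iff_le_add', le_div_iff₀ hZ', sub_mul]
      linarith

/-- The output is accurate for at least three quarters of the values of the random number. -/
theorem le_card_good :
    (3 / 4 : ℝ) * 2 ^ coinCount x ≤ #{R ∈ range (2 ^ coinCount x) |
      |(outNum x R : ℝ) / outDen x - x.1.1.expectedCycleCover| ≤
        x.1.2 * x.1.1.expectedCycleCover} := by
  set E := x.1.1.expectedCycleCover with hE
  have hsum := sum_ratio x
  rw [← hE] at hsum
  have hF := factor_pos x
  rcases Nat.eq_zero_or_pos (tickets x) with hM | hM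
  · have hE0 : E = 0 := by
      rw [hM, range_zero, sum_empty] at hsum
      exact (mul_eq_zero.1 hsum.symm).resolve_left hF.ne'
    rw [filter_true_of_mem]
    · rw [card_range]
      push_cast
      linarith [pow_pos (two_pos (α := ℝ)) (coinCount x)]
    · intro R _
      simp [outNum, hM, hE0]
  have hh : 0 < precision x := Nat.succ_pos _
  have hn : 0 < nodes x := (two_le_nodes x).trans' (by norm_num)
  have hM' : (0 : ℝ) < tickets x := by exact_mod_cast hM
  have hQ : 8 * tickets x ^ samples x ≤ 2 ^ coinCount x := by
    have := Nat.pow_le_pow_left (Nat.lt_size_self (tickets x)).le (samples x)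
    rw [← pow_mul, mul_comm] at this
    rw [coinCount, pow_add]
    omega
  have hμ : ∑ y ∈ range (tickets x),
      (minCover x (realization x y) : ℝ) / Ticket.nearSum (dist x) (realization x y) =
      tickets x * (factor x * E / tickets x) := by
    rw [hsum, mul_div_cancel₀ _ hM'.ne']
  refine (Sampling.le_card_accurate (S := scale x) (N := samples x) hn hh hM rfl rfl hQ (sampleValue x) _
    (fun y hy => (sampleValue_spec x hy).1) (fun y hy => (sampleValue_spec x hy).2.1)
    (fun y hy => (sampleValue_spec x hy).2.2) hμ).trans ?_
  refine Nat.cast_le.2 (card_le_card fun R hR => ?_)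
  rw [mem_filter] at hR ⊢
  refine ⟨hR.1, ?_⟩
  have hR := hR.2
  have hN' : (0 : ℝ) < samples x := by
    have : 0 < samples x := by unfold samples; positivity
    exact_mod_cast this
  have hS' : (0 : ℝ) < scale x := by
    have : 0 < scale x := by unfold scale; positivity
    exact_mod_cast this
  have hh' : (0 : ℝ) < precision x := by exact_mod_cast hh
  have hE0 : 0 ≤ E := by
    have : 0 ≤ factor x * E := by
      rw [← hsum]
      exact sum_nonneg fun _ _ => by positivity
    exact nonneg_of_mul_nonneg_right this hF
  have hden : (outDen x : ℝ) = samples x * scale x * factor x := by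
    rw [outDen, factor]
    push_cast
    ring
  have hnum : (outNum x R : ℝ) =
      ((∑ i ∈ range (samples x), sampleValue x (R / tickets x ^ i % tickets x) : ℕ) : ℝ) *
        tickets x := by
    rw [outNum, Nat.cast_mul, sum_congr rfl fun i hi => by rw [min_eq_left (mem_range.1 hi).le]]
  set W : ℝ := ((∑ i ∈ range (samples x), sampleValue x (R / tickets x ^ i % tickets x) : ℕ) : ℝ)
  have hden0 : (0 : ℝ) < outDen x := by rw [hden]; positivity
  have key : |(outNum x R : ℝ) / outDen x - E| ≤ E / precision x := by
    have e1 : (outNum x R : ℝ) / outDen x - E =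
        (W - samples x * scale x * (factor x * E / tickets x)) * (tickets x / outDen x) := by
      rw [hnum, hden]
      field_simp
    rw [e1, abs_mul, abs_of_pos (div_pos hM' hden0)]
    refine (mul_le_mul_of_nonneg_right hR (div_pos hM' hden0).le).trans (le_of_eq ?_)
    rw [hden]
    field_simp
  refine key.trans ?_
  have hε : 1 / (precision x : ℝ) ≤ x.1.2 := by
    have hpos := Rat.num_pos.2 x.2
    have h2 : ((x.1.2.num.toNat : ℕ) : ℝ) = x.1.2.num := by
      have : (x.1.2.num.toNat : ℤ) = x.1.2.num := Int.toNat_of_nonneg hpos.le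
      exact_mod_cast this
    have h3 : x.1.2.den < precision x * x.1.2.num.toNat := by
      have := Nat.div_add_mod x.1.2.den x.1.2.num.toNat
      have := Nat.mod_lt x.1.2.den (by omega : 0 < x.1.2.num.toNat)
      rw [precision, add_mul, one_mul, mul_comm]
      omega
    have h4 : (x.1.2.den : ℝ) ≤ precision x * x.1.2.num := by
      rw [← h2]
      exact_mod_cast h3.le
    have h5 : (0 : ℝ) < x.1.2.den := by exact_mod_cast x.1.2.den_pos
    have h6 : (x.1.2 : ℝ) = x.1.2.num / x.1.2.den := by
      exact_mod_cast congrArg (Rat.cast (K := ℝ)) (Rat.num_div_den x.1.2).symm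
    rw [h6, div_le_div_iff₀ hh' h5, one_mul, mul_comm]
    exact h4
  calc E / precision x = 1 / (precision x : ℝ) * E := by ring
    _ ≤ x.1.2 * E := mul_le_mul_of_nonneg_right hε hE0

theorem outDen_pos : 0 < outDen x := by
  have h1 := probDen_pos x
  have h2 := distDen_pos x
  have h3 := (two_le_nodes x).trans' (by norm_num : 1 ≤ 2)
  have h4 : 0 < precision x := Nat.succ_pos _
  have h5 : 0 < samples x := by unfold samples; positivity
  have h6 : 0 < scale x := by unfold scale; positivity
  unfold outDen
  positivity

end Correct

end CycleCoverScheme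

/-! ### The approximation scheme -/

theorem mainTheorem3 :
    ∃ c : RAM.Prog, RAM.IsFPRAS StochasticGraph.load StochasticGraph.size
      StochasticGraph.expectedCycleCover c := by
  obtain ⟨c, P, hP⟩ := RAM.exists_randomized_prog CycleCoverScheme.source
    (num := CycleCoverScheme.outNum) (den := fun x _ => CycleCoverScheme.outDen x) (fun _ => rfl)
    (CycleCoverScheme.polyComp_coinCount (Γ := RAM.Ctx.nil _))
    CycleCoverScheme.polyBdd_coinCount
    (CycleCoverScheme.polyComp_outNum (Γ := (RAM.Ctx.nil CycleCoverScheme.source).ext) .var)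
    (CycleCoverScheme.polyComp_outDen (Γ := (RAM.Ctx.nil CycleCoverScheme.source).ext))
  refine ⟨c, P, fun G ε hε T hT => ?_⟩
  let x : CycleCoverScheme.source.X := ⟨(G, ε), hε⟩
  obtain ⟨hQ, hrun⟩ := hP x
  have hT' : P.eval (CycleCoverScheme.source.size x) = T := hT.symm
  rw [hT'] at hQ
  refine ⟨fun w => ?_, ?_⟩
  · obtain ⟨s', t, e, ht, -, -⟩ := hrun (RAM.coins w)
    exact ⟨s', t, e, hT' ▸ ht⟩
  · refine le_trans ?_ (RAM.le_coinProb hQ (good := fun R =>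
      |(CycleCoverScheme.outNum x R : ℝ) / CycleCoverScheme.outDen x - G.expectedCycleCover| ≤
        ε * G.expectedCycleCover) fun w hw => ?_)
    · rw [le_div_iff₀ (by positivity)]
      exact CycleCoverScheme.le_card_good x
    · obtain ⟨s', t, e, -, h0, h1⟩ := hrun (RAM.coins w)
      let R := RAM.coinNumber (RAM.coins w) (CycleCoverScheme.coinCount x)
      replace h0 : s'.reg 0 = (CycleCoverScheme.outNum x R : ℤ) := h0
      refine ⟨(CycleCoverScheme.outNum x R : ℚ) / CycleCoverScheme.outDen x,
        ⟨s', t, e, ?_, ?_⟩, ?_⟩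
      · rw [h1]
        exact_mod_cast (CycleCoverScheme.outDen_pos x).ne'
      · rw [h0, h1, Int.cast_natCast, Int.cast_natCast]
      · replace hw : |(CycleCoverScheme.outNum x R : ℝ) / CycleCoverScheme.outDen x -
          G.expectedCycleCover| ≤ ε * G.expectedCycleCover := hw
        obtain ⟨h2, h3⟩ := abs_le.1 hw
        push_cast
        constructor <;> linarith
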